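/- Let $\lambda>0$, $\alpha>2$, $\theta>0$ be real and let $m\ge 1$ be an integer. Base stations (BSs) are located at the points $x_0,x_1,\dots$ of a homogeneous Poisson point process $\Phi$ of density $\lambda$ on $\mathbb{R}^2$; independently of $\Phi$, their channel power fading gains $g_{x_i}$ are i.i.d. with law $\Gamma(m,\tfrac1m)$ (shape $m$, scale $1/m$; Nakagami-$m$ fading on all links, i.e. line of sight). The user is at the origin, all BSs have height $0$, and the power received from $x$ is $g_x\|x\|^{-\alpha}$. If the user is served by the BS at $x\in\Phi$, $$\mathrm{SIR}_x=\frac{g_x\|x\|^{-\alpha}}{\sum_{y\in\Phi\setminus\{x\}}g_y\|y\|^{-\alpha}} .$$ The serving BS is the closest one to the origin (closest BS association), respectively one with the highest SIR (strongest BS association); the coverage probability is $\Pr[\mathrm{SIR}_x>\theta]$ for the serving BS $x$. In the unified framework for the two associations, the coverage probability is expressed as $$\mathrm{P}_{\mathrm{cov}}(\theta)=\int_0^\infty \Pr\big[g\,r^{-\alpha}>\theta\, I_{\nu(r)}\big]\,f(r)\,\mathrm{d}r,\qquad I_{\rho}=\sum_{y\in\Phi,\ \|y\|>\rho}g_y\|y\|^{-\alpha},$$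 where $g\sim\Gamma(m,\tfrac1m)$ is independent of $\Phi$ and the $g_{x_i}$, with $f(r)=2\pi\lambda r e^{-\pi\lambda r^2}$, $\nu(r)=r$ for closest and $f(r)=2\pi\lambda r$, $\nu(r)=0$ for strongest BS association. Write $(z)_k=z(z+1)\cdots(z+k-1)$, let ${}_2F_1(a,b,c,z)$ be the Gauss hypergeometric function (for real $z<1$, by analytic continuation of the Gauss series), let $B_{k,j}(z_1,\dots,z_{k-j+1})$ be the incomplete Bell polynomials, and put $$\eta(s,m,r)={}_2F_1\big(m,-\tfrac2\alpha,1-\tfrac2\alpha,-\tfrac{s}{m r^\alpha}\big),\qquad \zeta(m)=-\frac{\Gamma(m+\frac2\alpha)\,\Gamma(-\frac2\alpha)}{\alpha\,\Gamma(m)},$$ $$\psi_k(\theta,m)=-\big(-\tfrac2\alpha\big)_k\Big(\eta(m\theta,m,1)-\sum_{j=1}^{k}\frac{(m)_{k-j}}{(1-\frac2\alpha)_{k-j}}\,\theta^{k-j}(1+\theta)^{-m-k+j}\Big).$$ (a) For closest BS association, the coverage probability $\Pr[\mathrm{SIR}_x>\theta]$ and the unified coverage expression are both equal to the (positive) number $$\frac{1}{\eta(m\theta,m,1)}\bigg(1+\sum_{k=1}^{m-1}\sum_{j=1}^{k}\frac{j!}{k!}\,B_{k,j}\Big(\frac{\psi_1(\theta,m)}{\eta(m\theta,m,1)},\dots,\frac{\psi_{k-j+1}(\theta,m)}{\eta(m\theta,m,1)}\Big)\bigg).$$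 (b) For strongest BS association, the unified coverage expression is equal, for every $m$, to the (positive) Rayleigh value $$\frac{1}{2\,\zeta(1)\,\theta^{2/\alpha}},$$ and, if $\theta\ge 1$, so is the coverage probability $\Pr[\mathrm{SIR}_x>\theta]$. -/

import Mathlib

open MeasureTheory ProbabilityTheory
open scoped ENNReal

noncomputable section

namespace CellularCoverage

/-! ### Special functions -/

/-- `F` is the Gauss hypergeometric function `z ↦ ₂F₁(a, b, c, z)` on the half-line `z < 1`: it is
real-analytic there and is given by the Gauss series for `|z| < 1`. -/
def IsGaussHypergeometric (a b c : ℝ) (F : ℝ → ℝ) : Prop :=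
  AnalyticOnNhd ℝ F (Set.Iio 1) ∧
    ∀ z : ℝ, |z| < 1 → F z = ordinaryHypergeometric a b c z

/-- The analytic continuation of the Gauss series to `z < 1` is unique. -/
theorem IsGaussHypergeometric.eqOn {a b c : ℝ} {F G : ℝ → ℝ}
    (hF : IsGaussHypergeometric a b c F) (hG : IsGaussHypergeometric a b c G) :
    Set.EqOn F G (Set.Iio 1) := by
  refine hF.1.eqOn_of_preconnected_of_eventuallyEq hG.1 isPreconnected_Iio
    (z₀ := 0) (by simp) ?_
  filter_upwards [Metric.ball_mem_nhds (0 : ℝ) one_pos] with z hz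
  have hz' : |z| < 1 := by simpa using hz
  rw [hF.2 z hz', hG.2 z hz']

open Classical in
/-- The Gauss hypergeometric function `₂F₁(a, b, c, z)` for real parameters and real `z < 1`. -/
def gaussHypergeometric (a b c z : ℝ) : ℝ :=
  if h : ∃ F : ℝ → ℝ, IsGaussHypergeometric a b c F then Classical.choose h z else 0

/-- The Pochhammer symbol `(z)_k = z (z + 1) ⋯ (z + k - 1)`. -/
def poch (z : ℝ) (k : ℕ) : ℝ := (ascPochhammer ℝ k).eval z

/-- `η(s, m, r) = ₂F₁(m, -2/α, 1 - 2/α, -s / (m r^α))`. -/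
def eta (α s : ℝ) (m : ℕ) (r : ℝ) : ℝ :=
  gaussHypergeometric m (-(2 / α)) (1 - 2 / α) (-(s / (m * r ^ α)))

/-- `ζ(m) = - Γ(m + 2/α) Γ(-2/α) / (α Γ(m))`. -/
def zeta (α : ℝ) (m : ℕ) : ℝ :=
  -(Real.Gamma (m + 2 / α) * Real.Gamma (-(2 / α)) / (α * Real.Gamma m))

/-- `ψ_k(θ, m)`. -/
def psi (α θ : ℝ) (m k : ℕ) : ℝ :=
  -poch (-(2 / α)) k *
    (eta α (m * θ) m 1 -
      ∑ j ∈ Finset.Icc 1 k,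
        poch m (k - j) / poch (1 - 2 / α) (k - j) * θ ^ (k - j) / (1 + θ) ^ (m + (k - j)))

/-- The incomplete Bell polynomial `B_{k,j}(z₁, z₂, …)`: the sum, over the partitions of a
`k`-element set into `j` nonempty blocks, of the product of `z_{|block|}` over the blocks.
(An `OrderedFinpartition k` is a set partition of `Fin k`; its blocks are listed in the order of
their greatest elements, so that every set partition occurs exactly once.) -/
def bellIncomplete (k j : ℕ) (z : ℕ → ℝ) : ℝ :=
  ∑ c : OrderedFinpartition k with c.length = j, ∏ i, z (c.partSize i)

/-! ### The network -/

/-- The Euclidean plane, with the typical user at the origin. -/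
abbrev Plane := EuclideanSpace ℝ (Fin 2)

variable {Ω : Type*} [MeasurableSpace Ω]

/-- The number of points `X i` that lie in `A`. -/
def pointCount (X : ℕ → Ω → Plane) (A : Set Plane) (ω : Ω) : ℕ∞ :=
  {i | X i ω ∈ A}.encard

/-- The random points `X 0, X 1, …` form a homogeneous Poisson point process of density `lam` on
the plane. -/
structure IsHomogeneousPPP (lam : ℝ) (X : ℕ → Ω → Plane) (P : Measure Ω) : Prop where
  measurable : ∀ i, Measurable (X i)
  poisson_count : ∀ A : Set Plane, MeasurableSet A → volume A < ∞ → ∀ n : ℕ,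
    P {ω | pointCount X A ω = n} =
      poissonMeasure (lam.toNNReal * (volume A).toNNReal) {n}
  indep_count : ∀ (n : ℕ) (A : Fin n → Set Plane),
    (∀ l, MeasurableSet (A l)) → (∀ l, volume (A l) < ∞) →
    Pairwise (Function.onFun Disjoint A) →
    iIndepFun (fun l ω => pointCount X (A l) ω) P

/-- The marked Poisson point process `{(x_i, g_{x_i})}` of base stations and channel power fading
gains under Nakagami-`m` fading: the locations form a homogeneous Poisson point process and,
independently of them, the gains are i.i.d. `Γ(m, 1/m)` (shape `m`, scale `1/m`, i.e. rate `m`). -/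
structure IsLOSNetwork (lam : ℝ) (m : ℕ) (X : ℕ → Ω → Plane) (g : ℕ → Ω → ℝ)
    (P : Measure Ω) : Prop where
  ppp : IsHomogeneousPPP lam X P
  gain_measurable : ∀ i, Measurable (g i)
  gain_law : ∀ i, P.map (g i) = gammaMeasure m m
  gain_indep : iIndepFun g P
  gain_indep_points : IndepFun (fun ω i => g i ω) (fun ω i => X i ω) P

/-- Received power from base station `i` (pathloss `r^{-α}`, height `0`). -/
def rxPower (α : ℝ) (X : ℕ → Ω → Plane) (g : ℕ → Ω → ℝ) (i : ℕ) (ω : Ω) : ℝ≥0∞ :=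
  ENNReal.ofReal (g i ω * ‖X i ω‖ ^ (-α))

/-- Signal-to-interference ratio when the user is served by base station `i`: all the other base
stations interfere. -/
def sir (α : ℝ) (X : ℕ → Ω → Plane) (g : ℕ → Ω → ℝ) (i : ℕ) (ω : Ω) : ℝ≥0∞ :=
  rxPower α X g i ω / ∑' j : {j : ℕ // j ≠ i}, rxPower α X g j ω

/-- The two association policies. -/
inductive Association
  | closest
  | strongest

/-- Base station `i` serves the typical user: no other one is closer, respectively no other one
offers a higher SIR. -/
def IsServing (α : ℝ) (X : ℕ → Ω → Plane) (g : ℕ → Ω → ℝ) (ω : Ω) : Association → ℕ → Prop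
  | .closest, i => ∀ j, ‖X i ω‖ ≤ ‖X j ω‖
  | .strongest, i => ∀ j, sir α X g j ω ≤ sir α X g i ω

/-- The probability that the SIR from the serving base station exceeds `θ`. -/
def coverageProb (assoc : Association) (α θ : ℝ) (X : ℕ → Ω → Plane) (g : ℕ → Ω → ℝ)
    (P : Measure Ω) : ℝ≥0∞ :=
  P {ω | ∃ i, IsServing α X g ω assoc i ∧ ENNReal.ofReal θ < sir α X g i ω}

/-- The weight `f(r)` of the serving distance `r` in the unified framework. -/
def servingDensity (lam : ℝ) : Association → ℝ → ℝ
  | .closest, r => 2 * Real.pi * lam * Real.exp (-(Real.pi * lam * r ^ 2)) * r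
  | .strongest, r => 2 * Real.pi * lam * r

/-- The radius `ν(r)` within which there are no interferers in the unified framework. -/
def exclusionRadius : Association → ℝ → ℝ
  | .closest, r => r
  | .strongest, _ => 0

/-- Aggregate power received from the base stations at distance greater than `ρ`. -/
def interferenceBeyond (α : ℝ) (X : ℕ → Ω → Plane) (g : ℕ → Ω → ℝ) (ρ : ℝ) (ω : Ω) : ℝ≥0∞ :=
  ∑' j : {j : ℕ // ρ < ‖X j ω‖}, rxPower α X g j ω

/-- The unified coverage expression `∫₀^∞ Pr[g r^{-α} / I > θ] f(r) dr`, where `g ∼ Γ(m, 1/m)` is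
the gain of a serving base station at distance `r`, independent of the interference `I` from the
base stations beyond the distance `ν(r)`. -/
def unifiedCoverage (assoc : Association) (lam α θ : ℝ) (m : ℕ) (X : ℕ → Ω → Plane)
    (g : ℕ → Ω → ℝ) (P : Measure Ω) : ℝ≥0∞ :=
  ∫⁻ r in Set.Ioi (0 : ℝ),
    ((gammaMeasure m m).prod P)
        {p : ℝ × Ω | ENNReal.ofReal θ <
          ENNReal.ofReal (p.1 * r ^ (-α)) /
            interferenceBeyond α X g (exclusionRadius assoc r) p.2} *
      ENNReal.ofReal (servingDensity lam assoc r)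

/-- Closed form for closest base station association. -/
def closestClosedForm (α θ : ℝ) (m : ℕ) : ℝ :=
  1 / eta α (m * θ) m 1 *
    (1 + ∑ k ∈ Finset.Icc 1 (m - 1), ∑ j ∈ Finset.Icc 1 k,
      (j.factorial : ℝ) / (k.factorial : ℝ) *
        bellIncomplete k j (fun l => psi α θ m l / eta α (m * θ) m 1))

/-- Closed form for strongest base station association, `1 / (2 ζ(1) θ^{2/α})`. -/
def strongestClosedForm (α θ : ℝ) : ℝ :=
  1 / (2 * zeta α 1 * θ ^ (2 / α))

end CellularCoverage

end

/-!
The proof writes every probability as a Laplace transform and evaluates the transform by polar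
coordinates.

*Point process.* Independence of the counts in disjoint sets gives the Laplace functional
`E[exp (-∑ f(x_i))] = exp (-λ ∫ (1 - e^{-f}))` of the Poisson process
(`IsHomogeneousPPP.laplace`). Its derivative in the direction of a second function, taken along a
dyadic sequence, is the reduced Campbell–Mecke formula for exponential functionals
(`IsHomogeneousPPP.mecke`). Integrating out the gains, and using that finite measures on `[0, ∞]`
are determined by the moments of `e^{-x}`, one obtains Slivnyak's theorem for the network
(`IsLOSNetwork.sum_map_eq_prod`, `IsLOSNetwork.tsum_measure`): summed over the base stations, the
probability of an event about one base station, the total power of the others and the distance to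
the closest of the others equals `λ ∫ dx` of its probability for a base station added at `x` with
an independent gain.

*Closest base station.* The function `F = ₂F₁(m, -2/α, 1 - 2/α, ·)` has an integral representation
on `Re z < 1`, from which the differential equation `x F' = (2/α) (F - (1 - x)^{-m})` follows. This
equation does two things: it makes `-v² (F (-s v^{-α} / m) - 1)` a primitive of the radial
integrand, so that the transform of the interference is an exponential of `F`; and it expresses all
derivatives of `F` at `-θ` through `ψ_k` (`psi_eq`). For a gain `h` of law `Γ(m, 1/m)`,
`Pr[h > Z] = E[∑_{k<m} (m Z)^k / k! e^{-m Z}]`, and each term is a derivative of the transform of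
`Z`; Faà di Bruno's formula turns it into a sum over set partitions (`measure_lt_gamma`). Given that
the serving distance is `r`, this sum depends on `r` through `u = π λ r²` only, and integrating over
`u` gives the Bell polynomials (`setLIntegral_coverageTerm`). The coverage probability itself is the
same integral, by Slivnyak's theorem, since almost surely there is no tie for the closest point.

*Strongest base station.* The total power `I` satisfies `E[e^{-s I}] = exp (-C s^{2/α})` with
`C = λ π Γ(1 - 2/α) E[g^{2/α}]`. Integrating over `r` first turns the unified expression into a
multiple of `E[g^{2/α}] E[I^{-2/α}]`, in which the fading moment cancels
(`IsLOSNetwork.unifiedCoverage_strongest`). For `θ ≥ 1` at most one base station can have an SIR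
above `θ`, so that the coverage probability is a sum over the base stations, to which Slivnyak's
theorem applies.
-/

namespace CellularCoverage

open Filter Topology

variable {Ω : Type*} [MeasurableSpace Ω]

/-! ### The decaying exponential on `[0, ∞]` -/

/-- `e^{-x}` for `x ∈ [0, ∞]`, with `e^{-∞} = 0`. -/
noncomputable def expNeg (x : ℝ≥0∞) : ℝ≥0∞ := EReal.exp (-(x : EReal))

@[simp] lemma expNeg_zero : expNeg 0 = 1 := by simp [expNeg]

@[simp] lemma expNeg_top : expNeg ∞ = 0 := by simp [expNeg]

lemma expNeg_add (x y : ℝ≥0∞) : expNeg (x + y) = expNeg x * expNeg y := by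
  rw [expNeg, expNeg, expNeg, ← EReal.exp_add, EReal.coe_ennreal_add, EReal.neg_add, sub_eq_add_neg]
  · exact Or.inl (by simp)
  · exact Or.inr (by simp)

lemma expNeg_ofReal {x : ℝ} (hx : 0 ≤ x) :
    expNeg (ENNReal.ofReal x) = ENNReal.ofReal (Real.exp (-x)) := by
  rw [expNeg, EReal.coe_ennreal_ofReal, max_eq_left hx, ← EReal.coe_neg, EReal.exp_coe]

lemma expNeg_antitone : Antitone expNeg := fun x y h => by
  unfold expNeg
  exact EReal.exp_monotone (EReal.neg_le_neg_iff.2 (EReal.coe_ennreal_le_coe_ennreal_iff.2 h))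

lemma expNeg_le_one (x : ℝ≥0∞) : expNeg x ≤ 1 := by
  simpa using expNeg_antitone (zero_le (a := x))

lemma expNeg_ne_top (x : ℝ≥0∞) : expNeg x ≠ ∞ := ((expNeg_le_one x).trans_lt ENNReal.one_lt_top).ne

lemma expNeg_injective : Function.Injective expNeg := fun x y h => by
  have := EReal.exp_strictMono.injective h
  simpa using this

@[simp] lemma expNeg_eq_zero {x : ℝ≥0∞} : expNeg x = 0 ↔ x = ∞ := by
  rw [← expNeg_top, expNeg_injective.eq_iff]

lemma continuous_expNeg : Continuous expNeg :=
  ENNReal.continuous_exp.comp (continuous_neg.comp continuous_coe_ennreal_ereal)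

@[fun_prop] lemma measurable_expNeg : Measurable expNeg := continuous_expNeg.measurable

lemma expNeg_sum {ι : Type*} (s : Finset ι) (f : ι → ℝ≥0∞) :
    expNeg (∑ i ∈ s, f i) = ∏ i ∈ s, expNeg (f i) := by
  classical
  induction s using Finset.induction_on with
  | empty => simp
  | insert a s ha ih => rw [Finset.sum_insert ha, Finset.prod_insert ha, expNeg_add, ih]

lemma expNeg_nsmul (n : ℕ) (x : ℝ≥0∞) : expNeg (n * x) = expNeg x ^ n := by
  induction n with
  | zero => simp
  | succ n ih => rw [Nat.cast_succ, add_mul, one_mul, expNeg_add, ih, pow_succ]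

lemma expNeg_toENNReal_neg_log {y : ℝ≥0∞} (hy : y ≤ 1) :
    expNeg (-(ENNReal.log y)).toENNReal = y := by
  have h : 0 ≤ -(ENNReal.log y) := by
    rw [EReal.le_neg, neg_zero]
    simpa using ENNReal.log_monotone hy
  rw [expNeg, EReal.coe_toENNReal h, neg_neg, ENNReal.exp_log]

/-- Monotone limits pass through sums in `[0, ∞]`. -/
lemma tendsto_tsum_of_monotone {ι : Type*} {f : ℕ → ι → ℝ≥0∞} {F : ι → ℝ≥0∞}
    (hf : ∀ i, Monotone fun n => f n i) (hF : ∀ i, Tendsto (fun n => f n i) atTop (𝓝 (F i))) :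
    Tendsto (fun n => ∑' i, f n i) atTop (𝓝 (∑' i, F i)) := by
  let _ : MeasurableSpace ι := ⊤
  simp_rw [← lintegral_count]
  exact lintegral_tendsto_of_tendsto_of_monotone (fun n => measurable_from_top.aemeasurable)
    (Eventually.of_forall hf) (Eventually.of_forall hF)

/-! ### The Laplace functional of a Poisson point process -/

lemma pointCount_toENNReal {Ω : Type*} (X : ℕ → Ω → Plane) (A : Set Plane) (ω : Ω) :
    (pointCount X A ω : ℝ≥0∞) = ∑' i, A.indicator 1 (X i ω) := by
  rw [pointCount, ← ENNReal.tsum_set_one, tsum_subtype {i | X i ω ∈ A} (fun _ => (1 : ℝ≥0∞))]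
  rfl

lemma IsHomogeneousPPP.measurable_tsum {lam : ℝ} {X : ℕ → Ω → Plane} {P : Measure Ω}
    (hX : IsHomogeneousPPP lam X P) {f : Plane → ℝ≥0∞} (hf : Measurable f) :
    Measurable fun ω => ∑' i, f (X i ω) :=
  Measurable.tsum fun i => hf.comp (hX.measurable i)

lemma IsHomogeneousPPP.measurable_pointCount {lam : ℝ} {X : ℕ → Ω → Plane} {P : Measure Ω}
    (hX : IsHomogeneousPPP lam X P) {A : Set Plane} (hA : MeasurableSet A) :
    Measurable (pointCount X A) := by
  have h : Measurable fun ω => (pointCount X A ω : ℝ≥0∞) := by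
    simp_rw [pointCount_toENNReal]
    exact hX.measurable_tsum (measurable_one.indicator hA)
  refine measurable_to_countable' fun n => ?_
  have : pointCount X A ⁻¹' {n} = (fun ω => (pointCount X A ω : ℝ≥0∞)) ⁻¹' {(n : ℝ≥0∞)} := by
    ext ω; simp
  rw [this]
  exact h (measurableSet_singleton _)

/-- The Laplace transform of the Poisson distribution. -/
lemma tsum_poisson_expNeg (ρ c : NNReal) :
    ∑' n : ℕ, poissonMeasure ρ {n} * expNeg (c * n) = expNeg (ρ * (1 - expNeg c)) := by
  have hc : expNeg c = ENNReal.ofReal (Real.exp (-c)) := by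
    rw [← ENNReal.ofReal_coe_nnreal, expNeg_ofReal c.coe_nonneg]
  have h1 : ∀ n : ℕ, poissonMeasure ρ {n} * expNeg (c * n) =
      ENNReal.ofReal (Real.exp (-ρ) * ((ρ * Real.exp (-c)) ^ n / (n.factorial : ℝ))) := by
    intro n
    rw [mul_comm (c : ℝ≥0∞), expNeg_nsmul, hc, poissonMeasure_singleton,
      ← ENNReal.ofReal_pow (Real.exp_nonneg _), ← ENNReal.ofReal_mul (by positivity)]
    congr 1
    rw [mul_pow]; ring
  have h2 : HasSum (fun n : ℕ => Real.exp (-ρ) * ((ρ * Real.exp (-c)) ^ n / (n.factorial : ℝ)))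
      (Real.exp (-ρ) * Real.exp (ρ * Real.exp (-c))) := by
    refine HasSum.mul_left _ ?_
    have h := NormedSpace.expSeries_div_hasSum_exp (𝔸 := ℝ) (ρ * Real.exp (-c))
    rwa [← Real.exp_eq_exp_ℝ] at h
  simp_rw [h1]
  have hle : Real.exp (-(c : ℝ)) ≤ 1 := Real.exp_le_one_iff.2 (by simp)
  rw [← ENNReal.ofReal_tsum_of_nonneg (fun n => by positivity) h2.summable, h2.tsum_eq, hc,
    ← ENNReal.ofReal_one, ← ENNReal.ofReal_sub _ (Real.exp_nonneg _), ← ENNReal.ofReal_coe_nnreal,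
    ← ENNReal.ofReal_mul ρ.coe_nonneg, expNeg_ofReal (mul_nonneg ρ.coe_nonneg (sub_nonneg.2 hle)),
    ← Real.exp_add]
  congr 2
  ring

lemma IsHomogeneousPPP.lintegral_expNeg_pointCount {lam : ℝ} {X : ℕ → Ω → Plane} {P : Measure Ω}
    (hX : IsHomogeneousPPP lam X P) {A : Set Plane} (hA : MeasurableSet A) (hA' : volume A < ∞)
    {c : ℝ≥0∞} (hc : c ≠ 0) (hc' : c ≠ ∞) :
    ∫⁻ ω, expNeg (c * pointCount X A ω) ∂P
      = expNeg (ENNReal.ofReal lam * volume A * (1 - expNeg c)) := by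
  have hm := hX.measurable_pointCount hA
  lift c to NNReal using hc'
  have h1 : ∫⁻ ω, expNeg (c * pointCount X A ω) ∂P
      = ∫⁻ n, expNeg (c * (n : ℕ∞)) ∂(P.map (pointCount X A)) :=
    (lintegral_map (f := fun n : ℕ∞ => expNeg (c * n)) .of_discrete hm).symm
  rw [h1, lintegral_countable' (fun n : ℕ∞ => expNeg (c * n))]
  have h2 : ∑' n : ℕ∞, expNeg (c * n) * (P.map (pointCount X A)) {n}
      = ∑' n : ℕ, poissonMeasure (lam.toNNReal * (volume A).toNNReal) {n} * expNeg (c * n) := by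
    rw [← Function.Injective.tsum_eq (g := ((↑) : ℕ → ℕ∞)) Nat.cast_injective]
    · refine tsum_congr fun n => ?_
      rw [Measure.map_apply hm (measurableSet_singleton _), mul_comm]
      congr 1
      exact hX.poisson_count A hA hA' n
    · intro n hn
      induction n using ENat.recTopCoe with
      | top =>
        refine absurd ?_ hn
        simp [ENNReal.mul_top hc]
      | coe n => exact ⟨n, rfl⟩
  rw [h2, tsum_poisson_expNeg]
  congr 2
  rw [ENNReal.coe_mul, ENNReal.coe_toNNReal hA'.ne]
  rfl

/-- The Laplace functional on simple functions, by independence of the counts in the level sets. -/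
lemma IsHomogeneousPPP.laplace_simpleFunc {lam : ℝ} {X : ℕ → Ω → Plane} {P : Measure Ω}
    (hX : IsHomogeneousPPP lam X P) (f : SimpleFunc Plane ℝ≥0∞) (hf : ∀ x, f x ≠ ∞)
    (hf' : volume {x | f x ≠ 0} < ∞) :
    ∫⁻ ω, expNeg (∑' i, f (X i ω)) ∂P
      = expNeg (ENNReal.ofReal lam * ∫⁻ x, (1 - expNeg (f x))) := by
  classical
  set s : Finset ℝ≥0∞ := f.range.filter (· ≠ 0) with hs
  have hs0 : ∀ c ∈ s, c ≠ 0 := fun c hc => (Finset.mem_filter.1 hc).2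
  have hst : ∀ c ∈ s, c ≠ ∞ := fun c hc => by
    obtain ⟨x, rfl⟩ := SimpleFunc.mem_range.1 (Finset.mem_filter.1 hc).1
    exact hf x
  have hvol : ∀ c ∈ s, volume (f ⁻¹' {c}) < ∞ := fun c hc =>
    (measure_mono (fun x (hx : f x = c) => by
      show f x ≠ 0
      rw [hx]; exact hs0 c hc)).trans_lt hf'
  have hsum : ∀ ω, ∑' i, f (X i ω) = ∑ c ∈ s, c * (pointCount X (f ⁻¹' {c}) ω : ℝ≥0∞) := by
    intro ω
    simp_rw [pointCount_toENNReal, ← ENNReal.tsum_mul_left]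
    rw [← Summable.tsum_finsetSum (fun _ _ => ENNReal.summable)]
    refine tsum_congr fun i => ?_
    by_cases h0 : f (X i ω) = 0
    · rw [h0, Finset.sum_eq_zero]
      intro c hc
      rw [Set.indicator_of_notMem, mul_zero]
      simp only [Set.mem_preimage, Set.mem_singleton_iff, h0]
      exact (hs0 c hc).symm
    · rw [Finset.sum_eq_single (f (X i ω))]
      · rw [Set.indicator_of_mem (by simp)]; simp
      · intro c _ hne
        rw [Set.indicator_of_notMem, mul_zero]
        simpa using hne.symm
      · intro h
        exact absurd (Finset.mem_filter.2 ⟨f.mem_range_self _, h0⟩) h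
  have hind : iIndepFun (fun (c : s) ω => pointCount X (f ⁻¹' {(c : ℝ≥0∞)}) ω) P := by
    have h := hX.indep_count s.card (fun l => f ⁻¹' {((s.equivFin.symm l : s) : ℝ≥0∞)})
      (fun l => f.measurableSet_preimage _) (fun l => hvol _ (s.equivFin.symm l).2)
      (fun a b hab => by
        refine Disjoint.preimage _ (Set.disjoint_singleton.2 fun h => hab ?_)
        exact s.equivFin.symm.injective (Subtype.ext h))
    have := h.precomp s.equivFin.injective
    convert this using 3 with c
    simp
  have hind' : iIndepFun (fun (c : s) ω =>
      expNeg ((c : ℝ≥0∞) * pointCount X (f ⁻¹' {(c : ℝ≥0∞)}) ω)) P :=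
    hind.comp (fun (c : s) (n : ℕ∞) => expNeg ((c : ℝ≥0∞) * n)) (fun _ => .of_discrete)
  have hRHS : ∫⁻ x, (1 - expNeg (f x)) = ∑ c ∈ s, (1 - expNeg c) * volume (f ⁻¹' {c}) := by
    have : ∫⁻ x, (1 - expNeg (f x)) = ∫⁻ x, f.map (fun c => 1 - expNeg c) x := rfl
    rw [this, SimpleFunc.lintegral_eq_lintegral, SimpleFunc.map_lintegral, hs,
      Finset.sum_filter_of_ne]
    intro c _ h h0
    simp [h0] at h
  simp_rw [hsum, expNeg_sum]
  rw [hRHS, Finset.mul_sum, expNeg_sum]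
  calc ∫⁻ ω, ∏ c ∈ s, expNeg (c * pointCount X (f ⁻¹' {c}) ω) ∂P
      = ∫⁻ ω, ∏ c : s, expNeg ((c : ℝ≥0∞) * pointCount X (f ⁻¹' {(c : ℝ≥0∞)}) ω) ∂P := by
        refine lintegral_congr fun ω => ?_
        exact (Finset.prod_coe_sort s (fun c => expNeg (c * pointCount X (f ⁻¹' {c}) ω))).symm
    _ = ∏ c : s, ∫⁻ ω, expNeg ((c : ℝ≥0∞) * pointCount X (f ⁻¹' {(c : ℝ≥0∞)}) ω) ∂P := by
        refine lintegral_prod_eq_prod_lintegral_of_indepFun _ _ hind' fun c => ?_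
        exact (Measurable.of_discrete (f := fun n : ℕ∞ => expNeg ((c : ℝ≥0∞) * n))).comp
          (hX.measurable_pointCount (f.measurableSet_preimage _))
    _ = ∏ c : s, expNeg (ENNReal.ofReal lam * ((1 - expNeg c) * volume (f ⁻¹' {(c : ℝ≥0∞)}))) := by
        refine Finset.prod_congr rfl fun c _ => ?_
        rw [hX.lintegral_expNeg_pointCount (f.measurableSet_preimage _) (hvol c c.2) (hs0 c c.2)
          (hst c c.2), mul_assoc, mul_comm (volume _)]
    _ = _ := Finset.prod_coe_sort s
        (fun c => expNeg (ENNReal.ofReal lam * ((1 - expNeg c) * volume (f ⁻¹' {c}))))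

/-- The Laplace functional of a homogeneous Poisson point process. -/
theorem IsHomogeneousPPP.laplace {lam : ℝ} {X : ℕ → Ω → Plane} {P : Measure Ω}
    [IsProbabilityMeasure P] (hX : IsHomogeneousPPP lam X P)
    {f : Plane → ℝ≥0∞} (hf : Measurable f) :
    ∫⁻ ω, expNeg (∑' i, f (X i ω)) ∂P
      = expNeg (ENNReal.ofReal lam * ∫⁻ x, (1 - expNeg (f x))) := by
  -- Truncation to balls keeps the level sets of the approximations of finite volume.
  set F : ℕ → SimpleFunc Plane ℝ≥0∞ := fun n =>
    (SimpleFunc.eapprox f n).restrict (Metric.ball 0 n) with hF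
  have hFx : ∀ n x, F n x = (Metric.ball (0 : Plane) n).indicator (SimpleFunc.eapprox f n) x :=
    fun n x => by rw [hF]; simp [SimpleFunc.restrict_apply _ measurableSet_ball]
  have hmono : ∀ x, Monotone fun n => F n x := by
    intro x a b hab
    simp only [hFx]
    refine (Set.indicator_le_indicator (SimpleFunc.monotone_eapprox f hab x)).trans ?_
    exact Set.indicator_le_indicator_of_subset
      (Metric.ball_subset_ball (by exact_mod_cast hab)) (fun _ => zero_le) x
  have hlim : ∀ x, Tendsto (fun n => F n x) atTop (𝓝 (f x)) := by
    intro x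
    have h1 : Tendsto (fun n => SimpleFunc.eapprox f n x) atTop (𝓝 (f x)) := by
      rw [← SimpleFunc.iSup_eapprox_apply hf x]
      exact tendsto_atTop_iSup fun a b hab => SimpleFunc.monotone_eapprox f hab x
    refine h1.congr' ?_
    obtain ⟨N, hN⟩ := exists_nat_gt ‖x‖
    filter_upwards [eventually_ge_atTop N] with n hn
    rw [hFx, Set.indicator_of_mem]
    rw [mem_ball_zero_iff]
    exact hN.trans_le (by exact_mod_cast hn)
  have hsimple : ∀ n, ∫⁻ ω, expNeg (∑' i, F n (X i ω)) ∂P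
      = expNeg (ENNReal.ofReal lam * ∫⁻ x, (1 - expNeg (F n x))) := by
    intro n
    refine hX.laplace_simpleFunc (F n) (fun x => ?_) ?_
    · rw [hFx]
      refine ((Set.indicator_le_self _ _ x).trans_lt (SimpleFunc.eapprox_lt_top f n x)).ne
    · refine (measure_mono (t := Metric.ball (0 : Plane) n) fun x hx => ?_).trans_lt
        measure_ball_lt_top
      by_contra h
      exact hx (by rw [hFx, Set.indicator_of_notMem h])
  have hL : Tendsto (fun n => ∫⁻ ω, expNeg (∑' i, F n (X i ω)) ∂P) atTop
      (𝓝 (∫⁻ ω, expNeg (∑' i, f (X i ω)) ∂P)) := by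
    refine tendsto_lintegral_of_dominated_convergence (fun _ => 1)
      (fun n => measurable_expNeg.comp (hX.measurable_tsum (F n).measurable))
      (fun n => Eventually.of_forall fun ω => expNeg_le_one _) (by simp)
      (Eventually.of_forall fun ω => ?_)
    exact (continuous_expNeg.tendsto _).comp
      (tendsto_tsum_of_monotone (fun i => hmono _) (fun i => hlim _))
  have hR : Tendsto (fun n => expNeg (ENNReal.ofReal lam * ∫⁻ x, (1 - expNeg (F n x)))) atTop
      (𝓝 (expNeg (ENNReal.ofReal lam * ∫⁻ x, (1 - expNeg (f x))))) := by
    refine (continuous_expNeg.tendsto _).comp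
      (ENNReal.Tendsto.const_mul ?_ (Or.inr ENNReal.ofReal_ne_top))
    refine lintegral_tendsto_of_tendsto_of_monotone
      (fun n => (measurable_const.sub (measurable_expNeg.comp (F n).measurable)).aemeasurable)
      (Eventually.of_forall fun x a b hab => tsub_le_tsub_left (expNeg_antitone (hmono x hab)) 1)
      (Eventually.of_forall fun x => ?_)
    exact ENNReal.Tendsto.sub tendsto_const_nhds ((continuous_expNeg.tendsto _).comp (hlim x))
      (Or.inl ENNReal.one_ne_top)
  exact tendsto_nhds_unique hL (by simpa only [hsimple] using hR)

/-! ### The reduced Campbell–Mecke formula -/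

/-- `2^k (1 - e^{-a / 2^k})`, which increases to `a`. Powers of two make the monotonicity in `k`
the inequality `1 - y² ≤ 2 (1 - y)`. -/
noncomputable def dyadicSlope (k : ℕ) (a : ℝ≥0∞) : ℝ≥0∞ := 2 ^ k * (1 - expNeg (a / 2 ^ k))

lemma dyadicSlope_mono (k : ℕ) : Monotone (dyadicSlope k) := fun _ _ h => by
  unfold dyadicSlope
  gcongr
  exact expNeg_antitone (by gcongr)

lemma continuous_dyadicSlope (k : ℕ) : Continuous (dyadicSlope k) := by
  unfold dyadicSlope
  have h2 : (2 : ℝ≥0∞) ^ k ≠ ∞ := ENNReal.pow_ne_top (by simp)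
  refine (ENNReal.continuous_const_mul h2).comp ?_
  refine (ENNReal.continuous_sub_left ENNReal.one_ne_top).comp (continuous_expNeg.comp ?_)
  exact ENNReal.continuous_div_const _ (by simp)

lemma dyadicSlope_succ (k : ℕ) (a : ℝ≥0∞) : dyadicSlope k a ≤ dyadicSlope (k + 1) a := by
  unfold dyadicSlope
  rw [pow_succ, mul_assoc]
  gcongr
  have h : a / 2 ^ k = a / (2 ^ k * 2) + a / (2 ^ k * 2) := by
    rw [ENNReal.div_add_div_same, ← two_mul, mul_comm (2 ^ k)]
    rw [ENNReal.mul_div_mul_left _ _ (by simp) (by simp)]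
  rw [h, expNeg_add]
  generalize expNeg (a / (2 ^ k * 2)) = y
  rcases le_total 1 y with hy | hy
  · rw [tsub_eq_zero_of_le (one_le_mul hy hy)]; exact zero_le
  · lift y to NNReal using (hy.trans_lt ENNReal.one_lt_top).ne
    have hy' : y ≤ 1 := by exact_mod_cast hy
    have : (1 : NNReal) - y * y ≤ 2 * (1 - y) := by
      rw [← NNReal.coe_le_coe, NNReal.coe_sub (mul_le_one' hy' hy'), NNReal.coe_mul,
        NNReal.coe_mul, NNReal.coe_sub hy', NNReal.coe_one, NNReal.coe_ofNat]
      nlinarith [sq_nonneg ((y : ℝ) - 1)]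
    exact_mod_cast this

lemma monotone_dyadicSlope (a : ℝ≥0∞) : Monotone fun k => dyadicSlope k a :=
  monotone_nat_of_le_succ fun k => dyadicSlope_succ k a

lemma tendsto_dyadicSlope (a : ℝ≥0∞) : Tendsto (fun k => dyadicSlope k a) atTop (𝓝 a) := by
  induction a with
  | top =>
    have : (fun k => dyadicSlope k ∞) = fun k => (2 : ℝ≥0∞) ^ k := by
      funext k
      simp [dyadicSlope,
        ENNReal.top_div_of_ne_top (ENNReal.pow_ne_top (n := k) ENNReal.ofNat_ne_top)]
    rw [this]
    exact ENNReal.tendsto_pow_atTop_nhds_top_iff.2 (by norm_num)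
  | coe a =>
    have h1 : ∀ k, dyadicSlope k a
        = ENNReal.ofReal (2 ^ k * (1 - Real.exp (-(a / 2 ^ k)))) := by
      intro k
      have h2 : ((a : ℝ≥0∞) / 2 ^ k) = ENNReal.ofReal (a / 2 ^ k) := by
        rw [ENNReal.ofReal_div_of_pos (by positivity), ENNReal.ofReal_coe_nnreal,
          ENNReal.ofReal_pow (by norm_num)]
        simp
      rw [dyadicSlope, h2, expNeg_ofReal (by positivity), ENNReal.ofReal_mul (by positivity),
        ENNReal.ofReal_sub _ (Real.exp_nonneg _), ENNReal.ofReal_pow (by norm_num)]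
      simp
    simp_rw [h1]
    rw [← ENNReal.ofReal_coe_nnreal]
    refine ENNReal.tendsto_ofReal ?_
    have hd : HasDerivAt (fun t : ℝ => 1 - Real.exp (-(a * t))) a 0 := by
      have h := ((hasDerivAt_id (0 : ℝ)).const_mul (a : ℝ)).neg.exp.const_sub 1
      simpa using h
    have hs := hd.tendsto_slope_zero_right
    have h0 : Tendsto (fun k : ℕ => ((1 : ℝ) / 2) ^ k) atTop (𝓝[>] 0) :=
      tendsto_pow_atTop_nhdsWithin_zero_of_lt_one (by norm_num) (by norm_num)
    refine (hs.comp h0).congr fun k => ?_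
    simp [div_eq_mul_inv]

lemma dyadicSlope_le (k : ℕ) (a : ℝ≥0∞) : dyadicSlope k a ≤ a :=
  (monotone_dyadicSlope a).ge_of_tendsto (tendsto_dyadicSlope a) k

/-- The slope at a moving argument: the two monotone limits may be taken together. -/
lemma tendsto_dyadicSlope_of_monotone {c : ℕ → ℝ≥0∞} {l : ℝ≥0∞} (hc : Monotone c)
    (hl : Tendsto c atTop (𝓝 l)) : Tendsto (fun k => dyadicSlope k (c k)) atTop (𝓝 l) := by
  have hm : Monotone fun k => dyadicSlope k (c k) := fun a b hab =>
    (monotone_dyadicSlope (c a) hab).trans (dyadicSlope_mono b (hc hab))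
  have ht := tendsto_atTop_iSup hm
  convert ht using 2
  refine le_antisymm (le_of_tendsto' (tendsto_dyadicSlope l) fun j => ?_)
    (iSup_le fun k => (dyadicSlope_le k _).trans (hc.ge_of_tendsto hl k))
  refine le_of_tendsto (((continuous_dyadicSlope j).tendsto l).comp hl) ?_
  filter_upwards [eventually_ge_atTop j] with k hk
  exact (monotone_dyadicSlope (c k) hk).trans (le_iSup (fun k => dyadicSlope k (c k)) k)

/-- Size-biased Laplace functional: the derivative at `t = 0` of the Laplace functional along
`f + t h`. -/
theorem IsHomogeneousPPP.lintegral_tsum_mul_expNeg {lam : ℝ} {X : ℕ → Ω → Plane} {P : Measure Ω}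
    [IsProbabilityMeasure P] (hX : IsHomogeneousPPP lam X P)
    {f h : Plane → ℝ≥0∞} (hf : Measurable f) (hh : Measurable h) :
    ∫⁻ ω, (∑' i, h (X i ω)) * expNeg (∑' i, f (X i ω)) ∂P
      = ENNReal.ofReal lam * (∫⁻ x, h x * expNeg (f x)) * ∫⁻ ω, expNeg (∑' i, f (X i ω)) ∂P := by
  have mN {k : Plane → ℝ≥0∞} (hk : Measurable k) := hX.measurable_tsum hk
  set b : ℕ → ℝ≥0∞ := fun k => ∫⁻ x, expNeg (f x) * (1 - expNeg (h x / 2 ^ k)) with hb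
  have h2 : ∀ k : ℕ, (2 : ℝ≥0∞) ^ k ≠ ∞ := fun k => ENNReal.pow_ne_top (by simp)
  have mhk : ∀ k : ℕ, Measurable fun x => h x / 2 ^ k := fun k => hh.div_const _
  have key : ∀ k : ℕ, ∫⁻ ω, dyadicSlope k (∑' i, h (X i ω)) * expNeg (∑' i, f (X i ω)) ∂P
      = dyadicSlope k (ENNReal.ofReal lam * (2 ^ k * b k))
          * ∫⁻ ω, expNeg (∑' i, f (X i ω)) ∂P := by
    intro k
    have e1 : ∀ ω, dyadicSlope k (∑' i, h (X i ω)) * expNeg (∑' i, f (X i ω))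
        = 2 ^ k * (expNeg (∑' i, f (X i ω)) - expNeg (∑' i, (f (X i ω) + h (X i ω) / 2 ^ k))) := by
      intro ω
      rw [ENNReal.tsum_add, expNeg_add, dyadicSlope, mul_assoc]
      simp_rw [div_eq_mul_inv]
      rw [ENNReal.tsum_mul_right, ENNReal.sub_mul (fun _ _ => expNeg_ne_top _), one_mul,
        mul_comm (expNeg (_ * _))]
    simp_rw [e1]
    have mm : Measurable fun ω => expNeg (∑' i, (f (X i ω) + h (X i ω) / 2 ^ k)) :=
      measurable_expNeg.comp (mN (hf.add (mhk k)))
    rw [lintegral_const_mul' _ _ (h2 k), lintegral_sub mm]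
    rotate_left
    · exact (lintegral_mono (fun ω => expNeg_le_one _)).trans_lt (by simp) |>.ne
    · exact Eventually.of_forall fun ω =>
        expNeg_antitone (ENNReal.tsum_le_tsum fun i => le_self_add)
    have e2 : ∫⁻ x, (1 - expNeg (f x + h x / 2 ^ k)) = (∫⁻ x, (1 - expNeg (f x))) + b k := by
      have m1 : Measurable fun x => 1 - expNeg (f x) :=
        measurable_const.sub (measurable_expNeg.comp hf)
      simp only [hb]
      rw [← lintegral_add_left m1]
      refine lintegral_congr fun x => ?_
      rw [expNeg_add, ENNReal.mul_sub (fun _ _ => expNeg_ne_top _), mul_one,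
        tsub_add_tsub_cancel (expNeg_le_one _)]
      exact mul_le_of_le_one_right' (expNeg_le_one _)
    have e3 := hX.laplace (f := fun x => f x + h x / 2 ^ k) (hf.add (mhk k))
    rw [e3, hX.laplace hf, e2, mul_add, expNeg_add, dyadicSlope, mul_assoc,
      ENNReal.sub_mul (fun _ _ => expNeg_ne_top _), one_mul]
    congr 2
    rw [mul_comm]
    congr 2
    rw [mul_left_comm, mul_comm (2 ^ k), ENNReal.mul_div_cancel_right (by simp) (h2 k)]
  -- Inside the slope on the right stands the slope of `h` itself, integrated against `e^{-f}`.
  have hbm : Monotone fun k => ENNReal.ofReal lam * (2 ^ k * b k) := by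
    intro i j hij
    refine mul_le_mul_right ?_ _
    rw [hb, ← lintegral_const_mul' _ _ (h2 i), ← lintegral_const_mul' _ _ (h2 j)]
    refine lintegral_mono fun x => ?_
    have := monotone_dyadicSlope (h x) hij
    rw [mul_left_comm, mul_left_comm (2 ^ j)]
    exact mul_le_mul_right this _
  have hbl : Tendsto (fun k => ENNReal.ofReal lam * (2 ^ k * b k)) atTop
      (𝓝 (ENNReal.ofReal lam * ∫⁻ x, h x * expNeg (f x))) := by
    refine ENNReal.Tendsto.const_mul ?_ (Or.inr ENNReal.ofReal_ne_top)
    have e : ∀ k, 2 ^ k * b k = ∫⁻ x, dyadicSlope k (h x) * expNeg (f x) := by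
      intro k
      rw [hb, ← lintegral_const_mul' _ _ (h2 k)]
      refine lintegral_congr fun x => ?_
      rw [dyadicSlope, mul_assoc, mul_comm (expNeg (f x))]
    simp_rw [e]
    refine lintegral_tendsto_of_tendsto_of_monotone
      (fun k => ((continuous_dyadicSlope k).measurable.comp hh).mul
        (measurable_expNeg.comp hf) |>.aemeasurable)
      (Eventually.of_forall fun x i j hij => mul_le_mul_left (monotone_dyadicSlope (h x) hij) _)
      (Eventually.of_forall fun x => ?_)
    exact ENNReal.Tendsto.mul_const (tendsto_dyadicSlope _) (Or.inr (expNeg_ne_top _))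
  have hL : Tendsto
      (fun k => ∫⁻ ω, dyadicSlope k (∑' i, h (X i ω)) * expNeg (∑' i, f (X i ω)) ∂P) atTop
      (𝓝 (∫⁻ ω, (∑' i, h (X i ω)) * expNeg (∑' i, f (X i ω)) ∂P)) := by
    refine lintegral_tendsto_of_tendsto_of_monotone
      (fun k => ((continuous_dyadicSlope k).measurable.comp (mN hh)).mul
        (measurable_expNeg.comp (mN hf)) |>.aemeasurable)
      (Eventually.of_forall fun ω i j hij => mul_le_mul_left (monotone_dyadicSlope _ hij) _)
      (Eventually.of_forall fun ω => ?_)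
    exact ENNReal.Tendsto.mul_const (tendsto_dyadicSlope _) (Or.inr (expNeg_ne_top _))
  simp_rw [key] at hL
  refine tendsto_nhds_unique hL (ENNReal.Tendsto.mul_const
    (tendsto_dyadicSlope_of_monotone hbm hbl) (Or.inr ?_))
  exact ((lintegral_mono (fun ω => expNeg_le_one _)).trans_lt (by simp)).ne

lemma tsum_eq_add_tsum_ne (f : ℕ → ℝ≥0∞) (i : ℕ) :
    ∑' j, f j = f i + ∑' j : {j // j ≠ i}, f j := by
  rw [← ENNReal.summable.tsum_add_tsum_compl (s := {i}) ENNReal.summable]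
  simp
  rfl

lemma measurable_tsum_ne {f : ℕ → Ω → ℝ≥0∞} (hf : ∀ i, Measurable (f i)) (i : ℕ) :
    Measurable fun ω => ∑' j : {j // j ≠ i}, f j ω :=
  Measurable.tsum fun j => hf j

/-- For finite `f` the factor `e^{-f(x_i)}` missing from the sum over `j ≠ i` can be restored by the
weight `h = 1_A e^{f}` in the size-biased Laplace functional. -/
lemma IsHomogeneousPPP.mecke_of_ne_top {lam : ℝ} {X : ℕ → Ω → Plane} {P : Measure Ω}
    [IsProbabilityMeasure P] (hX : IsHomogeneousPPP lam X P)
    {f : Plane → ℝ≥0∞} (hf : Measurable f) (hf' : ∀ x, f x ≠ ∞)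
    {A : Set Plane} (hA : MeasurableSet A) :
    ∫⁻ ω, ∑' i, A.indicator 1 (X i ω) * expNeg (∑' j : {j // j ≠ i}, f (X j ω)) ∂P
      = ENNReal.ofReal lam * volume A * ∫⁻ ω, expNeg (∑' i, f (X i ω)) ∂P := by
  have h := hX.lintegral_tsum_mul_expNeg hf (h := A.indicator fun x => (expNeg (f x))⁻¹)
    ((measurable_expNeg.comp hf).inv.indicator hA)
  have hx : ∀ x, A.indicator (fun x => (expNeg (f x))⁻¹) x * expNeg (f x) = A.indicator 1 x := by
    intro x
    by_cases hxA : x ∈ A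
    · simp only [Set.indicator_of_mem hxA, Pi.one_apply]
      exact ENNReal.inv_mul_cancel (by simpa using hf' x) (expNeg_ne_top _)
    · simp [Set.indicator_of_notMem hxA]
  simp_rw [hx] at h
  rw [lintegral_indicator_one hA] at h
  rw [← h]
  refine lintegral_congr fun ω => ?_
  rw [← ENNReal.tsum_mul_right]
  refine tsum_congr fun i => ?_
  rw [tsum_eq_add_tsum_ne (fun j => f (X j ω)) i, expNeg_add, ← mul_assoc, hx]

/-- The reduced Campbell–Mecke formula for the functionals `exp (-∑ f)`: a point of the process,
together with the other points, is distributed like a uniformly placed point with an independent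
copy of the process. -/
theorem IsHomogeneousPPP.mecke {lam : ℝ} {X : ℕ → Ω → Plane} {P : Measure Ω}
    [IsProbabilityMeasure P] (hX : IsHomogeneousPPP lam X P)
    {f : Plane → ℝ≥0∞} (hf : Measurable f)
    {A : Set Plane} (hA : MeasurableSet A) (hA' : volume A < ∞) :
    ∫⁻ ω, ∑' i, A.indicator 1 (X i ω) * expNeg (∑' j : {j // j ≠ i}, f (X j ω)) ∂P
      = ENNReal.ofReal lam * volume A * ∫⁻ ω, expNeg (∑' i, f (X i ω)) ∂P := by
  -- Infinite values of `f` are needed to express that a disc is empty; `f` is truncated at `n`.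
  have mF : ∀ n : ℕ, Measurable fun x => min (f x) n := fun n => hf.min measurable_const
  have hmono : ∀ x, Monotone fun n : ℕ => min (f x) n := fun x a b hab =>
    min_le_min le_rfl (by exact_mod_cast hab)
  have hlim : ∀ x, Tendsto (fun n : ℕ => min (f x) n) atTop (𝓝 (f x)) := fun x => by
    simpa using (tendsto_const_nhds (x := f x)).min ENNReal.tendsto_nat_nhds_top
  have hfin := fun n : ℕ => hX.mecke_of_ne_top (mF n)
    (fun x => ((min_le_right _ _).trans_lt (ENNReal.natCast_lt_top n)).ne) hA
  have hcamp : ∫⁻ ω, ∑' i, A.indicator 1 (X i ω) ∂P = ENNReal.ofReal lam * volume A := by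
    have := hX.mecke_of_ne_top (f := fun _ => 0) measurable_const (by simp) hA
    simpa using this
  have hcfin : ∫⁻ ω, ∑' i, A.indicator (1 : Plane → ℝ≥0∞) (X i ω) ∂P ≠ ∞ := by
    rw [hcamp]; exact ENNReal.mul_ne_top ENNReal.ofReal_ne_top hA'.ne
  have mI : Measurable (A.indicator (1 : Plane → ℝ≥0∞)) := measurable_one.indicator hA
  have hL : Tendsto (fun n : ℕ => ∫⁻ ω, ∑' i, A.indicator 1 (X i ω) *
        expNeg (∑' j : {j // j ≠ i}, min (f (X j ω)) n) ∂P) atTop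
      (𝓝 (∫⁻ ω, ∑' i, A.indicator 1 (X i ω) * expNeg (∑' j : {j // j ≠ i}, f (X j ω)) ∂P)) := by
    refine tendsto_lintegral_of_dominated_convergence
      (fun ω => ∑' i, A.indicator (1 : Plane → ℝ≥0∞) (X i ω))
      (fun n => Measurable.tsum fun i => (mI.comp (hX.measurable i)).mul
        (measurable_expNeg.comp (measurable_tsum_ne (fun j => (mF n).comp (hX.measurable j)) i)))
      (fun n => Eventually.of_forall fun ω => ENNReal.tsum_le_tsum fun i =>
        mul_le_of_le_one_right' (expNeg_le_one _)) hcfin ?_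
    filter_upwards [ae_lt_top (hX.measurable_tsum mI) hcfin] with ω hω
    simp_rw [← lintegral_count] at hω ⊢
    refine tendsto_lintegral_of_dominated_convergence _ (fun n => .of_discrete)
      (fun n => Eventually.of_forall fun i => mul_le_of_le_one_right' (expNeg_le_one _)) hω.ne
      (Eventually.of_forall fun i => ?_)
    refine ENNReal.Tendsto.const_mul ?_ (Or.inr ?_)
    · exact (continuous_expNeg.tendsto _).comp
        (by simpa only [lintegral_count] using
          tendsto_tsum_of_monotone (fun j => hmono _) (fun j : {j // j ≠ i} => hlim (X j ω)))
    · exact ((Set.indicator_le_self' (fun _ _ => zero_le) _).trans_lt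
        (show (1 : Plane → ℝ≥0∞) (X i ω) < ∞ by simp)).ne
  have hR : Tendsto (fun n : ℕ => ∫⁻ ω, expNeg (∑' i, min (f (X i ω)) n) ∂P) atTop
      (𝓝 (∫⁻ ω, expNeg (∑' i, f (X i ω)) ∂P)) := by
    refine tendsto_lintegral_of_dominated_convergence (fun _ => 1)
      (fun n => measurable_expNeg.comp (hX.measurable_tsum (mF n)))
      (fun n => Eventually.of_forall fun ω => expNeg_le_one _) (by simp)
      (Eventually.of_forall fun ω => ?_)
    exact (continuous_expNeg.tendsto _).comp
      (tendsto_tsum_of_monotone (fun i => hmono _) (fun i => hlim _))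
  refine tendsto_nhds_unique hL ?_
  simp_rw [hfin]
  exact ENNReal.Tendsto.const_mul hR
    (Or.inr (ENNReal.mul_ne_top ENNReal.ofReal_ne_top hA'.ne))

/-! ### Independent marks -/

/-- The exponent `f` with `e^{-f} = E[e^{-w h}]` for a mark `h` of law `γ` (negative marks count as
zero). -/
noncomputable def markExponent (γ : Measure ℝ) (w : ℝ≥0∞) : ℝ≥0∞ :=
  (-(ENNReal.log (∫⁻ h, expNeg (w * ENNReal.ofReal h) ∂γ))).toENNReal

lemma expNeg_markExponent (γ : Measure ℝ) [IsProbabilityMeasure γ] (w : ℝ≥0∞) :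
    expNeg (markExponent γ w) = ∫⁻ h, expNeg (w * ENNReal.ofReal h) ∂γ :=
  expNeg_toENNReal_neg_log ((lintegral_mono fun _ => expNeg_le_one _).trans (by simp))

lemma measurable_markExponent (γ : Measure ℝ) [IsProbabilityMeasure γ] :
    Measurable (markExponent γ) := by
  unfold markExponent
  refine measurable_ereal_toENNReal.comp (Measurable.neg ?_)
  refine Measurable.ennreal_log (Measurable.lintegral_prod_right' (ν := γ)
    (f := fun p : ℝ≥0∞ × ℝ => expNeg (p.1 * ENNReal.ofReal p.2)) ?_)
  fun_prop

/-- The Laplace transform of a weighted sum of independent marks. -/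
lemma lintegral_expNeg_tsum_marks {ι : Type*} [Countable ι] {P : Measure Ω}
    [IsProbabilityMeasure P] {γ : Measure ℝ} [IsProbabilityMeasure γ] {g : ι → Ω → ℝ}
    (hg : ∀ i, Measurable (g i)) (hlaw : ∀ i, P.map (g i) = γ) (hind : iIndepFun g P)
    (a : ι → ℝ≥0∞) :
    ∫⁻ ω, expNeg (∑' i, a i * ENNReal.ofReal (g i ω)) ∂P
      = expNeg (∑' i, markExponent γ (a i)) := by
  have mg : ∀ i, Measurable fun ω => a i * ENNReal.ofReal (g i ω) := fun i =>
    (ENNReal.measurable_ofReal.comp (hg i)).const_mul _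
  have hfin : ∀ s : Finset ι, ∫⁻ ω, expNeg (∑ i ∈ s, a i * ENNReal.ofReal (g i ω)) ∂P
      = expNeg (∑ i ∈ s, markExponent γ (a i)) := by
    intro s
    simp_rw [expNeg_sum]
    have hi : iIndepFun (fun i ω => expNeg (a i * ENNReal.ofReal (g i ω))) P :=
      hind.comp (fun i h => expNeg (a i * ENNReal.ofReal h)) (fun i => by fun_prop)
    rw [lintegral_prod_eq_prod_lintegral_of_indepFun _ _ hi
      (fun i => measurable_expNeg.comp (mg i))]
    refine Finset.prod_congr rfl fun i _ => ?_
    rw [expNeg_markExponent, ← hlaw i, lintegral_map (by fun_prop) (hg i)]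
  have hL : Tendsto (fun s : Finset ι => ∫⁻ ω, expNeg (∑ i ∈ s, a i * ENNReal.ofReal (g i ω)) ∂P)
      atTop (𝓝 (∫⁻ ω, expNeg (∑' i, a i * ENNReal.ofReal (g i ω)) ∂P)) := by
    refine tendsto_lintegral_filter_of_dominated_convergence (fun _ => 1)
      (Eventually.of_forall fun s => measurable_expNeg.comp
        (Finset.measurable_fun_sum s fun i _ => mg i))
      (Eventually.of_forall fun n => Eventually.of_forall fun ω => expNeg_le_one _) (by simp)
      (Eventually.of_forall fun ω => ?_)
    exact (continuous_expNeg.tendsto _).comp ENNReal.summable.hasSum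
  refine tendsto_nhds_unique hL ?_
  simp_rw [hfin]
  exact (continuous_expNeg.tendsto _).comp ENNReal.summable.hasSum

lemma IsLOSNetwork.isProbabilityMeasure_gain {lam : ℝ} {m : ℕ} {X : ℕ → Ω → Plane}
    {g : ℕ → Ω → ℝ} {P : Measure Ω} [IsProbabilityMeasure P] (hnet : IsLOSNetwork lam m X g P) :
    IsProbabilityMeasure (gammaMeasure m m) := by
  rw [← hnet.gain_law 0]
  exact Measure.isProbabilityMeasure_map (hnet.gain_measurable 0).aemeasurable

/-- The gains may be integrated out, the locations being fixed. -/
lemma IsLOSNetwork.lintegral_marks {lam : ℝ} {m : ℕ} {X : ℕ → Ω → Plane}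
    {g : ℕ → Ω → ℝ} {P : Measure Ω} [IsProbabilityMeasure P] (hnet : IsLOSNetwork lam m X g P)
    (S : Set ℕ) {w : Plane → ℝ≥0∞} (hw : Measurable w) {G : (ℕ → Plane) → ℝ≥0∞}
    (hG : Measurable G) :
    ∫⁻ ω, G (fun i => X i ω) * expNeg (∑' j : S, w (X j ω) * ENNReal.ofReal (g j ω)) ∂P
      = ∫⁻ ω, G (fun i => X i ω) *
          expNeg (∑' j : S, markExponent (gammaMeasure m m) (w (X j ω))) ∂P := by
  have := hnet.isProbabilityMeasure_gain
  have mX : Measurable fun ω i => X i ω := measurable_pi_lambda _ hnet.ppp.measurable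
  have mg : Measurable fun ω i => g i ω := measurable_pi_lambda _ hnet.gain_measurable
  have hF : Measurable fun p : (ℕ → ℝ) × (ℕ → Plane) =>
      G p.2 * expNeg (∑' j : S, w (p.2 j) * ENNReal.ofReal (p.1 j)) := by
    refine (hG.comp measurable_snd).mul (measurable_expNeg.comp (Measurable.tsum fun j => ?_))
    have m1 : Measurable fun p : (ℕ → ℝ) × (ℕ → Plane) => p.2 j :=
      (measurable_pi_apply (j : ℕ)).comp measurable_snd
    have m2 : Measurable fun p : (ℕ → ℝ) × (ℕ → Plane) => p.1 j :=
      (measurable_pi_apply (j : ℕ)).comp measurable_fst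
    exact (hw.comp m1).mul (ENNReal.measurable_ofReal.comp m2)
  have h1 := lintegral_map hF (mg.prodMk mX) (μ := P)
  rw [(indepFun_iff_map_prod_eq_prod_map_map mg.aemeasurable mX.aemeasurable).1
    hnet.gain_indep_points] at h1
  have := Measure.isProbabilityMeasure_map mg.aemeasurable (μ := P)
  have := Measure.isProbabilityMeasure_map mX.aemeasurable (μ := P)
  rw [← h1, lintegral_prod_symm' _ hF, lintegral_map hF.lintegral_prod_left' mX]
  refine lintegral_congr fun ω => ?_
  dsimp only
  rw [lintegral_map (f := fun x : ℕ → ℝ => G (fun i => X i ω) *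
    expNeg (∑' j : S, w (X j ω) * ENNReal.ofReal (x j)))
    (hF.comp (measurable_id.prodMk measurable_const)) mg]
  rw [lintegral_const_mul, lintegral_expNeg_tsum_marks (fun j : S => hnet.gain_measurable j)
    (fun j : S => hnet.gain_law j) (hnet.gain_indep.precomp Subtype.val_injective)]
  exact measurable_expNeg.comp (Measurable.tsum fun j =>
    (ENNReal.measurable_ofReal.comp (hnet.gain_measurable j)).const_mul _)

/-! ### Finite measures on `[0, ∞]` are determined by the moments of `e^{-x}` -/

/-- `e^{-x}` as a bounded continuous function on `[0, ∞]`. -/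
noncomputable def expNegBCF : BoundedContinuousFunction ℝ≥0∞ ℝ :=
  BoundedContinuousFunction.mkOfCompact
    ⟨fun x => (expNeg x).toReal, continuous_iff_continuousAt.2 fun x =>
      (ENNReal.tendsto_toReal (expNeg_ne_top x)).comp (continuous_expNeg.tendsto x)⟩

lemma expNegBCF_apply (x : ℝ≥0∞) : expNegBCF x = (expNeg x).toReal := rfl

/-- By the Stone–Weierstrass theorem for the algebra generated by `e^{-x}`, which separates the
points of the compact space `[0, ∞]`. -/
theorem ext_of_lintegral_expNeg {μ ν : Measure ℝ≥0∞} [IsFiniteMeasure μ] [IsFiniteMeasure ν]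
    (h : ∀ n : ℕ, ∫⁻ x, expNeg (n * x) ∂μ = ∫⁻ x, expNeg (n * x) ∂ν) : μ = ν := by
  have hmom : ∀ n : ℕ, ∫ x, (expNegBCF ^ n) x ∂μ = ∫ x, (expNegBCF ^ n) x ∂ν := by
    intro n
    have e : ∀ κ : Measure ℝ≥0∞, ∫ x, (expNegBCF ^ n) x ∂κ = (∫⁻ x, expNeg (n * x) ∂κ).toReal := by
      intro κ
      rw [← integral_toReal (by fun_prop)
        (Eventually.of_forall fun x => (expNeg_ne_top _).lt_top)]
      refine integral_congr_ae (Eventually.of_forall fun x => ?_)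
      simp [expNegBCF_apply, expNeg_nsmul]
    rw [e, e, h]
  let A : StarSubalgebra ℝ (BoundedContinuousFunction ℝ≥0∞ ℝ) :=
    { Algebra.adjoin ℝ {expNegBCF} with
      star_mem' := fun {f} hf => by
        have : star f = f := by ext x; simp
        rw [this]; exact hf }
  refine ext_of_forall_mem_subalgebra_integral_eq_of_polish (𝕜 := ℝ) (A := A) ?_ ?_
  · intro x y hxy
    refine ⟨expNegBCF, ⟨expNegBCF, ⟨expNegBCF, ?_, rfl⟩, rfl⟩, ?_⟩
    · exact Algebra.subset_adjoin rfl
    · rw [expNegBCF_apply, expNegBCF_apply, Ne,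
        ENNReal.toReal_eq_toReal_iff' (expNeg_ne_top _) (expNeg_ne_top _)]
      exact fun h => hxy (expNeg_injective h)
  · intro f hf
    have hf' : f ∈ Algebra.adjoin ℝ {expNegBCF} := hf
    rw [Algebra.adjoin_singleton_eq_range_aeval] at hf'
    obtain ⟨p, rfl⟩ := hf'
    change ∫ x, (Polynomial.aeval expNegBCF p) x ∂μ = ∫ x, (Polynomial.aeval expNegBCF p) x ∂ν
    clear hf
    induction p using Polynomial.induction_on' with
    | add p q hp hq =>
      simp only [map_add, BoundedContinuousFunction.add_apply]
      rw [integral_add (BoundedContinuousFunction.integrable _ _)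
        (BoundedContinuousFunction.integrable _ _),
        integral_add (BoundedContinuousFunction.integrable _ _)
        (BoundedContinuousFunction.integrable _ _), hp, hq]
    | monomial n a =>
      simp only [Polynomial.aeval_monomial, Algebra.algebraMap_eq_smul_one, smul_mul_assoc, one_mul,
        BoundedContinuousFunction.smul_apply]
      rw [integral_smul, integral_smul, hmom]

/-! ### The joint law of a base station and of what the others contribute -/

/-- Distance from the origin to the closest of the points with index in `S`. -/
noncomputable def nearest (X : ℕ → Ω → Plane) (S : Set ℕ) (ω : Ω) : ℝ≥0∞ := ⨅ j : S, ‖X j ω‖ₑ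

/-- Total power received from the base stations with index in `S`. -/
noncomputable def totalPower (α : ℝ) (X : ℕ → Ω → Plane) (g : ℕ → Ω → ℝ) (S : Set ℕ) (ω : Ω) :
    ℝ≥0∞ :=
  ∑' j : S, rxPower α X g j ω

/-- The pathloss `‖x‖^{-α}`. -/
noncomputable def pathloss (α : ℝ) (x : Plane) : ℝ≥0∞ := ENNReal.ofReal (‖x‖ ^ (-α))

lemma measurable_pathloss (α : ℝ) : Measurable (pathloss α) :=
  ENNReal.measurable_ofReal.comp (measurable_norm.pow_const _)

lemma rxPower_eq {Ω : Type*} (α : ℝ) (X : ℕ → Ω → Plane) (g : ℕ → Ω → ℝ) (i : ℕ) (ω : Ω) :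
    rxPower α X g i ω = pathloss α (X i ω) * ENNReal.ofReal (g i ω) := by
  rw [rxPower, pathloss, mul_comm, ENNReal.ofReal_mul (Real.rpow_nonneg (norm_nonneg _) _)]

/-- The event that no point is closer than `ρ`, as an exponential functional. -/
lemma indicator_nearest {Ω : Type*} (X : ℕ → Ω → Plane) (S : Set ℕ) (ρ : ℝ≥0∞) (ω : Ω) :
    expNeg (∑' j : S, {x : Plane | ‖x‖ₑ < ρ}.indicator (fun _ => ∞) (X j ω))
      = {ω | ρ ≤ nearest X S ω}.indicator 1 ω := by
  by_cases h : ω ∈ {ω | ρ ≤ nearest X S ω}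
  · have h' : ∀ j : S, ρ ≤ ‖X j ω‖ₑ := fun j => (show ρ ≤ nearest X S ω from h).trans (iInf_le _ j)
    have : ∀ j : S, {x : Plane | ‖x‖ₑ < ρ}.indicator (fun _ => (∞ : ℝ≥0∞)) (X j ω) = 0 := fun j =>
      Set.indicator_of_notMem (by simpa using h' j) _
    simp [this, Set.indicator_of_mem h]
  · rw [Set.indicator_of_notMem h, expNeg_eq_zero]
    have h' : nearest X S ω < ρ := not_le.1 h
    obtain ⟨j, hj⟩ := iInf_lt_iff.1 h'
    refine ENNReal.tsum_eq_top_of_eq_top ⟨j, ?_⟩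
    exact Set.indicator_of_mem (show X j ω ∈ {x : Plane | ‖x‖ₑ < ρ} from hj) _

section Network

variable {lam : ℝ} {m : ℕ} {X : ℕ → Ω → Plane} {g : ℕ → Ω → ℝ} {P : Measure Ω}

lemma IsHomogeneousPPP.measurable_nearest (hX : IsHomogeneousPPP lam X P) (S : Set ℕ) :
    Measurable (nearest X S) :=
  Measurable.iInf fun j => (hX.measurable j).enorm

lemma IsLOSNetwork.measurable_rxPower (hnet : IsLOSNetwork lam m X g P) (α : ℝ) (i : ℕ) :
    Measurable (rxPower α X g i) := by
  have : rxPower α X g i = fun ω => pathloss α (X i ω) * ENNReal.ofReal (g i ω) := by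
    funext ω; exact rxPower_eq ..
  rw [this]
  exact ((measurable_pathloss α).comp (hnet.ppp.measurable i)).mul
    (ENNReal.measurable_ofReal.comp (hnet.gain_measurable i))

lemma IsLOSNetwork.measurable_totalPower (hnet : IsLOSNetwork lam m X g P) (α : ℝ) (S : Set ℕ) :
    Measurable (totalPower α X g S) :=
  Measurable.tsum fun j => hnet.measurable_rxPower α j

variable [IsProbabilityMeasure P]

/-- The joint transform of the power and the distance of the base stations in `S`, in terms of the
locations alone. -/
lemma IsLOSNetwork.lintegral_power_nearest (hnet : IsLOSNetwork lam m X g P) (α : ℝ) (S : Set ℕ)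
    (s ρ : ℝ≥0∞) {G : (ℕ → Plane) → ℝ≥0∞} (hG : Measurable G) :
    ∫⁻ ω, G (fun i => X i ω) * ({ω | ρ ≤ nearest X S ω}.indicator 1 ω *
        expNeg (s * totalPower α X g S ω)) ∂P
      = ∫⁻ ω, G (fun i => X i ω) * expNeg (∑' j : S,
          ({x : Plane | ‖x‖ₑ < ρ}.indicator (fun _ => ∞) (X j ω) +
            markExponent (gammaMeasure m m) (s * pathloss α (X j ω)))) ∂P := by
  have mI : Measurable ({x : Plane | ‖x‖ₑ < ρ}.indicator (fun _ => (∞ : ℝ≥0∞))) :=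
    measurable_const.indicator (measurableSet_lt measurable_enorm measurable_const)
  have h := hnet.lintegral_marks S (w := fun x => s * pathloss α x)
    ((measurable_pathloss α).const_mul s)
    (G := fun x => G x * expNeg (∑' j : S, {x : Plane | ‖x‖ₑ < ρ}.indicator (fun _ => ∞) (x j)))
    (hG.mul (measurable_expNeg.comp (Measurable.tsum fun j => mI.comp (measurable_pi_apply _))))
  simp_rw [ENNReal.tsum_add, expNeg_add, ← mul_assoc] at h ⊢
  rw [← h]
  refine lintegral_congr fun ω => ?_
  rw [indicator_nearest, totalPower]
  simp_rw [rxPower_eq, mul_assoc, ENNReal.tsum_mul_left]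

/-- Slivnyak's theorem for the network: summed over all base stations, the joint law of the location
of a base station, of the total power of the others, and of the distance to the closest of
the others is the product of `lam dx` and of the law of the total power and of the distance to
the closest base station in the whole network. -/
theorem IsLOSNetwork.sum_map_eq_prod (hnet : IsLOSNetwork lam m X g P) (α : ℝ) :
    Measure.sum (fun i => P.map fun ω =>
        (X i ω, (totalPower α X g {j | j ≠ i} ω, nearest X {j | j ≠ i} ω)))
      = (ENNReal.ofReal lam • (volume : Measure Plane)).prod
          (P.map fun ω => (totalPower α X g Set.univ ω, nearest X Set.univ ω)) := by
  have := hnet.isProbabilityMeasure_gain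
  have mJ := hnet.measurable_totalPower α
  have mR := hnet.ppp.measurable_nearest
  have mX := hnet.ppp.measurable
  have mT : ∀ i, Measurable fun ω =>
      (X i ω, (totalPower α X g {j | j ≠ i} ω, nearest X {j | j ≠ i} ω)) := fun i =>
    (mX i).prodMk ((mJ _).prodMk (mR _))
  have mU : Measurable fun ω => (totalPower α X g Set.univ ω, nearest X Set.univ ω) :=
    (mJ _).prodMk (mR _)
  have := Measure.isProbabilityMeasure_map mU.aemeasurable (μ := P)
  -- For fixed `A` and `ρ`, compare two finite measures on `[0, ∞]` through their transforms.
  have hslice : ∀ A : Set Plane, MeasurableSet A → volume A < ∞ → ∀ ρ : ℝ≥0∞,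
      Measure.sum (fun i => (P.restrict ({ω | X i ω ∈ A} ∩ {ω | ρ ≤ nearest X {j | j ≠ i} ω})).map
        (totalPower α X g {j | j ≠ i}))
      = (ENNReal.ofReal lam * volume A) •
        (P.restrict {ω | ρ ≤ nearest X Set.univ ω}).map (totalPower α X g Set.univ) := by
    intro A hA hA' ρ
    have mρ : ∀ S, MeasurableSet {ω | ρ ≤ nearest X S ω} := fun S =>
      measurableSet_le measurable_const (mR S)
    have hmom : ∀ n : ℕ,
        ∫⁻ x, expNeg (n * x) ∂(Measure.sum (fun i => (P.restrict ({ω | X i ω ∈ A} ∩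
          {ω | ρ ≤ nearest X {j | j ≠ i} ω})).map (totalPower α X g {j | j ≠ i})))
        = ∫⁻ x, expNeg (n * x) ∂((ENNReal.ofReal lam * volume A) •
        (P.restrict {ω | ρ ≤ nearest X Set.univ ω}).map (totalPower α X g Set.univ)) := by
      intro n
      have mE : Measurable fun x : ℝ≥0∞ => expNeg (n * x) := by fun_prop
      set f : Plane → ℝ≥0∞ := fun x => {x : Plane | ‖x‖ₑ < ρ}.indicator (fun _ => ∞) x +
        markExponent (gammaMeasure m m) (n * pathloss α x) with hf
      have mf : Measurable f := by
        refine (measurable_const.indicator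
          (measurableSet_lt measurable_enorm measurable_const)).add ?_
        exact (measurable_markExponent _).comp ((measurable_pathloss α).const_mul _)
      have hU : ∫⁻ x, expNeg (n * x) ∂((P.restrict {ω | ρ ≤ nearest X Set.univ ω}).map
          (totalPower α X g Set.univ)) = ∫⁻ ω, expNeg (∑' j, f (X j ω)) ∂P := by
        rw [lintegral_map mE (mJ _), ← lintegral_indicator (mρ _)]
        have h := hnet.lintegral_power_nearest α Set.univ n ρ (G := fun _ => 1) measurable_const
        simp only [one_mul] at h
        have e : ∀ ω, ∑' j : (Set.univ : Set ℕ), f (X j ω) = ∑' j, f (X j ω) := fun ω =>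
          tsum_univ fun j => f (X j ω)
        rw [← lintegral_congr fun ω => congrArg expNeg (e ω)]
        refine Eq.trans ?_ h
        refine lintegral_congr fun ω => ?_
        by_cases hω : ω ∈ {ω | ρ ≤ nearest X Set.univ ω}
        · simp [Set.indicator_of_mem hω]
        · simp [Set.indicator_of_notMem hω]
      have hI : ∀ i, ∫⁻ x, expNeg (n * x) ∂((P.restrict ({ω | X i ω ∈ A} ∩
          {ω | ρ ≤ nearest X {j | j ≠ i} ω})).map (totalPower α X g {j | j ≠ i}))
          = ∫⁻ ω, A.indicator 1 (X i ω) * expNeg (∑' j : {j // j ≠ i}, f (X j ω)) ∂P := by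
        intro i
        have mA : MeasurableSet ({ω | X i ω ∈ A} ∩ {ω | ρ ≤ nearest X {j | j ≠ i} ω}) :=
          MeasurableSet.inter (mX i hA) (mρ _)
        rw [lintegral_map mE (mJ _), ← lintegral_indicator mA]
        have h := hnet.lintegral_power_nearest α {j | j ≠ i} n ρ
          (G := fun x => A.indicator 1 (x i))
          ((measurable_one.indicator hA).comp (measurable_pi_apply i))
        refine Eq.trans ?_ h
        refine lintegral_congr fun ω => ?_
        by_cases h1 : X i ω ∈ A <;> by_cases h2 : ρ ≤ nearest X {j | j ≠ i} ω <;>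
          simp [Set.indicator, h1, h2]
      rw [lintegral_sum_measure, lintegral_smul_measure, hU, smul_eq_mul,
        ← hnet.ppp.mecke mf hA hA', lintegral_tsum]
      · exact tsum_congr hI
      · exact fun i => (((measurable_one.indicator hA).comp (mX i)).mul (measurable_expNeg.comp
          (measurable_tsum_ne (fun j => mf.comp (mX j)) i))).aemeasurable
    have hfin : IsFiniteMeasure ((ENNReal.ofReal lam * volume A) •
        (P.restrict {ω | ρ ≤ nearest X Set.univ ω}).map (totalPower α X g Set.univ)) :=
      Measure.smul_finite _ (ENNReal.mul_ne_top ENNReal.ofReal_ne_top hA'.ne)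
    have hfin' : IsFiniteMeasure (Measure.sum (fun i => (P.restrict ({ω | X i ω ∈ A} ∩
          {ω | ρ ≤ nearest X {j | j ≠ i} ω})).map (totalPower α X g {j | j ≠ i}))) := by
      refine ⟨?_⟩
      have h0 := hmom 0
      simp only [Nat.cast_zero, zero_mul, expNeg_zero, lintegral_one] at h0
      rw [h0]
      exact measure_lt_top _ _
    exact ext_of_lintegral_expNeg hmom
  have hC : MeasurableSpace.generateFrom {A : Set Plane | MeasurableSet A ∧ volume A < ∞}
      = (inferInstance : MeasurableSpace Plane) := by
    refine le_antisymm (MeasurableSpace.generateFrom_le fun A hA => hA.1) fun A hA => ?_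
    have : A = ⋃ n : ℕ, A ∩ Metric.ball 0 n := by
      rw [← Set.inter_iUnion, Metric.iUnion_ball_nat, Set.inter_univ]
    rw [this]
    refine MeasurableSet.iUnion fun n => MeasurableSpace.measurableSet_generateFrom
      ⟨hA.inter measurableSet_ball, ?_⟩
    exact (measure_mono Set.inter_subset_right).trans_lt measure_ball_lt_top
  have hD : MeasurableSpace.generateFrom (Set.image2 (· ×ˢ ·) {E : Set ℝ≥0∞ | MeasurableSet E}
      (Set.range Set.Ici)) = (inferInstance : MeasurableSpace (ℝ≥0∞ × ℝ≥0∞)) := by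
    refine generateFrom_eq_prod MeasurableSpace.generateFrom_measurableSet ?_
      isCountablySpanning_measurableSet ?_
    · rw [← borel_eq_generateFrom_Ici, BorelSpace.measurable_eq (α := ℝ≥0∞)]
    · exact ⟨fun _ => Set.Ici 0, fun _ => ⟨0, rfl⟩,
        Set.iUnion_eq_univ_iff.2 fun _ => ⟨0, Set.mem_Ici.2 zero_le⟩⟩
  have hDpi : IsPiSystem (Set.image2 (· ×ˢ ·) {E : Set ℝ≥0∞ | MeasurableSet E}
      (Set.range (Set.Ici : ℝ≥0∞ → Set ℝ≥0∞))) :=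
    MeasurableSpace.isPiSystem_measurableSet.prod (isPiSystem_Ici (α := ℝ≥0∞))
  -- It remains to extend the equality from the sets `A × E × [ρ, ∞]`.
  refine (Measure.prod_eq_generateFrom hC hD ?_ hDpi ?_ ?_ ?_).symm
  · intro A hA B hB _
    exact ⟨hA.1.inter hB.1, (measure_mono Set.inter_subset_left).trans_lt hA.2⟩
  · refine ⟨fun n => Metric.ball 0 n, fun n => ⟨measurableSet_ball, measure_ball_lt_top⟩,
      fun n => ?_, Metric.iUnion_ball_nat _⟩
    exact ENNReal.mul_lt_top ENNReal.ofReal_lt_top measure_ball_lt_top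
  · exact ⟨fun _ => Set.univ, fun _ => ⟨Set.univ,
      (MeasurableSet.univ : MeasurableSet (Set.univ : Set ℝ≥0∞)), Set.Ici 0, ⟨0, rfl⟩, by simp⟩,
      fun _ => measure_lt_top _ _, Set.iUnion_const _⟩
  · rintro A ⟨hA, hA'⟩ _ ⟨E, hE, _, ⟨ρ, rfl⟩, rfl⟩
    replace hE : MeasurableSet E := hE
    have h := congrArg (fun μ => μ E) (hslice A hA hA' ρ)
    have mEρ : MeasurableSet (E ×ˢ Set.Ici ρ) := MeasurableSet.prod hE measurableSet_Ici
    rw [Measure.sum_apply _ hE, Measure.smul_apply, Measure.map_apply (mJ _) hE,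
      Measure.restrict_apply (mJ _ hE)] at h
    rw [Measure.sum_apply _ (hA.prod mEρ), Measure.map_apply mU mEρ,
      Measure.smul_apply, smul_eq_mul]
    refine Eq.trans ?_ (h.trans ?_)
    · refine tsum_congr fun i => ?_
      rw [Measure.map_apply (mT i) (hA.prod mEρ), Measure.map_apply (mJ _) hE,
        Measure.restrict_apply (mJ _ hE)]
      congr 1
      ext ω
      simp only [Set.mem_preimage, Set.mem_prod, Set.mem_inter_iff, Set.mem_ofPred_eq, Set.mem_Ici]
      tauto
    · rfl

end Network

/-! ### The hypergeometric function `₂F₁(m, -d, 1 - d, z)` -/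

/-- The integrand of the Euler-type integral `∫₀¹ y^{-d} (1 - z y)^{-n} dy`. -/
noncomputable def eulerIntegrand (d : ℝ) (n : ℕ) (z : ℂ) (y : ℝ) : ℂ :=
  ((y ^ (-d) : ℝ) : ℂ) * ((1 - z * y) ^ n)⁻¹

/-- The Euler-type integral `∫₀¹ y^{-d} (1 - z y)^{-n} dy`. -/
noncomputable def eulerIntegral (d : ℝ) (n : ℕ) (z : ℂ) : ℂ :=
  ∫ y in Set.Ioc (0 : ℝ) 1, eulerIntegrand d n z y

lemma hasDerivAt_inv_pow {𝕜 : Type*} [NontriviallyNormedField 𝕜] (n : ℕ) {w : 𝕜} (hw : w ≠ 0) :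
    HasDerivAt (fun w : 𝕜 => (w ^ n)⁻¹) (-(n * (w ^ (n + 1))⁻¹)) w := by
  have h := hasDerivAt_zpow (-(n : ℤ)) w (Or.inl hw)
  have e : -(n : ℤ) - 1 = -((n + 1 : ℕ) : ℤ) := by push_cast; ring
  rw [e] at h
  simpa only [zpow_neg, zpow_natCast, Int.cast_neg, Int.cast_natCast, neg_mul] using h

lemma le_norm_one_sub_mul {c : ℝ} (hc1 : c ≤ 1) {z : ℂ} (hz : z.re ≤ 1 - c) {y : ℝ}
    (hy : y ∈ Set.Ioc (0 : ℝ) 1) : c ≤ ‖1 - z * y‖ := by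
  refine le_trans ?_ (Complex.re_le_norm _)
  have h : (1 - z * y).re = 1 - z.re * y := by simp
  rw [h]
  nlinarith [hy.1, hy.2, mul_le_mul_of_nonneg_right hz hy.1.le]

lemma one_sub_mul_ne_zero {z : ℂ} (hz : z.re < 1) {y : ℝ} (hy : y ∈ Set.Ioc (0 : ℝ) 1) :
    1 - z * y ≠ 0 := by
  have h := le_norm_one_sub_mul (c := min 1 (1 - z.re)) (min_le_left _ _)
    (by linarith [min_le_right 1 (1 - z.re)]) hy
  exact norm_pos_iff.1 ((lt_min one_pos (by linarith)).trans_le h)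

lemma integrableOn_rpow_Ioc {r : ℝ} (hr : -1 < r) :
    IntegrableOn (fun y : ℝ => y ^ r) (Set.Ioc 0 1) :=
  (intervalIntegrable_iff_integrableOn_Ioc_of_le zero_le_one).1
    (intervalIntegral.intervalIntegrable_rpow' hr)

lemma integral_rpow_Ioc {r : ℝ} (hr : -1 < r) :
    ∫ y in Set.Ioc (0 : ℝ) 1, y ^ r = 1 / (r + 1) := by
  rw [← intervalIntegral.integral_of_le zero_le_one, integral_rpow (Or.inl hr), Real.one_rpow,
    Real.zero_rpow (by linarith), sub_zero]

lemma measurable_eulerIntegrand (d : ℝ) (n : ℕ) (z : ℂ) : Measurable (eulerIntegrand d n z) := by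
  unfold eulerIntegrand
  fun_prop

lemma norm_eulerIntegrand_le {d c : ℝ} (n : ℕ) (hc : 0 < c) (hc1 : c ≤ 1) {z : ℂ}
    (hz : z.re ≤ 1 - c) {y : ℝ} (hy : y ∈ Set.Ioc (0 : ℝ) 1) :
    ‖eulerIntegrand d n z y‖ ≤ (c ^ n)⁻¹ * y ^ (-d) := by
  have h0 : 0 ≤ y ^ (-d) := Real.rpow_nonneg hy.1.le _
  rw [eulerIntegrand, norm_mul, norm_inv, norm_pow, Complex.norm_real, Real.norm_of_nonneg h0,
    mul_comm]
  gcongr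
  exact le_norm_one_sub_mul hc1 hz hy

lemma integrableOn_eulerIntegrand {d : ℝ} (hd : d < 1) (n : ℕ) {z : ℂ} (hz : z.re < 1) :
    IntegrableOn (eulerIntegrand d n z) (Set.Ioc 0 1) := by
  refine Integrable.mono' ((integrableOn_rpow_Ioc (r := -d) (by linarith)).const_mul
    (((min 1 (1 - z.re)) ^ n)⁻¹)) (measurable_eulerIntegrand d n z).aestronglyMeasurable ?_
  refine (ae_restrict_iff' measurableSet_Ioc).2 (Eventually.of_forall fun y hy => ?_)
  exact norm_eulerIntegrand_le n (lt_min one_pos (by linarith)) (min_le_left _ _)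
    (by linarith [min_le_right 1 (1 - z.re)]) hy

lemma hasDerivAt_eulerIntegral {d : ℝ} (hd : d < 1) (n : ℕ) {z : ℂ} (hz : z.re < 1) :
    HasDerivAt (eulerIntegral d n)
      (∫ y in Set.Ioc (0 : ℝ) 1, n * y * eulerIntegrand d (n + 1) z y) z := by
  set c : ℝ := min 1 ((1 - z.re) / 2) with hc
  have hc0 : 0 < c := lt_min one_pos (by linarith)
  have hc2 : c ≤ (1 - z.re) / 2 := min_le_right _ _
  have hnhds : {w : ℂ | w.re < 1 - c} ∈ 𝓝 z :=
    (isOpen_lt Complex.continuous_re continuous_const).mem_nhds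
      (show z.re < 1 - c by linarith)
  refine (hasDerivAt_integral_of_dominated_loc_of_deriv_le (𝕜 := ℂ) (F := eulerIntegrand d n)
    (F' := fun w y => n * y * eulerIntegrand d (n + 1) w y)
    (bound := fun y => (n * (c ^ (n + 1))⁻¹) * y ^ (-d)) hnhds
    (Eventually.of_forall fun w => (measurable_eulerIntegrand d n w).aestronglyMeasurable)
    (integrableOn_eulerIntegrand hd n hz) ?_ ?_
    ((integrableOn_rpow_Ioc (r := -d) (by linarith)).const_mul _) ?_).2
  · have := measurable_eulerIntegrand d (n + 1) z
    exact Measurable.aestronglyMeasurable (by fun_prop)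
  · refine (ae_restrict_iff' measurableSet_Ioc).2 (Eventually.of_forall fun y hy w hw => ?_)
    have h := norm_eulerIntegrand_le (d := d) (n + 1) hc0 (min_le_left _ _) (le_of_lt hw) hy
    rw [norm_mul, norm_mul, Complex.norm_real, Real.norm_of_nonneg hy.1.le, Complex.norm_natCast,
      mul_assoc, mul_assoc]
    exact mul_le_mul_of_nonneg_left ((mul_le_of_le_one_left (norm_nonneg _) hy.2).trans h)
      n.cast_nonneg
  · refine (ae_restrict_iff' measurableSet_Ioc).2 (Eventually.of_forall fun y hy w hw => ?_)
    have hw1 : w.re < 1 := by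
      have : w.re < 1 - c := hw
      linarith
    have hne := one_sub_mul_ne_zero hw1 hy
    have h1 : HasDerivAt (fun w : ℂ => 1 - w * y) (-y) w := by
      simpa using ((hasDerivAt_id w).mul_const (y : ℂ)).const_sub 1
    have h2 := ((hasDerivAt_inv_pow n hne).comp w h1).const_mul ((y ^ (-d) : ℝ) : ℂ)
    refine HasDerivAt.congr_deriv (f := fun w => eulerIntegrand d n w y) h2 ?_
    simp only [eulerIntegrand]
    ring

/-- Integration by parts: `z K' + (1 - d) K = (1 - z)^{-n}` for `K = ∫₀¹ y^{-d} (1 - z y)^{-n}`. -/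
lemma eulerIntegral_parts {d : ℝ} (hd : d < 1) (n : ℕ) {z : ℂ} (hz : z.re < 1) :
    z * (∫ y in Set.Ioc (0 : ℝ) 1, n * y * eulerIntegrand d (n + 1) z y)
      + (1 - d) * eulerIntegral d n z = ((1 - z) ^ n)⁻¹ := by
  have hint : IntegrableOn (fun y : ℝ => n * y * eulerIntegrand d (n + 1) z y) (Set.Ioc 0 1) := by
    have h := (integrableOn_eulerIntegrand hd (n + 1) hz).const_mul (n : ℂ)
    refine Integrable.mono h ?_ ?_
    · have := measurable_eulerIntegrand d (n + 1) z
      exact Measurable.aestronglyMeasurable (by fun_prop)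
    · refine (ae_restrict_iff' measurableSet_Ioc).2 (Eventually.of_forall fun y hy => ?_)
      rw [norm_mul, norm_mul, norm_mul, Complex.norm_real, Real.norm_of_nonneg hy.1.le]
      gcongr
      exact mul_le_of_le_one_right (norm_nonneg _) hy.2
  set f : ℝ → ℂ := fun y => ((y ^ (1 - d) : ℝ) : ℂ) * ((1 - z * y) ^ n)⁻¹ with hf
  have hne : ∀ y ∈ Set.Icc (0 : ℝ) 1, 1 - z * y ≠ 0 := by
    intro y hy
    rcases hy.1.eq_or_lt with rfl | h0
    · simp
    · exact one_sub_mul_ne_zero hz ⟨h0, hy.2⟩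
  have hcont : ContinuousOn f (Set.Icc 0 1) := by
    refine ContinuousOn.mul ?_ (ContinuousOn.inv₀ ?_ fun y hy => pow_ne_zero n (hne y hy))
    · exact (Complex.continuous_ofReal.comp
        (Real.continuous_rpow_const (by linarith))).continuousOn
    · exact Continuous.continuousOn (by fun_prop)
  have hderiv : ∀ y ∈ Set.Ioo (0 : ℝ) 1, HasDerivAt f
      (z * (n * y * eulerIntegrand d (n + 1) z y) + (1 - d) * eulerIntegrand d n z y) y := by
    intro y hy
    have hy' := hne y ⟨hy.1.le, hy.2.le⟩
    have h1 : HasDerivAt (fun y : ℝ => 1 - z * (y : ℂ)) (-z) y := by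
      simpa using ((Complex.ofRealCLM.hasDerivAt (x := y)).const_mul z).const_sub 1
    have h2 := (hasDerivAt_inv_pow n hy').comp y h1
    have h3 : HasDerivAt (fun y : ℝ => ((y ^ (1 - d) : ℝ) : ℂ))
        (((1 - d) * y ^ (1 - d - 1) : ℝ) : ℂ) y :=
      (Real.hasDerivAt_rpow_const (Or.inl hy.1.ne')).ofReal_comp
    refine HasDerivAt.congr_deriv (f := f) (h3.mul h2) ?_
    have h4 : y ^ (1 - d) = y * y ^ (-d) := by
      rw [sub_eq_add_neg, Real.rpow_add hy.1, Real.rpow_one]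
    have h5 : (1 - d - 1) = -d := by ring
    simp only [eulerIntegrand]
    rw [h4, h5]
    push_cast
    ring
  have hI : IntegrableOn (fun y : ℝ => z * (n * y * eulerIntegrand d (n + 1) z y)
      + (1 - d) * eulerIntegrand d n z y) (Set.Ioc 0 1) :=
    (hint.const_mul z).add ((integrableOn_eulerIntegrand hd n hz).const_mul _)
  have h := intervalIntegral.integral_eq_sub_of_hasDerivAt_of_le zero_le_one hcont hderiv
    ((intervalIntegrable_iff_integrableOn_Ioc_of_le zero_le_one).2 hI)
  rw [intervalIntegral.integral_of_le zero_le_one, integral_add (hint.const_mul z)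
    ((integrableOn_eulerIntegrand hd n hz).const_mul _), integral_const_mul,
    integral_const_mul] at h
  rw [eulerIntegral, h, hf]
  simp [Real.zero_rpow (show 1 - d ≠ 0 by linarith)]

/-- The function `(1 - z)^{-m} - m z ∫₀¹ y^{-d} (1 - z y)^{-m-1} dy`, which continues
`₂F₁(m, -d, 1 - d, z)` to the half-plane `Re z < 1`. -/
noncomputable def hyperContinuation (d : ℝ) (m : ℕ) (z : ℂ) : ℂ :=
  ((1 - z) ^ m)⁻¹ - m * z * eulerIntegral d (m + 1) z

/-- The differential equation `z G' = d (G - (1 - z)^{-m})`. -/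
lemma hasDerivAt_hyperContinuation {d : ℝ} (hd : d < 1) (m : ℕ) {z : ℂ} (hz : z.re < 1) :
    ∃ G', HasDerivAt (hyperContinuation d m) G' z ∧
      z * G' = d * (hyperContinuation d m z - ((1 - z) ^ m)⁻¹) := by
  have hne : 1 - z ≠ 0 := by
    have := one_sub_mul_ne_zero hz (y := 1) ⟨one_pos, le_rfl⟩
    simpa using this
  have h1 : HasDerivAt (fun w : ℂ => 1 - w) (-1) z := by
    simpa using (hasDerivAt_id z).const_sub 1
  have h2 := (hasDerivAt_inv_pow m hne).comp z h1
  have h3 := ((hasDerivAt_id z).const_mul (m : ℂ)).mul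
    (hasDerivAt_eulerIntegral hd (m + 1) hz)
  have hp := eulerIntegral_parts hd (m + 1) hz
  refine ⟨_, h2.sub h3, ?_⟩
  rw [hyperContinuation]
  simp only [id, mul_one]
  set K := eulerIntegral d (m + 1) z
  set K' := ∫ y in Set.Ioc (0 : ℝ) 1, ((m + 1 : ℕ) : ℂ) * y * eulerIntegrand d (m + 1 + 1) z y
  have hK' : z * K' = ((1 - z) ^ (m + 1))⁻¹ - (1 - d) * K := by rw [← hp]; ring
  linear_combination (-(m * z)) * hK'

lemma eulerIntegral_ofReal (d : ℝ) (n : ℕ) (x : ℝ) :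
    eulerIntegral d n x
      = ((∫ y in Set.Ioc (0 : ℝ) 1, y ^ (-d) * ((1 - x * y) ^ n)⁻¹ : ℝ) : ℂ) := by
  refine Eq.trans (integral_congr_ae (Eventually.of_forall fun y => ?_)) integral_ofReal
  simp [eulerIntegrand]

/-- Termwise integration of the binomial series. -/
lemma hasSum_eulerIntegral {d : ℝ} (hd : d < 1) (n : ℕ) {x : ℝ} (hx : |x| < 1) :
    HasSum (fun k : ℕ => ((k + n).choose n : ℝ) * x ^ k / (k + 1 - d))
      (∫ y in Set.Ioc (0 : ℝ) 1, y ^ (-d) * ((1 - x * y) ^ (n + 1))⁻¹) := by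
  set F : ℕ → ℝ → ℝ := fun k y => ((k + n).choose n : ℝ) * x ^ k * y ^ (k - d) with hF
  have hk : ∀ k : ℕ, (-1 : ℝ) < k - d := fun k => by
    have : (0 : ℝ) ≤ k := k.cast_nonneg
    linarith
  have hint : ∀ k, IntegrableOn (F k) (Set.Ioc 0 1) := fun k =>
    (integrableOn_rpow_Ioc (hk k)).const_mul _
  have hval : ∀ k, ∫ y in Set.Ioc (0 : ℝ) 1, F k y
      = ((k + n).choose n : ℝ) * x ^ k / (k + 1 - d) := by
    intro k
    rw [hF, integral_const_mul, integral_rpow_Ioc (hk k), mul_one_div]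
    congr 1; ring
  have hnorm : ∀ k, ∫ y in Set.Ioc (0 : ℝ) 1, ‖F k y‖
      = ((k + n).choose n : ℝ) * |x| ^ k * (1 / (k + 1 - d)) := by
    intro k
    have : ∀ y ∈ Set.Ioc (0 : ℝ) 1, ‖F k y‖ = ((k + n).choose n : ℝ) * |x| ^ k * y ^ (k - d) := by
      intro y hy
      rw [hF, norm_mul, norm_mul, norm_pow, Real.norm_natCast, Real.norm_eq_abs,
        Real.norm_of_nonneg (Real.rpow_nonneg hy.1.le _)]
    rw [setIntegral_congr_fun measurableSet_Ioc this, integral_const_mul,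
      integral_rpow_Ioc (hk k)]
    congr 2; ring
  have hs : Summable fun k => ∫ y in Set.Ioc (0 : ℝ) 1, ‖F k y‖ := by
    simp_rw [hnorm]
    have h1 :=
      (hasSum_choose_mul_geometric_of_norm_lt_one n (r := |x|) (by simpa using hx)).summable
    refine Summable.of_nonneg_of_le (fun k => ?_) (fun k => ?_) (h1.mul_right (1 / (1 - d)))
    · have := hk k
      have : 0 < (k : ℝ) + 1 - d := by linarith
      positivity
    · have h0 : (0 : ℝ) ≤ k := k.cast_nonneg
      gcongr
      linarith
  have h := hasSum_integral_of_summable_integral_norm hint hs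
  simp_rw [hval] at h
  refine (congrArg (HasSum _) ?_).mpr h
  refine setIntegral_congr_fun measurableSet_Ioc fun y hy => ?_
  have hxy : ‖x * y‖ < 1 := by
    rw [norm_mul, Real.norm_eq_abs, Real.norm_of_nonneg hy.1.le]
    exact (mul_le_of_le_one_right (abs_nonneg x) hy.2).trans_lt hx
  have h2 := (hasSum_choose_mul_geometric_of_norm_lt_one n hxy).mul_left (y ^ (-d))
  rw [one_div] at h2
  rw [← h2.tsum_eq]
  refine tsum_congr fun k => ?_
  rw [hF]
  dsimp only
  rw [sub_eq_add_neg, Real.rpow_add hy.1, Real.rpow_natCast, mul_pow]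
  ring

lemma poch_succ (z : ℝ) (k : ℕ) : poch z (k + 1) = poch z k * (z + k) :=
  ascPochhammer_succ_eval k z

lemma poch_zero (z : ℝ) : poch z 0 = 1 := by simp [poch]

lemma poch_one_sub_ne_zero {d : ℝ} (hd : d < 1) (k : ℕ) : poch (1 - d) k ≠ 0 := by
  induction k with
  | zero => simp [poch_zero]
  | succ k ih =>
    rw [poch_succ]
    have : (0 : ℝ) ≤ k := k.cast_nonneg
    exact mul_ne_zero ih (by linarith)

/-- `(-d)_k (k - d) = -d (1 - d)_k`. -/
lemma poch_neg_mul (d : ℝ) (k : ℕ) : poch (-d) k * (k - d) = -d * poch (1 - d) k := by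
  induction k with
  | zero => simp [poch_zero]
  | succ k ih =>
    rw [poch_succ, poch_succ]
    push_cast
    linear_combination (1 + k - d) * ih

lemma poch_natCast (m k : ℕ) : poch m k = k.factorial * ((m + k - 1).choose k : ℝ) := by
  have h := ascPochhammer_eval_cast ℝ k m
  rw [ascPochhammer_nat_eq_ascFactorial, Nat.ascFactorial_eq_factorial_mul_choose'] at h
  rw [poch, ← h]
  push_cast
  rfl

/-- The Gauss series is recovered by subtracting the two series in the definition of the
continuation term by term, using `(-d)_n / (1 - d)_n = -d / (n - d)`. -/
theorem isGaussHypergeometric_hyperContinuation {d : ℝ} (hd0 : 0 < d) (hd : d < 1) {m : ℕ}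
    (hm : 1 ≤ m) :
    IsGaussHypergeometric m (-d) (1 - d) fun x => (hyperContinuation d m x).re := by
  refine ⟨?_, fun x hx => ?_⟩
  · have hdiff : DifferentiableOn ℂ (hyperContinuation d m) {z : ℂ | z.re < 1} := fun z hz => by
      obtain ⟨G', h, _⟩ := hasDerivAt_hyperContinuation hd m hz
      exact h.differentiableAt.differentiableWithinAt
    have han := hdiff.analyticOnNhd (isOpen_lt Complex.continuous_re continuous_const)
    exact fun x hx => (han x (by simpa using hx)).re_ofReal
  · have h1 := hasSum_choose_mul_geometric_of_norm_lt_one (m - 1) (r := x) (by simpa using hx)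
    rw [Nat.sub_add_cancel hm] at h1
    have h2 := (hasSum_eulerIntegral hd m hx).mul_left (m * x)
    have hre : (hyperContinuation d m x).re = 1 / (1 - x) ^ m
        - m * x * ∫ y in Set.Ioc (0 : ℝ) 1, y ^ (-d) * ((1 - x * y) ^ (m + 1))⁻¹ := by
      rw [hyperContinuation, eulerIntegral_ofReal]
      rw [show ((1 - (x : ℂ)) ^ m)⁻¹ - m * x *
        ((∫ y in Set.Ioc (0 : ℝ) 1, y ^ (-d) * ((1 - x * y) ^ (m + 1))⁻¹ : ℝ) : ℂ)
        = ((1 / (1 - x) ^ m - m * x *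
          ∫ y in Set.Ioc (0 : ℝ) 1, y ^ (-d) * ((1 - x * y) ^ (m + 1))⁻¹ : ℝ) : ℂ) by
          push_cast; ring, Complex.ofReal_re]
    dsimp only
    rw [hre]
    -- The terms of the second series, shifted by one.
    set a : ℕ → ℝ := fun n => ((n + (m - 1)).choose (m - 1) : ℝ) * x ^ n with ha
    have h2' : HasSum (fun n : ℕ => (n : ℝ) / (n - d) * a n)
        (m * x * ∫ y in Set.Ioc (0 : ℝ) 1, y ^ (-d) * ((1 - x * y) ^ (m + 1))⁻¹) := by
      refine (hasSum_nat_add_iff' 1).1 ?_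
      simp only [Finset.range_one, Finset.sum_singleton, Nat.cast_zero, zero_div, zero_mul,
        sub_zero]
      refine (congrArg (fun f : ℕ → ℝ => HasSum f _) (funext fun n => ?_)).mp h2
      rw [ha]
      dsimp only
      have hc : ((n : ℝ) + 1) * ((n + 1 + (m - 1)).choose (m - 1) : ℝ)
          = m * ((n + m).choose m : ℝ) := by
        obtain ⟨k, rfl⟩ := Nat.exists_eq_succ_of_ne_zero (by omega : m ≠ 0)
        have h := Nat.choose_succ_right_eq (n + (k + 1)) k
        simp only [Nat.succ_eq_add_one, Nat.add_sub_cancel]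
        have e : n + (k + 1) - k = n + 1 := by omega
        rw [e] at h
        rw [show n + 1 + k = n + (k + 1) by ring]
        have h' : (((n + (k + 1)).choose (k + 1) : ℕ) : ℝ) * (k + 1)
          = ((n + (k + 1)).choose k : ℕ) * (n + 1) := by exact_mod_cast h
        push_cast
        linarith
      have h0 : (0 : ℝ) ≤ n := n.cast_nonneg
      have : (n : ℝ) + 1 - d ≠ 0 := by linarith
      push_cast
      rw [pow_succ]
      field_simp
      linear_combination (-(x ^ n * x)) * hc
    rw [← (h1.sub h2').tsum_eq, ordinaryHypergeometric_eq_tsum]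
    refine tsum_congr fun n => ?_
    change _ = ((n.factorial : ℝ)⁻¹ * poch m n * poch (-d) n * (poch (1 - d) n)⁻¹) • x ^ n
    have hn : (n : ℝ) - d ≠ 0 := by
      rcases Nat.eq_zero_or_pos n with rfl | h
      · simpa using hd0.ne'
      · have : (1 : ℝ) ≤ n := by exact_mod_cast h
        linarith
    have hp : poch (-d) n * (poch (1 - d) n)⁻¹ = -d / (n - d) := by
      rw [← div_eq_mul_inv, div_eq_div_iff (poch_one_sub_ne_zero hd n) hn, poch_neg_mul]
    have hch : (n + (m - 1)).choose (m - 1) = (m + n - 1).choose n := by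
      rw [show m + n - 1 = n + (m - 1) by omega]
      exact (Nat.choose_symm_add).symm
    have hf : (n.factorial : ℝ) ≠ 0 := by positivity
    rw [mul_assoc, hp, poch_natCast, ← hch, smul_eq_mul, ha]
    dsimp only
    field_simp
    ring

lemma isGaussHypergeometric_gaussHypergeometric {d : ℝ} (hd0 : 0 < d) (hd : d < 1) {m : ℕ}
    (hm : 1 ≤ m) :
    IsGaussHypergeometric m (-d) (1 - d) (gaussHypergeometric m (-d) (1 - d)) := by
  have h : ∃ F : ℝ → ℝ, IsGaussHypergeometric m (-d) (1 - d) F :=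
    ⟨_, isGaussHypergeometric_hyperContinuation hd0 hd hm⟩
  have e : gaussHypergeometric m (-d) (1 - d) = Classical.choose h := by
    funext z
    rw [gaussHypergeometric, dif_pos h]
  rw [e]
  exact Classical.choose_spec h

lemma gaussHypergeometric_eqOn {d : ℝ} (hd0 : 0 < d) (hd : d < 1) {m : ℕ} (hm : 1 ≤ m) :
    Set.EqOn (gaussHypergeometric m (-d) (1 - d)) (fun x => (hyperContinuation d m x).re)
      (Set.Iio 1) :=
  (isGaussHypergeometric_gaussHypergeometric hd0 hd hm).eqOn
    (isGaussHypergeometric_hyperContinuation hd0 hd hm)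

lemma gaussHypergeometric_pos {d : ℝ} (hd0 : 0 < d) (hd : d < 1) {m : ℕ} (hm : 1 ≤ m) {x : ℝ}
    (hx : x ≤ 0) : 0 < gaussHypergeometric m (-d) (1 - d) x := by
  have hx1 : x ∈ Set.Iio (1 : ℝ) := by
    show x < 1
    linarith
  rw [gaussHypergeometric_eqOn hd0 hd hm hx1]
  dsimp only
  rw [hyperContinuation, eulerIntegral_ofReal]
  have hI : 0 ≤ ∫ y in Set.Ioc (0 : ℝ) 1, y ^ (-d) * ((1 - x * y) ^ (m + 1))⁻¹ := by
    refine setIntegral_nonneg measurableSet_Ioc fun y hy => ?_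
    have h1 : 0 ≤ 1 - x * y := by nlinarith [hy.1]
    have h2 : 0 ≤ y ^ (-d) := Real.rpow_nonneg hy.1.le _
    positivity
  set J := ∫ y in Set.Ioc (0 : ℝ) 1, y ^ (-d) * ((1 - x * y) ^ (m + 1))⁻¹
  have e : ((1 - (x : ℂ)) ^ m)⁻¹ - m * x * (J : ℂ)
      = ((((1 - x) ^ m)⁻¹ + m * (-x) * J : ℝ) : ℂ) := by push_cast; ring
  rw [e, Complex.ofReal_re]
  have h1 : 0 < 1 - x := by linarith
  have h2 : 0 ≤ -x := by linarith
  positivity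

lemma gaussHypergeometric_zero {d : ℝ} (hd0 : 0 < d) (hd : d < 1) {m : ℕ} (hm : 1 ≤ m) :
    gaussHypergeometric m (-d) (1 - d) 0 = 1 := by
  rw [(isGaussHypergeometric_gaussHypergeometric hd0 hd hm).2 0 (by simp),
    ordinaryHypergeometric_zero]

/-- The differential equation `x F' = d (F - (1 - x)^{-m})` of `F = ₂F₁(m, -d, 1 - d, ·)`. -/
lemma gaussHypergeometric_ode {d : ℝ} (hd0 : 0 < d) (hd : d < 1) {m : ℕ} (hm : 1 ≤ m) {x : ℝ}
    (hx : x < 1) :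
    DifferentiableAt ℝ (gaussHypergeometric m (-d) (1 - d)) x ∧
      x * deriv (gaussHypergeometric m (-d) (1 - d)) x
        = d * (gaussHypergeometric m (-d) (1 - d) x - ((1 - x) ^ m)⁻¹) := by
  obtain ⟨G', hG, hode⟩ := hasDerivAt_hyperContinuation hd m (z := (x : ℂ)) (by simpa using hx)
  have heq := gaussHypergeometric_eqOn hd0 hd hm
  have hF : HasDerivAt (gaussHypergeometric m (-d) (1 - d)) G'.re x := by
    refine hG.real_of_complex.congr_of_eventuallyEq ?_
    filter_upwards [Iio_mem_nhds hx] with y hy using heq hy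
  refine ⟨hF.differentiableAt, ?_⟩
  rw [hF.deriv, heq hx]
  have h := congrArg Complex.re hode
  have e : ((1 - (x : ℂ)) ^ m)⁻¹ = ((((1 - x) ^ m)⁻¹ : ℝ) : ℂ) := by push_cast; ring
  rw [e, Complex.re_ofReal_mul, Complex.re_ofReal_mul, Complex.sub_re, Complex.ofReal_re] at h
  exact h

/-- The successive derivatives of `F = ₂F₁(m, -d, 1 - d, ·)`, obtained from the differential
equation by applying `x d/dx` repeatedly. -/
lemma pow_mul_iteratedDeriv_gaussHypergeometric {d : ℝ} (hd0 : 0 < d) (hd : d < 1) {m : ℕ}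
    (hm : 1 ≤ m) (k : ℕ) {x : ℝ} (hx : x < 1) :
    x ^ k * iteratedDeriv k (gaussHypergeometric m (-d) (1 - d)) x
      = (-1) ^ k * poch (-d) k * (gaussHypergeometric m (-d) (1 - d) x -
          ∑ i ∈ Finset.range k,
            poch m i / poch (1 - d) i * ((-x) ^ i * ((1 - x) ^ (m + i))⁻¹)) := by
  set F := gaussHypergeometric m (-d) (1 - d) with hF
  induction k generalizing x with
  | zero => simp [poch_zero]
  | succ k ih =>
    have han := (isGaussHypergeometric_gaussHypergeometric hd0 hd hm).1
    have hdk : HasDerivAt (iteratedDeriv k F) (iteratedDeriv (k + 1) F x) x := by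
      rw [iteratedDeriv_succ, iteratedDeriv_eq_iterate]
      exact ((han.iterated_deriv k) x hx).differentiableAt.hasDerivAt
    obtain ⟨hFd, hode⟩ := gaussHypergeometric_ode hd0 hd hm hx
    rw [← hF] at hFd hode
    have hx1 : 1 - x ≠ 0 := by linarith
    have h1x : HasDerivAt (fun y : ℝ => 1 - y) (-1) x := by
      simpa using (hasDerivAt_id x).const_sub 1
    -- The summand and its derivative.
    set T : ℕ → ℝ → ℝ := fun i y =>
      poch m i / poch (1 - d) i * ((-y) ^ i * ((1 - y) ^ (m + i))⁻¹) with hT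
    have hTd : ∀ i, ∃ T', HasDerivAt (T i) T' x ∧
        x * T' = i * T i x - (i + 1 - d) * T (i + 1) x := by
      intro i
      have h1 := (hasDerivAt_neg x).pow i
      have h2 := (hasDerivAt_inv_pow (m + i) hx1).comp x h1x
      refine ⟨_, (h1.mul h2).const_mul (poch m i / poch (1 - d) i), ?_⟩
      have hi : (1 - d + i : ℝ) ≠ 0 := by
        have : (0 : ℝ) ≤ i := i.cast_nonneg
        linarith
      have hp := poch_one_sub_ne_zero hd i
      have hpow : x * (i * (-x) ^ (i - 1) * -1) = i * (-x) ^ i := by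
        rcases Nat.eq_zero_or_pos i with rfl | hi0
        · simp
        · obtain ⟨j, rfl⟩ := Nat.exists_eq_succ_of_ne_zero hi0.ne'
          simp only [Nat.succ_eq_add_one, Nat.add_sub_cancel]
          ring
      have hq : poch m (i + 1) / poch (1 - d) (i + 1) * (i + 1 - d)
          = poch m i / poch (1 - d) i * (m + i) := by
        rw [poch_succ, poch_succ]
        have hi' : (i : ℝ) + 1 - d ≠ 0 := by
          intro h; exact hi (by linarith)
        field_simp
        ring
      simp only [hT, Pi.pow_apply, Function.comp_apply]
      rw [show m + (i + 1) = m + i + 1 by ring]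
      push_cast
      have e : x * (poch m i / poch (1 - d) i * (↑i * (-x) ^ (i - 1) * -1 * ((1 - x) ^ (m + i))⁻¹
            + (-x) ^ i * (-((m + i) * ((1 - x) ^ (m + i + 1))⁻¹) * -1)))
          = poch m i / poch (1 - d) i * ((x * (↑i * (-x) ^ (i - 1) * -1)) * ((1 - x) ^ (m + i))⁻¹)
            - (poch m i / poch (1 - d) i * (m + i)) *
              ((-x) ^ (i + 1) * ((1 - x) ^ (m + i + 1))⁻¹) := by ring
      rw [hpow, ← hq] at e
      refine Eq.trans ?_ (e.trans ?_)
      · ring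
      · ring
    choose T' hT1 hT2 using hTd
    have hL : HasDerivAt (fun y => y ^ k * iteratedDeriv k F y)
        (k * x ^ (k - 1) * iteratedDeriv k F x + x ^ k * iteratedDeriv (k + 1) F x) x := by
      have h := ((hasDerivAt_id x).pow k).mul hdk
      rw [mul_one] at h
      exact h
    have hR : HasDerivAt (fun y => (-1) ^ k * poch (-d) k * (F y - ∑ i ∈ Finset.range k, T i y))
        ((-1) ^ k * poch (-d) k * (deriv F x - ∑ i ∈ Finset.range k, T' i)) x := by
      refine HasDerivAt.const_mul _ (hFd.hasDerivAt.sub ?_)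
      exact HasDerivAt.fun_sum fun i _ => hT1 i
    have heq : (fun y => y ^ k * iteratedDeriv k F y) =ᶠ[𝓝 x]
        fun y => (-1) ^ k * poch (-d) k * (F y - ∑ i ∈ Finset.range k, T i y) := by
      filter_upwards [Iio_mem_nhds hx] with y hy using ih hy
    have hder := hL.unique (hR.congr_of_eventuallyEq heq)
    have hpow : x * (k * x ^ (k - 1)) = k * x ^ k := by
      rcases Nat.eq_zero_or_pos k with rfl | hk0
      · simp
      · obtain ⟨j, rfl⟩ := Nat.exists_eq_succ_of_ne_zero hk0.ne'
        simp only [Nat.succ_eq_add_one, Nat.add_sub_cancel]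
        ring
    have hx' : x * ∑ i ∈ Finset.range k, T' i
        = ∑ i ∈ Finset.range k, (i * T i x - (i + 1 - d) * T (i + 1) x) := by
      rw [Finset.mul_sum]
      exact Finset.sum_congr rfl fun i _ => hT2 i
    -- Telescoping.
    have htel : ∀ n : ℕ, ∑ i ∈ Finset.range n, (i * T i x - (i + 1 - d) * T (i + 1) x)
        = n * ∑ i ∈ Finset.range n, T i x - d * T 0 x
          - (n - d) * ∑ i ∈ Finset.range (n + 1), T i x := by
      intro n
      induction n with
      | zero => simp
      | succ n ihn =>
        rw [Finset.sum_range_succ, ihn, Finset.sum_range_succ _ (n + 1), Finset.sum_range_succ _ n]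
        push_cast
        ring
    have hT0 : T 0 x = ((1 - x) ^ m)⁻¹ := by simp [hT, poch_zero]
    rw [htel] at hx'
    rw [poch_succ]
    have h3 : x * (k * x ^ (k - 1) * iteratedDeriv k F x + x ^ k * iteratedDeriv (k + 1) F x)
        = k * (x ^ k * iteratedDeriv k F x) + x ^ (k + 1) * iteratedDeriv (k + 1) F x := by
      rw [mul_add, ← mul_assoc, hpow]; ring
    rw [hder, ih hx] at h3
    have h4 : x ^ (k + 1) * iteratedDeriv (k + 1) F x
        = (-1) ^ k * poch (-d) k * (x * deriv F x - x * ∑ i ∈ Finset.range k, T' i)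
          - k * ((-1) ^ k * poch (-d) k * (F x - ∑ i ∈ Finset.range k, T i x)) := by
      linear_combination -h3
    change _ = _ * (F x - ∑ i ∈ Finset.range (k + 1), T i x)
    rw [h4, hode, hx', hT0, pow_succ]
    ring

section Parameters

variable {α θ : ℝ} {m : ℕ}

lemma two_div_pos (hα : 2 < α) : 0 < 2 / α := by positivity

lemma two_div_lt_one (hα : 2 < α) : 2 / α < 1 := by rw [div_lt_one] <;> linarith

lemma eta_eq (hm : 1 ≤ m) :
    eta α (m * θ) m 1 = gaussHypergeometric m (-(2 / α)) (1 - 2 / α) (-θ) := by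
  have : (m : ℝ) ≠ 0 := by positivity
  rw [eta, Real.one_rpow, mul_one, mul_div_cancel_left₀ _ this]

lemma eta_pos (hα : 2 < α) (hθ : 0 < θ) (hm : 1 ≤ m) : 0 < eta α (m * θ) m 1 := by
  rw [eta_eq hm]
  exact gaussHypergeometric_pos (two_div_pos hα) (two_div_lt_one hα) hm (by linarith)

/-- `ψ_k = -θ^k F^{(k)}(-θ)` for `F = ₂F₁(m, -2/α, 1 - 2/α, ·)`. -/
lemma psi_eq (hα : 2 < α) (hθ : 0 < θ) (hm : 1 ≤ m) (k : ℕ) :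
    psi α θ m k
      = -(θ ^ k * iteratedDeriv k (gaussHypergeometric m (-(2 / α)) (1 - 2 / α)) (-θ)) := by
  have h := pow_mul_iteratedDeriv_gaussHypergeometric (two_div_pos hα) (two_div_lt_one hα) hm k
    (x := -θ) (by linarith)
  have h1 : ((-1 : ℝ)) ^ k * (-1) ^ k = 1 := by rw [← mul_pow]; simp
  have hθk : θ ^ k * iteratedDeriv k (gaussHypergeometric m (-(2 / α)) (1 - 2 / α)) (-θ)
      = (-1) ^ k * ((-θ) ^ k *
        iteratedDeriv k (gaussHypergeometric m (-(2 / α)) (1 - 2 / α)) (-θ)) := by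
    rw [neg_pow θ, ← mul_assoc, ← mul_assoc, h1, one_mul]
  rw [hθk, h, psi, eta_eq hm, ← mul_assoc, ← mul_assoc, h1, one_mul, neg_mul]
  congr 3
  refine Finset.sum_bij' (fun j _ => k - j) (fun i _ => k - i) ?_ ?_ ?_ ?_ ?_
  · intro j hj
    simp only [Finset.mem_Icc, Finset.mem_range] at *
    omega
  · intro j hj
    simp only [Finset.mem_Icc, Finset.mem_range] at *
    omega
  · intro j hj
    simp only [Finset.mem_Icc] at *
    omega
  · intro j hj
    simp only [Finset.mem_range] at *
    omega
  · intro j _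
    rw [neg_neg, sub_neg_eq_add]
    ring

end Parameters

/-! ### The gamma law with integer shape -/

/-- The sum of the derivatives telescopes. -/
lemma hasDerivAt_sum_pow_div_factorial_mul_exp (c : ℝ) (n : ℕ) (x : ℝ) :
    HasDerivAt (fun x => ∑ k ∈ Finset.range (n + 1), (c * x) ^ k / (k.factorial : ℝ) *
      Real.exp (-(c * x))) (-(c * ((c * x) ^ n / (n.factorial : ℝ) * Real.exp (-(c * x))))) x := by
  have hc : HasDerivAt (fun x : ℝ => c * x) c x := by simpa using (hasDerivAt_id x).const_mul c
  have he : HasDerivAt (fun x : ℝ => Real.exp (-(c * x))) (Real.exp (-(c * x)) * -c) x :=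
    hc.neg.exp
  induction n with
  | zero =>
    simp only [zero_add, Finset.range_one, Finset.sum_singleton, pow_zero, Nat.factorial_zero,
      Nat.cast_one, div_one, one_mul]
    exact he.congr_deriv (by ring)
  | succ n ih =>
    simp_rw [Finset.sum_range_succ _ (n + 1)]
    have h := ((hc.pow (n + 1)).div_const ((n + 1).factorial : ℝ)).mul he
    refine (ih.add h).congr_deriv ?_
    rw [Nat.factorial_succ]
    push_cast
    simp only [Pi.pow_apply]
    have : (n.factorial : ℝ) ≠ 0 := by positivity
    have : (n : ℝ) + 1 ≠ 0 := by positivity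
    field_simp
    ring

/-- The tail of the gamma law `Γ(m, 1/m)` is a Poisson sum. -/
lemma gammaMeasure_Ioi {m : ℕ} (hm : 1 ≤ m) {y : ℝ} (hy : 0 ≤ y) :
    gammaMeasure m m (Set.Ioi y) = ENNReal.ofReal (∑ k ∈ Finset.range m,
      (m * y) ^ k / (k.factorial : ℝ) * Real.exp (-(m * y))) := by
  obtain ⟨n, rfl⟩ := Nat.exists_eq_succ_of_ne_zero (by omega : m ≠ 0)
  simp only [Nat.succ_eq_add_one]
  set c : ℝ := ((n + 1 : ℕ) : ℝ) with hc
  have hc0 : 0 < c := by positivity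
  set G : ℝ → ℝ := fun x => -∑ k ∈ Finset.range (n + 1), (c * x) ^ k / (k.factorial : ℝ) *
      Real.exp (-(c * x)) with hG
  have hpdf : ∀ x ∈ Set.Ioi y, gammaPDF c c x
      = ENNReal.ofReal (c * ((c * x) ^ n / (n.factorial : ℝ) * Real.exp (-(c * x)))) := by
    intro x hx
    have hx0 : 0 < x := hy.trans_lt hx
    rw [gammaPDF_of_nonneg hx0.le]
    congr 1
    have h1 : c - 1 = (n : ℝ) := by rw [hc]; push_cast; ring
    have h2 : Real.Gamma c = n.factorial := by
      rw [hc]; push_cast; exact Real.Gamma_nat_eq_factorial n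
    rw [h1, Real.rpow_natCast, h2, hc, Real.rpow_natCast, ← hc, pow_succ, mul_pow]
    ring
  have hd : ∀ x ∈ Set.Ioi y, HasDerivAt G
      (c * ((c * x) ^ n / (n.factorial : ℝ) * Real.exp (-(c * x)))) x := fun x _ => by
    have h := (hasDerivAt_sum_pow_div_factorial_mul_exp c n x).neg
    rw [neg_neg] at h
    exact h
  have hcont : ContinuousWithinAt G (Set.Ici y) y :=
    (hasDerivAt_sum_pow_div_factorial_mul_exp c n y).neg.continuousAt.continuousWithinAt
  have hnn : ∀ x ∈ Set.Ioi y, 0 ≤ c * ((c * x) ^ n / (n.factorial : ℝ) * Real.exp (-(c * x))) := by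
    intro x hx
    have hx0 : 0 < x := hy.trans_lt hx
    positivity
  have ht : Tendsto G atTop (𝓝 0) := by
    rw [← neg_zero]
    refine Tendsto.neg ?_
    rw [← Finset.sum_const_zero (s := Finset.range (n + 1))]
    refine tendsto_finsetSum _ fun k _ => ?_
    have h := ((Real.tendsto_pow_mul_exp_neg_atTop_nhds_zero k).comp
      (tendsto_id.const_mul_atTop hc0)).div_const (k.factorial : ℝ)
    rw [zero_div] at h
    refine h.congr fun x => ?_
    simp only [Function.comp_apply, id]
    ring
  rw [gammaMeasure, withDensity_apply _ measurableSet_Ioi,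
    setLIntegral_congr_fun measurableSet_Ioi hpdf,
    ← ofReal_integral_eq_lintegral_ofReal (integrableOn_Ioi_deriv_of_nonneg hcont hd hnn ht)
      ((ae_restrict_iff' measurableSet_Ioi).2 (Eventually.of_forall hnn)),
    integral_Ioi_of_hasDerivAt_of_nonneg hcont hd hnn ht, zero_sub, hG, neg_neg]

/-- The Laplace transform of the gamma law, by rescaling its density. -/
lemma expNeg_markExponent_gamma {m : ℕ} (hm : 1 ≤ m) {s : ℝ} (hs : 0 ≤ s) :
    expNeg (markExponent (gammaMeasure m m) (ENNReal.ofReal s))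
      = ENNReal.ofReal (((1 + s / m) ^ m)⁻¹) := by
  have hm0 : (0 : ℝ) < m := by exact_mod_cast hm
  have := isProbabilityMeasure_gammaMeasure hm0 hm0
  have hpt : ∀ h : ℝ, gammaPDF m m h * expNeg (ENNReal.ofReal s * ENNReal.ofReal h)
      = ENNReal.ofReal (((1 + s / m) ^ m)⁻¹) * gammaPDF m (m + s) h := by
    intro h
    rcases lt_or_ge h 0 with hh | hh
    · simp [gammaPDF_of_neg hh]
    · rw [gammaPDF_of_nonneg hh, gammaPDF_of_nonneg hh, ← ENNReal.ofReal_mul hs,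
        expNeg_ofReal (mul_nonneg hs hh), ← ENNReal.ofReal_mul (by positivity),
        ← ENNReal.ofReal_mul (by positivity)]
      congr 1
      have e : -((m + s) * h) = -(m * h) + -(s * h) := by ring
      have e2 : (1 + s / m) ^ m = ((m : ℝ) + s) ^ m / m ^ m := by
        rw [← div_pow]; congr 1; field_simp
      rw [e, Real.exp_add, e2, Real.rpow_natCast, Real.rpow_natCast]
      have : ((m : ℝ) + s) ^ m ≠ 0 := by positivity
      field_simp
  have mpdf : Measurable (gammaPDF m m) :=
    ENNReal.measurable_ofReal.comp (measurable_gammaPDFReal _ _)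
  rw [expNeg_markExponent, gammaMeasure,
    lintegral_withDensity_eq_lintegral_mul _ mpdf (by fun_prop)]
  simp only [Pi.mul_apply]
  rw [lintegral_congr hpt, lintegral_const_mul' _ _ ENNReal.ofReal_ne_top,
    lintegral_gammaPDF_eq_one hm0 (by positivity), mul_one]

/-! ### From the Laplace transform of the interference to the coverage probability -/

/-- The contribution of the `k`-th derivative of `exp (-u ₂F₁(m, -2/α, 1 - 2/α, ·))` at `-θ` to
the coverage probability, written with `ψ` by Faà di Bruno's formula. -/
noncomputable def coverageTerm (α θ : ℝ) (m : ℕ) (u : ℝ) (k : ℕ) : ℝ :=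
  1 / (k.factorial : ℝ) * (Real.exp (-(u * eta α (m * θ) m 1)) *
    ∑ c : OrderedFinpartition k, u ^ c.length * ∏ i, psi α θ m (c.partSize i))

lemma sum_partSize {k : ℕ} (c : OrderedFinpartition k) : ∑ i, c.partSize i = k := by
  have h := Fintype.card_congr c.equivSigma
  simpa using h

/-- Faà di Bruno's formula for `exp (-u F)`, the derivatives of `F` being expressed through `ψ`. -/
lemma coverageTerm_eq {α θ : ℝ} {m : ℕ} (hα : 2 < α) (hθ : 0 < θ) (hm : 1 ≤ m) (u : ℝ) (k : ℕ) :
    θ ^ k / (k.factorial : ℝ) * iteratedDeriv k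
        (fun t => Real.exp (-u * gaussHypergeometric m (-(2 / α)) (1 - 2 / α) t)) (-θ)
      = coverageTerm α θ m u k := by
  set F := gaussHypergeometric m (-(2 / α)) (1 - 2 / α) with hF
  have han : AnalyticAt ℝ F (-θ) :=
    (isGaussHypergeometric_gaussHypergeometric (two_div_pos hα) (two_div_lt_one hα) hm).1 (-θ)
      (show -θ < 1 by linarith)
  have hg : ContDiffAt ℝ k (fun y => Real.exp (-u * y)) (F (-θ)) := by fun_prop
  have h := iteratedDeriv_comp_eq_sum_orderedFinpartition (i := k) hg
    (han.contDiffAt (n := k)) le_rfl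
  have h' : iteratedDeriv k (fun t => Real.exp (-u * F t)) (-θ) = _ := h
  rw [h', coverageTerm, eta_eq hm, ← hF]
  simp_rw [iteratedDeriv_exp_const_mul]
  rw [div_mul_eq_mul_div, mul_comm (1 / (k.factorial : ℝ)), mul_one_div]
  congr 1
  rw [Finset.mul_sum, Finset.mul_sum]
  refine Finset.sum_congr rfl fun c _ => ?_
  have hpow : θ ^ k = ∏ i, θ ^ c.partSize i := by
    rw [Finset.prod_pow_eq_pow_sum, sum_partSize]
  have hpsi : ∏ i, psi α θ m (c.partSize i)
      = (-1) ^ c.length * ((∏ i, θ ^ c.partSize i) * ∏ i, iteratedDeriv (c.partSize i) F (-θ)) := by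
    simp_rw [psi_eq hα hθ hm]
    rw [← Finset.prod_mul_distrib, Finset.prod_neg, Finset.card_univ, Fintype.card_fin]
  rw [hpsi, ← hpow, neg_pow u]
  have : Real.exp (-u * F (-θ)) = Real.exp (-(u * F (-θ))) := by rw [neg_mul]
  rw [this]
  ring

/-- If the transform of `Z` is `s ↦ exp (-u ₂F₁(m, -2/α, 1 - 2/α, -s θ / m))`, then the probability
that a gamma variable exceeds `Z` is the sum of the coverage terms, all of which are
nonnegative. -/
theorem measure_lt_gamma {α θ : ℝ} {m : ℕ} (hα : 2 < α) (hθ : 0 < θ) (hm : 1 ≤ m) {u : ℝ}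
    (ρ : Measure Ω) [IsFiniteMeasure ρ] {Z : Ω → ℝ≥0∞} (hZ : Measurable Z)
    (hL : ∀ s : ℝ, 0 < s → ∫⁻ ω, expNeg (ENNReal.ofReal s * Z ω) ∂ρ
      = ENNReal.ofReal (Real.exp (-u *
          gaussHypergeometric m (-(2 / α)) (1 - 2 / α) (-(s * θ / m))))) :
    ((gammaMeasure m m).prod ρ) {p : ℝ × Ω | Z p.2 < ENNReal.ofReal p.1}
        = ENNReal.ofReal (∑ k ∈ Finset.range m, coverageTerm α θ m u k) ∧
      ∀ k, 0 ≤ coverageTerm α θ m u k := by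
  have hm0 : (0 : ℝ) < m := by exact_mod_cast hm
  have := isProbabilityMeasure_gammaMeasure hm0 hm0
  set F := gaussHypergeometric m (-(2 / α)) (1 - 2 / α) with hF
  -- Where `Z = ∞` neither the event nor the transform has any mass.
  set ρ' := ρ.restrict {ω | Z ω ≠ ∞} with hρ'
  have mfin : MeasurableSet {ω | Z ω ≠ ∞} := (hZ (measurableSet_singleton ∞)).compl
  -- The scaling makes `mgf W` equal to `exp (-u F)` on the negative half-line.
  set W : Ω → ℝ := fun ω => m / θ * (Z ω).toReal with hW
  have mW : Measurable W := hZ.ennreal_toReal.const_mul _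
  have hW0 : ∀ ω, 0 ≤ W ω := fun ω => by positivity
  have hint : ∀ t : ℝ, t ≤ 0 → Integrable (fun ω => Real.exp (t * W ω)) ρ' := by
    intro t ht
    refine Integrable.mono' (integrable_const 1)
      (by fun_prop) (Eventually.of_forall fun ω => ?_)
    rw [Real.norm_of_nonneg (Real.exp_nonneg _)]
    exact Real.exp_le_one_iff.2 (mul_nonpos_of_nonpos_of_nonneg ht (hW0 ω))
  have hmgf : ∀ t : ℝ, t < 0 → mgf W ρ' t = Real.exp (-u * F t) := by
    intro t ht
    have hs : 0 < -t * (m / θ) := by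
      have : 0 < -t := by linarith
      positivity
    have h := hL _ hs
    have e1 : -(-t * (m / θ) * θ / m) = t := by field_simp
    rw [e1] at h
    have e2 : ∫⁻ ω, expNeg (ENNReal.ofReal (-t * (m / θ)) * Z ω) ∂ρ
        = ∫⁻ ω, ENNReal.ofReal (Real.exp (t * W ω)) ∂ρ' := by
      rw [hρ', ← lintegral_indicator mfin]
      refine lintegral_congr fun ω => ?_
      by_cases hω : Z ω = ∞
      · rw [Set.indicator_of_notMem (by simpa using hω), hω, ENNReal.mul_top
          (by simpa using hs), expNeg_top]
      · rw [Set.indicator_of_mem (show ω ∈ {ω | Z ω ≠ ∞} from hω)]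
        conv_lhs => rw [← ENNReal.ofReal_toReal hω]
        rw [← ENNReal.ofReal_mul hs.le, expNeg_ofReal (by positivity)]
        congr 2
        rw [hW]; ring
    rw [e2, ← ofReal_integral_eq_lintegral_ofReal (hint t ht.le)
      (Eventually.of_forall fun ω => Real.exp_nonneg _)] at h
    exact (ENNReal.ofReal_eq_ofReal_iff (integral_nonneg fun ω => Real.exp_nonneg _)
      (Real.exp_nonneg _)).1 h
  -- Every negative exponent is admissible, so the transform may be differentiated at `-θ`.
  have hmem : -θ ∈ interior (integrableExpSet W ρ') :=
    mem_interior.2 ⟨Set.Iio 0, fun t ht => hint t (le_of_lt ht), isOpen_Iio,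
      show -θ < 0 by linarith⟩
  have hterm : ∀ k : ℕ, coverageTerm α θ m u k
      = ∫ ω, (m * (Z ω).toReal) ^ k / (k.factorial : ℝ) * Real.exp (-(m * (Z ω).toReal)) ∂ρ' := by
    intro k
    have h1 := iteratedDeriv_mgf hmem k
    have h2 : mgf W ρ' =ᶠ[𝓝 (-θ)] fun t => Real.exp (-u * F t) := by
      filter_upwards [Iio_mem_nhds (show -θ < 0 by linarith)] with t ht using hmgf t ht
    rw [h2.iteratedDeriv_eq] at h1
    rw [← coverageTerm_eq hα hθ hm, ← hF, h1, ← integral_const_mul]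
    refine integral_congr_ae (Eventually.of_forall fun ω => ?_)
    dsimp only
    have e1 : (m : ℝ) * (Z ω).toReal = θ * W ω := by rw [hW]; field_simp
    rw [e1, mul_pow, neg_mul]
    ring
  refine ⟨?_, fun k => ?_⟩
  · have mS : MeasurableSet {p : ℝ × Ω | Z p.2 < ENNReal.ofReal p.1} :=
      measurableSet_lt (hZ.comp measurable_snd) (ENNReal.measurable_ofReal.comp measurable_fst)
    have hinner : ∀ ω, gammaMeasure m m ((fun h => (h, ω)) ⁻¹'
          {p : ℝ × Ω | Z p.2 < ENNReal.ofReal p.1})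
        = {ω | Z ω ≠ ∞}.indicator (fun ω => ENNReal.ofReal (∑ k ∈ Finset.range m,
          (m * (Z ω).toReal) ^ k / (k.factorial : ℝ) * Real.exp (-(m * (Z ω).toReal)))) ω := by
      intro ω
      by_cases hω : Z ω = ∞
      · rw [Set.indicator_of_notMem (by simpa using hω)]
        convert measure_empty (μ := gammaMeasure m m)
        ext h
        simp [hω]
      · rw [Set.indicator_of_mem (show ω ∈ {ω | Z ω ≠ ∞} from hω),
          ← gammaMeasure_Ioi hm ENNReal.toReal_nonneg]
        congr 1
        ext h
        exact ENNReal.lt_ofReal_iff_toReal_lt hω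
    have hI : ∀ k ∈ Finset.range m, Integrable (fun ω => (m * (Z ω).toReal) ^ k /
        (k.factorial : ℝ) * Real.exp (-(m * (Z ω).toReal))) ρ' := by
      intro k _
      have h := (integrable_pow_mul_exp_of_mem_interior_integrableExpSet hmem k).const_mul
        (θ ^ k / (k.factorial : ℝ))
      refine h.congr (Eventually.of_forall fun ω => ?_)
      dsimp only
      have e1 : (m : ℝ) * (Z ω).toReal = θ * W ω := by rw [hW]; field_simp
      rw [e1, mul_pow, neg_mul]
      ring
    rw [Measure.prod_apply_symm mS, lintegral_congr hinner, lintegral_indicator mfin,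
      ← ofReal_integral_eq_lintegral_ofReal (integrable_finsetSum _ hI)
        (Eventually.of_forall fun ω => Finset.sum_nonneg fun k _ => by positivity),
      integral_finsetSum _ hI]
    simp_rw [hterm]
  · rw [hterm]
    exact integral_nonneg fun ω => by positivity

/-! ### Radial integrals and the integral of the coverage terms -/

lemma lintegral_rpow_mul_exp_neg_mul {a r : ℝ} (ha : 0 < a) (hr : 0 < r) :
    ∫⁻ t in Set.Ioi (0 : ℝ), ENNReal.ofReal (t ^ (a - 1) * Real.exp (-(r * t)))
      = ENNReal.ofReal ((1 / r) ^ a * Real.Gamma a) := by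
  have h := Real.integral_rpow_mul_exp_neg_mul_Ioi ha hr
  have hpos : 0 < (1 / r) ^ a * Real.Gamma a :=
    mul_pos (Real.rpow_pos_of_pos (by positivity) _) (Real.Gamma_pos_of_pos ha)
  have hi : IntegrableOn (fun t : ℝ => t ^ (a - 1) * Real.exp (-(r * t))) (Set.Ioi 0) :=
    Integrable.of_integral_ne_zero (by rw [h]; exact hpos.ne')
  rw [← h, ofReal_integral_eq_lintegral_ofReal hi]
  refine (ae_restrict_iff' measurableSet_Ioi).2 (Eventually.of_forall fun t ht => ?_)
  exact mul_nonneg (Real.rpow_nonneg (le_of_lt ht) _) (Real.exp_nonneg _)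

/-- Polar coordinates in the plane, for radial functions. -/
lemma lintegral_norm_plane {f : ℝ → ℝ≥0∞} (hf : Measurable f) :
    ∫⁻ x : Plane, f ‖x‖ = ∫⁻ r in Set.Ioi (0 : ℝ), ENNReal.ofReal (2 * Real.pi * r) * f r := by
  set e := Complex.orthonormalBasisOneI.repr with he
  have h1 : ∫⁻ z : ℂ, f ‖e z‖ = ∫⁻ x : Plane, f ‖x‖ :=
    e.measurePreserving.lintegral_comp (hf.comp measurable_norm)
  rw [← h1]
  simp_rw [LinearIsometryEquiv.norm_map]
  rw [← Complex.lintegral_comp_polarCoord_symm (fun z => f ‖z‖)]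
  simp_rw [Complex.norm_polarCoord_symm, polarCoord_target, smul_eq_mul]
  rw [Measure.volume_eq_prod, ← Measure.prod_restrict, lintegral_prod _ (by fun_prop)]
  refine setLIntegral_congr_fun measurableSet_Ioi fun r hr => ?_
  have hr0 : (0 : ℝ) < r := hr
  dsimp only
  rw [setLIntegral_const, Real.volume_Ioo, abs_of_pos hr0, mul_right_comm,
    ← ENNReal.ofReal_mul hr0.le]
  congr 2
  ring

lemma setLIntegral_Ioo_two_pi_mul {R : ℝ} (hR : 0 ≤ R) :
    ∫⁻ r in Set.Ioi (0 : ℝ), ENNReal.ofReal (2 * Real.pi * r) * (Set.Iio R).indicator 1 r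
      = ENNReal.ofReal (Real.pi * R ^ 2) := by
  rw [← lintegral_norm_plane (measurable_one.indicator measurableSet_Iio)]
  have : ∀ x : Plane, (Set.Iio R).indicator (1 : ℝ → ℝ≥0∞) ‖x‖
      = (Metric.ball (0 : Plane) R).indicator 1 x := by
    intro x
    by_cases h : ‖x‖ < R
    · rw [Set.indicator_of_mem (show ‖x‖ ∈ Set.Iio R from h),
        Set.indicator_of_mem (by simpa using h)]; rfl
    · rw [Set.indicator_of_notMem (show ‖x‖ ∉ Set.Iio R from h),
        Set.indicator_of_notMem (by simpa using h)]
  simp_rw [this]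
  rw [lintegral_indicator_one measurableSet_ball, EuclideanSpace.volume_ball_fin_two,
    ← ENNReal.ofReal_pow hR, mul_comm, ← ENNReal.ofReal_mul Real.pi_pos.le]

/-- The substitution `u = c r²`, to be used with `c = π λ`. -/
lemma setLIntegral_comp_sq {c : ℝ} (hc : 0 < c) (f : ℝ → ℝ≥0∞) :
    ∫⁻ r in Set.Ioi (0 : ℝ), ENNReal.ofReal (2 * c * r) * f (c * r ^ 2)
      = ∫⁻ u in Set.Ioi (0 : ℝ), f u := by
  have himg : (fun r : ℝ => c * r ^ 2) '' Set.Ioi 0 = Set.Ioi 0 := by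
    ext u
    constructor
    · rintro ⟨r, hr, rfl⟩
      have hr0 : (0 : ℝ) < r := hr
      exact show 0 < c * r ^ 2 by positivity
    · intro hu
      have hu0 : (0 : ℝ) < u := hu
      refine ⟨Real.sqrt (u / c), Real.sqrt_pos.2 (by positivity), ?_⟩
      dsimp only
      rw [Real.sq_sqrt (by positivity)]
      field_simp
  have h := lintegral_image_eq_lintegral_abs_deriv_mul (s := Set.Ioi (0 : ℝ))
    (f := fun r : ℝ => c * r ^ 2) (f' := fun r => 2 * c * r) measurableSet_Ioi
    (fun r _ => (((hasDerivAt_pow 2 r).const_mul c).congr_deriv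
      (by push_cast; ring)).hasDerivWithinAt)
    (fun a ha b hb hab => by
      have ha0 : (0 : ℝ) < a := ha
      have hb0 : (0 : ℝ) < b := hb
      have := mul_left_cancel₀ hc.ne' hab
      exact (pow_left_inj₀ ha0.le hb0.le two_ne_zero).1 this) f
  rw [himg] at h
  rw [h]
  refine setLIntegral_congr_fun measurableSet_Ioi fun r hr => ?_
  have hr0 : (0 : ℝ) < r := hr
  rw [abs_of_pos (by positivity)]

/-- The radial integral in the Laplace transform of the interference: a primitive of
`2 v (1 - (1 + s v^{-α} / m)^{-m})` is `-v² (F (-s v^{-α} / m) - 1)`, by the differential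
equation of `F = ₂F₁(m, -2/α, 1 - 2/α, ·)`. -/
lemma setLIntegral_Ioi_one_sub_expNeg {α : ℝ} {m : ℕ} (hα : 2 < α) (hm : 1 ≤ m) {s r : ℝ}
    (hs : 0 < s) (hr : 0 < r) :
    ∫⁻ v in Set.Ioi r, ENNReal.ofReal (2 * Real.pi * v) *
        (1 - expNeg (markExponent (gammaMeasure m m) (ENNReal.ofReal (s * v ^ (-α)))))
      = ENNReal.ofReal (Real.pi * (r ^ 2 *
          (gaussHypergeometric m (-(2 / α)) (1 - 2 / α) (-(s * r ^ (-α) / m)) - 1))) ∧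
    0 ≤ r ^ 2 * (gaussHypergeometric m (-(2 / α)) (1 - 2 / α) (-(s * r ^ (-α) / m)) - 1) := by
  have hm0 : (0 : ℝ) < m := by exact_mod_cast hm
  set F := gaussHypergeometric m (-(2 / α)) (1 - 2 / α) with hF
  set q : ℝ → ℝ := fun v => s * v ^ (-α) / m with hq
  have hq0 : ∀ v ∈ Set.Ioi r, 0 ≤ q v := fun v hv => by
    have : 0 < v := hr.trans hv
    have := Real.rpow_nonneg this.le (-α)
    positivity
  set g' : ℝ → ℝ := fun v => 2 * v * (1 - ((1 + q v) ^ m)⁻¹) with hg'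
  have hnn : ∀ v ∈ Set.Ioi r, 0 ≤ g' v := by
    intro v hv
    have : 0 < v := hr.trans hv
    have h1 : ((1 + q v) ^ m)⁻¹ ≤ 1 := inv_le_one_of_one_le₀
      (one_le_pow₀ (by linarith [hq0 v hv]))
    have h2 : 0 ≤ 1 - ((1 + q v) ^ m)⁻¹ := by linarith
    positivity
  have hderiv : ∀ v, 0 < v → HasDerivAt (fun v => -(v ^ 2 * (F (-q v) - 1))) (g' v) v := by
    intro v hv0
    have hqv : 0 ≤ q v := by
      have := Real.rpow_nonneg hv0.le (-α)
      positivity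
    obtain ⟨hFd, hode⟩ := gaussHypergeometric_ode (two_div_pos hα) (two_div_lt_one hα) hm
      (x := -q v) (by linarith)
    rw [← hF] at hFd hode
    have hqd : HasDerivAt q (-(α * q v / v)) v := by
      have h := ((Real.hasDerivAt_rpow_const (p := -α) (Or.inl hv0.ne')).const_mul s).div_const
        (m : ℝ)
      refine h.congr_deriv ?_
      rw [hq, Real.rpow_sub_one hv0.ne']
      ring
    have h1 := (hFd.hasDerivAt.comp v hqd.neg).sub_const 1
    have h2 := ((hasDerivAt_pow 2 v).mul h1).neg
    refine h2.congr_deriv ?_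
    have hα0 : α ≠ 0 := by linarith
    simp only [hg', Function.comp_apply, Pi.neg_apply, Nat.cast_ofNat, Nat.add_one_sub_one,
      pow_one, neg_neg]
    have e : deriv F (-q v) * (q v) = -(2 / α * (F (-q v) - ((1 - -q v) ^ m)⁻¹)) := by
      rw [← hode]; ring
    rw [sub_neg_eq_add] at e
    have e2 : v ^ 2 * (deriv F (-q v) * (α * q v / v)) = α * v * (deriv F (-q v) * q v) := by
      field_simp
    rw [e2, e]
    field_simp
    ring
  have hlim : Tendsto (fun v => -(v ^ 2 * (F (-q v) - 1))) atTop (𝓝 0) := by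
    have hF0 : F 0 = 1 := gaussHypergeometric_zero (two_div_pos hα) (two_div_lt_one hα) hm
    have hd0 := (gaussHypergeometric_ode (two_div_pos hα) (two_div_lt_one hα) hm
      (x := 0) one_pos).1
    -- `F(-q) - 1 = O(q)`, and `v² q(v)` tends to `0` because `α > 2`.
    have hO := hd0.isBigO_sub
    have hqlim : Tendsto (fun v => -q v) atTop (𝓝 0) := by
      have h := (((tendsto_rpow_neg_atTop (show 0 < α by linarith)).const_mul s).div_const
        (m : ℝ)).neg
      simpa using h
    have hO2 := hO.comp_tendsto hqlim
    have hO3 := (Asymptotics.isBigO_refl (fun v : ℝ => v ^ 2) atTop).mul hO2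
    rw [← neg_zero]
    refine Tendsto.neg (f := fun v => v ^ 2 * (F (-q v) - 1)) ?_
    have hO4 : (fun v => v ^ 2 * (F (-q v) - 1)) =O[atTop] (fun v => v ^ 2 * (-q v - 0)) := by
      simpa [Function.comp_def, ← hF, hF0] using hO3
    refine hO4.trans_tendsto ?_
    · have h := ((tendsto_rpow_neg_atTop (show 0 < α - 2 by linarith)).const_mul (-(s / m)))
      rw [mul_zero] at h
      refine h.congr' ?_
      filter_upwards [eventually_gt_atTop 0] with v hv
      rw [hq, neg_sub, sub_eq_add_neg, Real.rpow_add hv]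
      have : v ^ (2 : ℝ) = v ^ 2 := by norm_cast
      rw [this]
      ring
  have hcont : ContinuousWithinAt (fun v => -(v ^ 2 * (F (-q v) - 1))) (Set.Ici r) r :=
    (hderiv r hr).continuousAt.continuousWithinAt
  have hderiv' : ∀ v ∈ Set.Ioi r, HasDerivAt (fun v => -(v ^ 2 * (F (-q v) - 1))) (g' v) v :=
    fun v hv => hderiv v (hr.trans hv)
  have hval := integral_Ioi_of_hasDerivAt_of_nonneg hcont hderiv' hnn hlim
  rw [zero_sub, neg_neg] at hval
  refine ⟨?_, ?_⟩
  · have hpt : ∀ v ∈ Set.Ioi r, ENNReal.ofReal (2 * Real.pi * v) *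
        (1 - expNeg (markExponent (gammaMeasure m m) (ENNReal.ofReal (s * v ^ (-α)))))
        = ENNReal.ofReal Real.pi * ENNReal.ofReal (g' v) := by
      intro v hv
      have hv0 : 0 < v := hr.trans hv
      have := hq0 v hv
      rw [expNeg_markExponent_gamma hm (mul_nonneg hs.le (Real.rpow_nonneg hv0.le _)),
        ← ENNReal.ofReal_one, ← ENNReal.ofReal_sub _ (by positivity),
        ← ENNReal.ofReal_mul (by positivity), ← ENNReal.ofReal_mul Real.pi_pos.le]
      congr 1
      rw [hg']
      ring
    rw [setLIntegral_congr_fun measurableSet_Ioi hpt,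
      lintegral_const_mul' _ _ ENNReal.ofReal_ne_top,
      ← ofReal_integral_eq_lintegral_ofReal
        (integrableOn_Ioi_deriv_of_nonneg hcont hderiv' hnn hlim)
        ((ae_restrict_iff' measurableSet_Ioi).2 (Eventually.of_forall hnn)),
      hval, ← ENNReal.ofReal_mul Real.pi_pos.le]
  · rw [← hval]
    exact setIntegral_nonneg measurableSet_Ioi hnn

/-- Integrating the coverage terms over `u` gives the closed form. -/
lemma setLIntegral_coverageTerm {α θ : ℝ} {m : ℕ} (hα : 2 < α) (hθ : 0 < θ) (hm : 1 ≤ m)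
    (hnn : ∀ u : ℝ, 0 < u → ∀ k, 0 ≤ coverageTerm α θ m u k) :
    ∫⁻ u in Set.Ioi (0 : ℝ), ENNReal.ofReal (∑ k ∈ Finset.range m, coverageTerm α θ m u k)
        = ENNReal.ofReal (closestClosedForm α θ m) ∧
      0 < closestClosedForm α θ m := by
  set η := eta α (m * θ) m 1 with hη
  have hη0 : 0 < η := eta_pos hα hθ hm
  have hpow : ∀ n : ℕ, ∫ u in Set.Ioi (0 : ℝ), u ^ n * Real.exp (-(η * u))
      = n.factorial / η ^ (n + 1) := by
    intro n
    have h := Real.integral_rpow_mul_exp_neg_mul_Ioi (a := n + 1) (by positivity) hη0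
    rw [Real.Gamma_nat_eq_factorial, add_sub_cancel_right] at h
    simp_rw [Real.rpow_natCast] at h
    rw [h]
    have : ((n : ℝ) + 1) = ((n + 1 : ℕ) : ℝ) := by push_cast; ring
    rw [this, Real.rpow_natCast, one_div, inv_pow]
    field_simp
  have hpowi : ∀ n : ℕ, IntegrableOn (fun u : ℝ => u ^ n * Real.exp (-(η * u))) (Set.Ioi 0) :=
    fun n => Integrable.of_integral_ne_zero (by rw [hpow]; positivity)
  have hcov : ∀ u k, coverageTerm α θ m u k = ∑ c : OrderedFinpartition k,
      (1 / (k.factorial : ℝ) * ∏ i, psi α θ m (c.partSize i)) *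
        (u ^ c.length * Real.exp (-(η * u))) := by
    intro u k
    rw [coverageTerm, Finset.mul_sum, Finset.mul_sum, ← hη, mul_comm u η]
    exact Finset.sum_congr rfl fun c _ => by ring
  have hci : ∀ k, IntegrableOn (fun u => coverageTerm α θ m u k) (Set.Ioi 0) := by
    intro k
    simp_rw [hcov]
    exact integrable_finsetSum _ fun c _ => (hpowi c.length).const_mul _
  have hcint : ∀ k, ∫ u in Set.Ioi (0 : ℝ), coverageTerm α θ m u k
      = ∑ c : OrderedFinpartition k, (1 / (k.factorial : ℝ) * ∏ i, psi α θ m (c.partSize i)) *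
        (c.length.factorial / η ^ (c.length + 1)) := by
    intro k
    simp_rw [hcov]
    rw [integral_finsetSum _ fun c _ => (hpowi c.length).const_mul _]
    simp_rw [integral_const_mul, hpow]
  have hc0 : ∫ u in Set.Ioi (0 : ℝ), coverageTerm α θ m u 0 = 1 / η := by
    rw [hcint, Fintype.sum_unique]
    have hl : (default : OrderedFinpartition 0).length = 0 := rfl
    have : IsEmpty (Fin (default : OrderedFinpartition 0).length) := by rw [hl]; infer_instance
    rw [Finset.prod_of_isEmpty, hl]
    simp
  -- Set partitions are grouped by their number of blocks.
  have hck : ∀ k ∈ Finset.Icc 1 (m - 1), ∫ u in Set.Ioi (0 : ℝ), coverageTerm α θ m u k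
      = 1 / η * ∑ j ∈ Finset.Icc 1 k, (j.factorial : ℝ) / (k.factorial : ℝ) *
        bellIncomplete k j (fun l => psi α θ m l / η) := by
    intro k hk
    have hk1 : 0 < k := (Finset.mem_Icc.1 hk).1
    rw [hcint, ← Finset.sum_fiberwise_of_maps_to (t := Finset.Icc 1 k)
      (g := fun c : OrderedFinpartition k => c.length)
      (fun c _ => Finset.mem_Icc.2 ⟨c.length_pos hk1, c.length_le⟩), Finset.mul_sum]
    refine Finset.sum_congr rfl fun j _ => ?_
    rw [bellIncomplete, Finset.mul_sum, Finset.mul_sum]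
    refine Finset.sum_congr rfl fun c hc => ?_
    obtain rfl : c.length = j := (Finset.mem_filter.1 hc).2
    rw [Finset.prod_div_distrib, Finset.prod_const, Finset.card_univ, Fintype.card_fin, pow_succ]
    field_simp
  have hrange : Finset.range m = insert 0 (Finset.Icc 1 (m - 1)) := by
    ext k
    simp only [Finset.mem_range, Finset.mem_insert, Finset.mem_Icc]
    omega
  have htot : ∫ u in Set.Ioi (0 : ℝ), ∑ k ∈ Finset.range m, coverageTerm α θ m u k
      = closestClosedForm α θ m := by
    rw [integral_finsetSum _ fun k _ => hci k, hrange, Finset.sum_insert (by simp), hc0,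
      Finset.sum_congr rfl hck, closestClosedForm, ← Finset.mul_sum, ← hη]
    ring
  refine ⟨?_, ?_⟩
  · rw [← htot, ofReal_integral_eq_lintegral_ofReal (integrable_finsetSum _ fun k _ => hci k)]
    exact (ae_restrict_iff' measurableSet_Ioi).2
      (Eventually.of_forall fun u hu => Finset.sum_nonneg fun k _ => hnn u hu k)
  · rw [← htot, integral_finsetSum _ fun k _ => hci k]
    refine Finset.sum_pos' (fun k _ => setIntegral_nonneg measurableSet_Ioi fun u hu => hnn u hu k)
      ⟨0, Finset.mem_range.2 hm, ?_⟩
    rw [hc0]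
    positivity

/-- The radial integral with an interference region reaching the origin, by Tonelli's theorem. -/
lemma setLIntegral_Ioi_zero_one_sub_expNeg {α a : ℝ} (hα : 2 < α) (ha : 0 ≤ a) :
    ∫⁻ v in Set.Ioi (0 : ℝ), ENNReal.ofReal (2 * Real.pi * v) *
        (1 - expNeg (ENNReal.ofReal (a * v ^ (-α))))
      = ENNReal.ofReal (Real.pi * Real.Gamma (1 - 2 / α) * a ^ (2 / α)) := by
  have hd0 := two_div_pos hα
  have hd1 := two_div_lt_one hα
  rcases ha.eq_or_lt with rfl | ha0
  · simp [Real.zero_rpow hd0.ne']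
  -- `1 - e^{-x} = ∫₀ˣ e^{-y} dy`, and `y < a v^{-α}` means `v < (a / y)^{1/α}`.
  have h1 : ∀ v ∈ Set.Ioi (0 : ℝ), ENNReal.ofReal (2 * Real.pi * v) *
        (1 - expNeg (ENNReal.ofReal (a * v ^ (-α))))
      = ∫⁻ y in Set.Ioi (0 : ℝ), ENNReal.ofReal (2 * Real.pi * v) *
        (ENNReal.ofReal (Real.exp (-y)) * (Set.Iio ((a / y) ^ (1 / α))).indicator 1 v) := by
    intro v hv
    have hv0 : (0 : ℝ) < v := hv
    have hx : 0 < a * v ^ (-α) := mul_pos ha0 (Real.rpow_pos_of_pos hv0 _)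
    rw [lintegral_const_mul' _ _ ENNReal.ofReal_ne_top]
    congr 1
    have h2 : ∀ y ∈ Set.Ioi (0 : ℝ), ENNReal.ofReal (Real.exp (-y)) *
        (Set.Iio ((a / y) ^ (1 / α))).indicator 1 v
        = (Set.Iio (a * v ^ (-α))).indicator (fun y => ENNReal.ofReal (Real.exp (-y))) y := by
      intro y hy
      have hy0 : (0 : ℝ) < y := hy
      have hiff : v < (a / y) ^ (1 / α) ↔ y < a * v ^ (-α) := by
        rw [one_div, Real.lt_rpow_inv_iff_of_pos hv0.le (by positivity) (by linarith),
          lt_div_iff₀ hy0, Real.rpow_neg hv0.le, ← div_eq_mul_inv,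
          lt_div_iff₀ (Real.rpow_pos_of_pos hv0 _), mul_comm]
      by_cases h : y < a * v ^ (-α)
      · rw [Set.indicator_of_mem (show v ∈ Set.Iio ((a / y) ^ (1 / α)) from hiff.2 h),
          Set.indicator_of_mem (show y ∈ Set.Iio (a * v ^ (-α)) from h), Pi.one_apply, mul_one]
      · rw [Set.indicator_of_notMem
          (show v ∉ Set.Iio ((a / y) ^ (1 / α)) from fun h' => h (hiff.1 h')),
          Set.indicator_of_notMem (show y ∉ Set.Iio (a * v ^ (-α)) from h), mul_zero]
    rw [setLIntegral_congr_fun measurableSet_Ioi h2, lintegral_indicator measurableSet_Iio,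
      Measure.restrict_restrict measurableSet_Iio, Set.inter_comm, Set.Ioi_inter_Iio,
      expNeg_ofReal hx.le, ← ENNReal.ofReal_one, ← ENNReal.ofReal_sub _ (Real.exp_nonneg _),
      Measure.restrict_congr_set Ioo_ae_eq_Ioc, ← ofReal_integral_eq_lintegral_ofReal
        ((Continuous.integrableOn_Icc (by fun_prop)).mono_set Set.Ioc_subset_Icc_self)
        (Eventually.of_forall fun y => Real.exp_nonneg _),
      ← intervalIntegral.integral_of_le hx.le]
    congr 1
    rw [intervalIntegral.integral_comp_neg (fun y => Real.exp y), integral_exp]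
    simp
  rw [setLIntegral_congr_fun measurableSet_Ioi h1, lintegral_lintegral_swap]
  · have h3 : ∀ y ∈ Set.Ioi (0 : ℝ), ∫⁻ v in Set.Ioi (0 : ℝ), ENNReal.ofReal (2 * Real.pi * v) *
        (ENNReal.ofReal (Real.exp (-y)) * (Set.Iio ((a / y) ^ (1 / α))).indicator 1 v)
        = ENNReal.ofReal (Real.pi * a ^ (2 / α)) *
          ENNReal.ofReal (y ^ (1 - 2 / α - 1) * Real.exp (-(1 * y))) := by
      intro y hy
      have hy0 : (0 : ℝ) < y := hy
      simp_rw [mul_left_comm _ (ENNReal.ofReal (Real.exp (-y)))]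
      rw [lintegral_const_mul' _ _ ENNReal.ofReal_ne_top,
        setLIntegral_Ioo_two_pi_mul (Real.rpow_nonneg (by positivity) _),
        ← ENNReal.ofReal_mul (Real.exp_nonneg _), ← ENNReal.ofReal_mul (by positivity)]
      congr 1
      rw [← Real.rpow_natCast, ← Real.rpow_mul (by positivity), Real.div_rpow ha0.le hy0.le]
      have e1 : 1 / α * ((2 : ℕ) : ℝ) = 2 / α := by push_cast; ring
      have e2 : 1 - 2 / α - 1 = -(2 / α) := by ring
      rw [e1, e2, Real.rpow_neg hy0.le, one_mul]
      ring
    rw [setLIntegral_congr_fun measurableSet_Ioi h3, lintegral_const_mul' _ _ ENNReal.ofReal_ne_top,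
      lintegral_rpow_mul_exp_neg_mul (by linarith) one_pos, ← ENNReal.ofReal_mul (by positivity)]
    congr 1
    rw [div_one, Real.one_rpow]
    ring
  · refine Measurable.aemeasurable ?_
    have e : ∀ p : ℝ × ℝ, (Set.Iio ((a / p.2) ^ (1 / α))).indicator (1 : ℝ → ℝ≥0∞) p.1
        = {p : ℝ × ℝ | p.1 < (a / p.2) ^ (1 / α)}.indicator 1 p := fun p => rfl
    simp only [Function.uncurry_def, e]
    have mS : MeasurableSet {p : ℝ × ℝ | p.1 < (a / p.2) ^ (1 / α)} :=
      measurableSet_lt measurable_fst (by fun_prop)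
    have mI := (measurable_one (α := ℝ≥0∞)).indicator mS
    fun_prop

/-! ### Independence of the gain of a base station from the rest of the network -/

lemma indepFun_prodMk_right {A B C : Type*} [MeasurableSpace A] [MeasurableSpace B]
    [MeasurableSpace C] {P : Measure Ω} [IsProbabilityMeasure P] {a : Ω → A} {b : Ω → B}
    {c : Ω → C} (ha : Measurable a) (hb : Measurable b) (hc : Measurable c)
    (hab : IndepFun a b P) (habc : IndepFun (fun ω => (a ω, b ω)) c P) :
    IndepFun a (fun ω => (b ω, c ω)) P := by
  have := Measure.isProbabilityMeasure_map ha.aemeasurable (μ := P)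
  have := Measure.isProbabilityMeasure_map hb.aemeasurable (μ := P)
  have := Measure.isProbabilityMeasure_map hc.aemeasurable (μ := P)
  have hbc : IndepFun b c P := habc.comp (φ := Prod.snd) (ψ := id) measurable_snd measurable_id
  rw [indepFun_iff_map_prod_eq_prod_map_map (by fun_prop) (by fun_prop)] at *
  rw [hbc, ← Measure.prodAssoc_prod, ← hab, ← habc,
    Measure.map_map MeasurableEquiv.prodAssoc.measurable (by fun_prop)]
  rfl

section Network

variable {lam α θ : ℝ} {m : ℕ} {X : ℕ → Ω → Plane} {g : ℕ → Ω → ℝ} {P : Measure Ω}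
  [IsProbabilityMeasure P]

lemma IsLOSNetwork.indepFun_gain_others (hnet : IsLOSNetwork lam m X g P) (i : ℕ) :
    IndepFun (g i) (fun ω => ((fun j : {j | j ≠ i} => g j ω), fun j => X j ω)) P := by
  have mX : Measurable fun ω i => X i ω := measurable_pi_lambda _ hnet.ppp.measurable
  have mg : Measurable fun ω => (fun j : {j | j ≠ i} => g j ω) :=
    measurable_pi_lambda _ fun j => hnet.gain_measurable j
  refine indepFun_prodMk_right (hnet.gain_measurable i) mg mX ?_ ?_
  · have h := indep_iSup_of_disjoint (fun j => (hnet.gain_measurable j).comap_le)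
      hnet.gain_indep.iIndep (S := {i}) (T := {j | j ≠ i}) (by simp)
    refine indep_of_indep_of_le_left (indep_of_indep_of_le_right h ?_) ?_
    · rw [MeasurableSpace.pi, MeasurableSpace.comap_iSup]
      refine iSup_le fun j => ?_
      rw [MeasurableSpace.comap_comp]
      exact le_iSup₂_of_le (j : ℕ) j.2 le_rfl
    · exact le_iSup₂_of_le i rfl le_rfl
  · exact hnet.gain_indep_points.comp
      (φ := fun x : ℕ → ℝ => (x i, fun j : {j | j ≠ i} => x j)) (ψ := id) (by fun_prop)
      measurable_id

/-- The Slivnyak-Mecke formula for the marked process: the sum over the base stations of the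
probability of an event that depends on the gain and the location of a base station, on the total
power of the others, and on the distance to the closest of the others. -/
theorem IsLOSNetwork.tsum_measure (hnet : IsLOSNetwork lam m X g P) (α : ℝ)
    {E : Set (ℝ × Plane × ℝ≥0∞ × ℝ≥0∞)} (hE : MeasurableSet E) :
    ∑' i, P {ω | (g i ω, X i ω, totalPower α X g {j | j ≠ i} ω, nearest X {j | j ≠ i} ω) ∈ E}
      = ENNReal.ofReal lam * ∫⁻ x : Plane, ((gammaMeasure m m).prod P)
          {p | (p.1, x, totalPower α X g Set.univ p.2, nearest X Set.univ p.2) ∈ E} := by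
  have := hnet.isProbabilityMeasure_gain
  have mJ := hnet.measurable_totalPower α
  have mR := hnet.ppp.measurable_nearest
  have mX := hnet.ppp.measurable
  have mT : ∀ i, Measurable fun ω =>
      (X i ω, (totalPower α X g {j | j ≠ i} ω, nearest X {j | j ≠ i} ω)) := fun i =>
    (mX i).prodMk ((mJ _).prodMk (mR _))
  have mU : Measurable fun ω => (totalPower α X g Set.univ ω, nearest X Set.univ ω) :=
    (mJ _).prodMk (mR _)
  have := Measure.isProbabilityMeasure_map mU.aemeasurable (μ := P)
  have hind : ∀ i, IndepFun (g i) (fun ω =>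
      (X i ω, (totalPower α X g {j | j ≠ i} ω, nearest X {j | j ≠ i} ω))) P := by
    intro i
    have m1 : ∀ j : {j | j ≠ i}, Measurable fun q : ({j | j ≠ i} → ℝ) × (ℕ → Plane) => q.1 j :=
      fun j => (measurable_pi_apply j).comp measurable_fst
    have m2 : ∀ j : ℕ, Measurable fun q : ({j | j ≠ i} → ℝ) × (ℕ → Plane) => q.2 j :=
      fun j => (measurable_pi_apply j).comp measurable_snd
    have mφ : Measurable fun q : ({j | j ≠ i} → ℝ) × (ℕ → Plane) =>
        (q.2 i, (∑' j : {j | j ≠ i}, ENNReal.ofReal (q.1 j * ‖q.2 j‖ ^ (-α)),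
          ⨅ j : {j | j ≠ i}, ‖q.2 j‖ₑ)) :=
      (m2 i).prodMk ((Measurable.tsum fun j => ENNReal.measurable_ofReal.comp
        ((m1 j).mul ((m2 j).norm.pow_const _))).prodMk (Measurable.iInf fun j => (m2 j).enorm))
    exact (hnet.indepFun_gain_others i).comp measurable_id mφ
  have hone : ∀ i, P {ω | (g i ω, X i ω, totalPower α X g {j | j ≠ i} ω,
      nearest X {j | j ≠ i} ω) ∈ E} = ∫⁻ t, gammaMeasure m m ((fun h => (h, t)) ⁻¹' E)
        ∂(P.map fun ω => (X i ω, (totalPower α X g {j | j ≠ i} ω, nearest X {j | j ≠ i} ω))) := by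
    intro i
    have := Measure.isProbabilityMeasure_map (mT i).aemeasurable (μ := P)
    rw [← Measure.prod_apply_symm hE, ← hnet.gain_law i,
      ← (indepFun_iff_map_prod_eq_prod_map_map (hnet.gain_measurable i).aemeasurable
        (mT i).aemeasurable).1 (hind i),
      Measure.map_apply ((hnet.gain_measurable i).prodMk (mT i)) hE]
    rfl
  have mk : Measurable fun t => gammaMeasure m m ((fun h => (h, t)) ⁻¹' E) :=
    measurable_measure_prodMk_right hE
  rw [tsum_congr hone, ← lintegral_sum_measure, hnet.sum_map_eq_prod α,
    lintegral_prod _ mk.aemeasurable, lintegral_smul_measure, smul_eq_mul]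
  congr 1
  refine lintegral_congr fun x => ?_
  have mE' : MeasurableSet {p : ℝ × Ω |
      (p.1, x, totalPower α X g Set.univ p.2, nearest X Set.univ p.2) ∈ E} :=
    (measurable_fst.prodMk (measurable_const.prodMk (mU.comp measurable_snd))) hE
  rw [Measure.prod_apply_symm mE',
    lintegral_map (f := fun y => gammaMeasure m m ((fun h => (h, x, y)) ⁻¹' E))
    (mk.comp measurable_prodMk_left) mU]
  rfl

/-! ### Laplace transforms of the interference -/

/-- The Laplace transform of a weighted sum of the gains. -/
lemma IsLOSNetwork.laplace_gains (hnet : IsLOSNetwork lam m X g P) {w : Plane → ℝ≥0∞}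
    (hw : Measurable w) :
    ∫⁻ ω, expNeg (∑' j, w (X j ω) * ENNReal.ofReal (g j ω)) ∂P
      = expNeg (ENNReal.ofReal lam *
          ∫⁻ x, (1 - expNeg (markExponent (gammaMeasure m m) (w x)))) := by
  have := hnet.isProbabilityMeasure_gain
  have h := hnet.lintegral_marks Set.univ hw (G := fun _ => 1) measurable_const
  simp only [one_mul] at h
  rw [← hnet.ppp.laplace (f := fun x => markExponent (gammaMeasure m m) (w x))
    ((measurable_markExponent (gammaMeasure m m)).comp hw)]
  refine Eq.trans (lintegral_congr fun ω => ?_) (h.trans (lintegral_congr fun ω => ?_))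
  · rw [tsum_univ fun j => w (X j ω) * ENNReal.ofReal (g j ω)]
  · rw [tsum_univ fun j => markExponent (gammaMeasure m m) (w (X j ω))]

lemma interferenceBeyond_eq {Ω : Type*} (α ρ : ℝ) (X : ℕ → Ω → Plane) (g : ℕ → Ω → ℝ) (ω : Ω) :
    interferenceBeyond α X g ρ ω
      = ∑' j, {x : Plane | ρ < ‖x‖}.indicator (pathloss α) (X j ω) * ENNReal.ofReal (g j ω) := by
  refine (tsum_subtype {j : ℕ | ρ < ‖X j ω‖} fun j => rxPower α X g j ω).trans ?_
  refine tsum_congr fun j => ?_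
  by_cases h : ρ < ‖X j ω‖
  · rw [Set.indicator_of_mem (show j ∈ {j : ℕ | ρ < ‖X j ω‖} from h),
      Set.indicator_of_mem (show X j ω ∈ {x : Plane | ρ < ‖x‖} from h), rxPower_eq]
  · rw [Set.indicator_of_notMem (show j ∉ {j : ℕ | ρ < ‖X j ω‖} from h),
      Set.indicator_of_notMem (show X j ω ∉ {x : Plane | ρ < ‖x‖} from h), zero_mul]

lemma interferenceBeyond_zero {Ω : Type*} (hα : 2 < α) (X : ℕ → Ω → Plane) (g : ℕ → Ω → ℝ)
    (ω : Ω) : interferenceBeyond α X g 0 ω = totalPower α X g Set.univ ω := by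
  rw [interferenceBeyond_eq, totalPower, tsum_univ fun j => rxPower α X g j ω]
  refine tsum_congr fun j => ?_
  rw [rxPower_eq]
  by_cases h : 0 < ‖X j ω‖
  · rw [Set.indicator_of_mem (show X j ω ∈ {x : Plane | 0 < ‖x‖} from h)]
  -- A base station at the origin contributes nothing because of `0 ^ (-α) = 0`.
  · have h0 : ‖X j ω‖ = 0 := le_antisymm (not_lt.1 h) (norm_nonneg _)
    rw [Set.indicator_of_notMem (show X j ω ∉ {x : Plane | 0 < ‖x‖} from h), pathloss, h0,
      Real.zero_rpow (by linarith), ENNReal.ofReal_zero]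

/-- The radial profile of `1 - E[e^{-s h ‖x‖^{-α}}]` outside the disc of radius `r`. -/
noncomputable def outerProfile (α : ℝ) (m : ℕ) (s r : ℝ) : ℝ → ℝ≥0∞ :=
  (Set.Ioi r).indicator fun v =>
    1 - expNeg (markExponent (gammaMeasure m m) (ENNReal.ofReal (s * v ^ (-α))))

lemma measurable_outerProfile (hm : 1 ≤ m) (s r : ℝ) : Measurable (outerProfile α m s r) := by
  have hm0 : (0 : ℝ) < m := by exact_mod_cast hm
  have := isProbabilityMeasure_gammaMeasure hm0 hm0
  have h := measurable_markExponent (gammaMeasure m m)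
  exact Measurable.indicator (by fun_prop) measurableSet_Ioi

lemma setLIntegral_outerProfile (hα : 2 < α) (hm : 1 ≤ m) {s r : ℝ} (hs : 0 < s) (hr : 0 < r) :
    ∫⁻ v in Set.Ioi (0 : ℝ), ENNReal.ofReal (2 * Real.pi * v) * outerProfile α m s r v
      = ENNReal.ofReal (Real.pi * (r ^ 2 *
          (gaussHypergeometric m (-(2 / α)) (1 - 2 / α) (-(s * r ^ (-α) / m)) - 1))) := by
  rw [← (setLIntegral_Ioi_one_sub_expNeg hα hm hs hr).1]
  have e : ∀ v, ENNReal.ofReal (2 * Real.pi * v) * outerProfile α m s r v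
      = (Set.Ioi r).indicator (fun v => ENNReal.ofReal (2 * Real.pi * v) *
        (1 - expNeg (markExponent (gammaMeasure m m) (ENNReal.ofReal (s * v ^ (-α)))))) v :=
    fun v => (Set.indicator_mul_right (Set.Ioi r) (fun v => ENNReal.ofReal (2 * Real.pi * v))
      fun v => 1 - expNeg (markExponent (gammaMeasure m m) (ENNReal.ofReal (s * v ^ (-α))))).symm
  simp_rw [e]
  rw [lintegral_indicator measurableSet_Ioi, Measure.restrict_restrict measurableSet_Ioi,
    Set.inter_eq_left.2 (Set.Ioi_subset_Ioi hr.le)]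

/-- The Laplace transform of the interference from beyond the distance `r`. -/
lemma IsLOSNetwork.laplace_interferenceBeyond (hnet : IsLOSNetwork lam m X g P) (hlam : 0 < lam)
    (hα : 2 < α) (hm : 1 ≤ m) {s r : ℝ} (hs : 0 < s) (hr : 0 < r) :
    ∫⁻ ω, expNeg (ENNReal.ofReal s * interferenceBeyond α X g r ω) ∂P
      = ENNReal.ofReal (Real.exp (-(Real.pi * lam * r ^ 2 *
          (gaussHypergeometric m (-(2 / α)) (1 - 2 / α) (-(s * r ^ (-α) / m)) - 1)))) := by
  have := hnet.isProbabilityMeasure_gain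
  have mS : MeasurableSet {x : Plane | r < ‖x‖} := measurableSet_lt measurable_const measurable_norm
  have hw : Measurable fun x => ENNReal.ofReal s * {x : Plane | r < ‖x‖}.indicator (pathloss α) x :=
    ((measurable_pathloss α).indicator mS).const_mul _
  have h := hnet.laplace_gains hw
  simp_rw [mul_assoc, ENNReal.tsum_mul_left, ← interferenceBeyond_eq] at h
  rw [h]
  have hx : ∀ x : Plane, 1 - expNeg (markExponent (gammaMeasure m m)
      (ENNReal.ofReal s * {x : Plane | r < ‖x‖}.indicator (pathloss α) x))
      = outerProfile α m s r ‖x‖ := by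
    intro x
    rw [outerProfile]
    by_cases hxr : r < ‖x‖
    · rw [Set.indicator_of_mem (show x ∈ {x : Plane | r < ‖x‖} from hxr),
        Set.indicator_of_mem (show ‖x‖ ∈ Set.Ioi r from hxr), pathloss, ENNReal.ofReal_mul hs.le]
    · rw [Set.indicator_of_notMem (show x ∉ {x : Plane | r < ‖x‖} from hxr),
        Set.indicator_of_notMem (show ‖x‖ ∉ Set.Ioi r from hxr), expNeg_markExponent]
      simp
  simp_rw [hx]
  have h0 := (setLIntegral_Ioi_one_sub_expNeg hα hm hs hr).2
  rw [lintegral_norm_plane (measurable_outerProfile hm s r), setLIntegral_outerProfile hα hm hs hr,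
    ← ENNReal.ofReal_mul hlam.le, expNeg_ofReal (by positivity)]
  congr 3
  ring

/-- The Laplace transform of the total power on the event that no base station is closer
than `r`. -/
lemma IsLOSNetwork.laplace_totalPower_nearest (hnet : IsLOSNetwork lam m X g P) (hlam : 0 < lam)
    (hα : 2 < α) (hm : 1 ≤ m) {s r : ℝ} (hs : 0 < s) (hr : 0 < r) :
    ∫⁻ ω in {ω | ENNReal.ofReal r ≤ nearest X Set.univ ω},
        expNeg (ENNReal.ofReal s * totalPower α X g Set.univ ω) ∂P
      = ENNReal.ofReal (Real.exp (-(Real.pi * lam * r ^ 2 *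
          gaussHypergeometric m (-(2 / α)) (1 - 2 / α) (-(s * r ^ (-α) / m))))) := by
  have := hnet.isProbabilityMeasure_gain
  have mρ : MeasurableSet {ω | ENNReal.ofReal r ≤ nearest X Set.univ ω} :=
    measurableSet_le measurable_const (hnet.ppp.measurable_nearest _)
  set f : Plane → ℝ≥0∞ := fun x => {x : Plane | ‖x‖ₑ < ENNReal.ofReal r}.indicator (fun _ => ∞) x +
    markExponent (gammaMeasure m m) (ENNReal.ofReal s * pathloss α x) with hf
  have mf : Measurable f := by
    refine (measurable_const.indicator
      (measurableSet_lt measurable_enorm measurable_const)).add ?_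
    exact (measurable_markExponent _).comp ((measurable_pathloss α).const_mul _)
  have h := hnet.lintegral_power_nearest α Set.univ (ENNReal.ofReal s) (ENNReal.ofReal r)
    (G := fun _ => 1) measurable_const
  simp only [one_mul] at h
  have e : ∀ ω, ∑' j : (Set.univ : Set ℕ), f (X j ω) = ∑' j, f (X j ω) := fun ω =>
    tsum_univ fun j => f (X j ω)
  have h1 : ∫⁻ ω in {ω | ENNReal.ofReal r ≤ nearest X Set.univ ω},
        expNeg (ENNReal.ofReal s * totalPower α X g Set.univ ω) ∂P
      = ∫⁻ ω, expNeg (∑' j, f (X j ω)) ∂P := by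
    rw [← lintegral_congr fun ω => congrArg expNeg (e ω), ← lintegral_indicator mρ]
    refine Eq.trans (lintegral_congr fun ω => ?_) h
    by_cases hω : ω ∈ {ω | ENNReal.ofReal r ≤ nearest X Set.univ ω}
    · simp [Set.indicator_of_mem hω]
    · simp [Set.indicator_of_notMem hω]
  rw [h1, hnet.ppp.laplace mf]
  have hx : ∀ᵐ x : Plane, 1 - expNeg (f x)
      = (fun v => (Set.Iio r).indicator 1 v + outerProfile α m s r v) ‖x‖ := by
    -- On the circle of radius `r` the two profiles differ, but it has area `0`.
    have h0 : ∀ᵐ x : Plane, x ∉ Metric.sphere (0 : Plane) r :=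
      measure_eq_zero_iff_ae_notMem.1 (Measure.addHaar_sphere _ _ _)
    filter_upwards [h0] with x hxs
    have hxs' : ‖x‖ ≠ r := by simpa using hxs
    have hiff : ‖x‖ₑ < ENNReal.ofReal r ↔ ‖x‖ < r := by
      rw [← ofReal_norm, ENNReal.ofReal_lt_ofReal_iff hr]
    rw [hf, outerProfile]
    rcases lt_or_gt_of_ne hxs' with hlt | hgt
    · dsimp only
      rw [Set.indicator_of_mem (show x ∈ {x : Plane | ‖x‖ₑ < ENNReal.ofReal r} from hiff.2 hlt),
        Set.indicator_of_mem (show ‖x‖ ∈ Set.Iio r from hlt),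
        Set.indicator_of_notMem (show ‖x‖ ∉ Set.Ioi r from not_lt.2 hlt.le)]
      simp
    · dsimp only
      rw [Set.indicator_of_notMem (show x ∉ {x : Plane | ‖x‖ₑ < ENNReal.ofReal r} from
          fun h => absurd (hiff.1 h) (not_lt.2 hgt.le)),
        Set.indicator_of_notMem (show ‖x‖ ∉ Set.Iio r from not_lt.2 hgt.le),
        Set.indicator_of_mem (show ‖x‖ ∈ Set.Ioi r from hgt), zero_add, zero_add, pathloss,
        ENNReal.ofReal_mul hs.le]
  have m1 : Measurable ((Set.Iio r).indicator (1 : ℝ → ℝ≥0∞)) :=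
    measurable_one.indicator measurableSet_Iio
  have h0 := (setLIntegral_Ioi_one_sub_expNeg hα hm hs hr).2
  have mo := measurable_outerProfile (α := α) hm s r
  have m2 : Measurable fun v => (Set.Iio r).indicator (1 : ℝ → ℝ≥0∞) v + outerProfile α m s r v :=
    m1.add mo
  rw [lintegral_congr_ae hx, lintegral_norm_plane m2]
  simp_rw [mul_add]
  rw [lintegral_add_left (by fun_prop), setLIntegral_Ioo_two_pi_mul hr.le,
    setLIntegral_outerProfile hα hm hs hr, ← ENNReal.ofReal_add (by positivity) (by positivity),
    ← ENNReal.ofReal_mul hlam.le, expNeg_ofReal (by positivity)]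
  congr 3
  ring

/-! ### Closest base station association -/

/-- The coverage event in the form `Z < h` required by the tail of the gain. The conventions for
`0 / 0` and for infinite interference agree on both sides. -/
lemma lt_div_iff_mul_lt_gain (hθ : 0 < θ) {r : ℝ} (hr : 0 < r) (h : ℝ) (I : ℝ≥0∞) :
    ENNReal.ofReal θ < ENNReal.ofReal (h * r ^ (-α)) / I
      ↔ ENNReal.ofReal (θ * r ^ α) * I < ENNReal.ofReal h := by
  have hr1 : 0 < r ^ α := Real.rpow_pos_of_pos hr _
  rw [ENNReal.lt_div_iff_mul_lt (Or.inr ENNReal.ofReal_ne_top)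
    (Or.inr (ENNReal.ofReal_pos.2 hθ).ne'), Real.rpow_neg hr.le, ← div_eq_mul_inv,
    ENNReal.ofReal_div_of_pos hr1, ENNReal.lt_div_iff_mul_lt
    (Or.inl (ENNReal.ofReal_pos.2 hr1).ne') (Or.inl ENNReal.ofReal_ne_top),
    ENNReal.ofReal_mul hθ.le, mul_right_comm]

/-- The coverage probability of a user at distance `r` from the serving base station, with the
interference from beyond the distance `r`, weighted with the probability that the disc of radius
`r` is empty. -/
lemma IsLOSNetwork.coverage_beyond (hnet : IsLOSNetwork lam m X g P) (hlam : 0 < lam)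
    (hα : 2 < α) (hθ : 0 < θ) (hm : 1 ≤ m) {r : ℝ} (hr : 0 < r) :
    ENNReal.ofReal (Real.exp (-(Real.pi * lam * r ^ 2))) * ((gammaMeasure m m).prod P)
        {p : ℝ × Ω | ENNReal.ofReal θ < ENNReal.ofReal (p.1 * r ^ (-α)) /
          interferenceBeyond α X g r p.2}
      = ENNReal.ofReal (∑ k ∈ Finset.range m, coverageTerm α θ m (Real.pi * lam * r ^ 2) k) ∧
    ∀ k, 0 ≤ coverageTerm α θ m (Real.pi * lam * r ^ 2) k := by
  have := hnet.isProbabilityMeasure_gain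
  have mI : Measurable (interferenceBeyond α X g r) := by
    have : interferenceBeyond α X g r = fun ω => ∑' j, {x : Plane | r < ‖x‖}.indicator
        (pathloss α) (X j ω) * ENNReal.ofReal (g j ω) := by
      funext ω; exact interferenceBeyond_eq ..
    rw [this]
    exact Measurable.tsum fun j => (((measurable_pathloss α).indicator
      (measurableSet_lt measurable_const measurable_norm)).comp (hnet.ppp.measurable j)).mul
      (ENNReal.measurable_ofReal.comp (hnet.gain_measurable j))
  have hr1 : 0 < r ^ α := Real.rpow_pos_of_pos hr _
  have hfin : IsFiniteMeasure (ENNReal.ofReal (Real.exp (-(Real.pi * lam * r ^ 2))) • P) :=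
    Measure.smul_finite _ ENNReal.ofReal_ne_top
  have h := measure_lt_gamma hα hθ hm (u := Real.pi * lam * r ^ 2)
    (ENNReal.ofReal (Real.exp (-(Real.pi * lam * r ^ 2))) • P)
    (Z := fun ω => ENNReal.ofReal (θ * r ^ α) * interferenceBeyond α X g r ω)
    (mI.const_mul _) fun s hs => by
      simp_rw [← mul_assoc, ← ENNReal.ofReal_mul hs.le]
      rw [lintegral_smul_measure, hnet.laplace_interferenceBeyond hlam hα hm (by positivity) hr,
        smul_eq_mul, ← ENNReal.ofReal_mul (Real.exp_nonneg _), ← Real.exp_add, Real.rpow_neg hr.le]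
      have e : s * (θ * r ^ α) * (r ^ α)⁻¹ / m = s * θ / m := by field_simp
      rw [e]
      congr 2
      ring
  refine ⟨?_, h.2⟩
  rw [← h.1, Measure.prod_smul_right, Measure.smul_apply, smul_eq_mul]
  simp_rw [lt_div_iff_mul_lt_gain hθ hr]

/-- The coverage probability of a user at distance `r` from the serving base station, all base
stations interfering, on the event that none is closer than `r`. -/
lemma IsLOSNetwork.coverage_nearest (hnet : IsLOSNetwork lam m X g P) (hlam : 0 < lam)
    (hα : 2 < α) (hθ : 0 < θ) (hm : 1 ≤ m) {x : Plane} (hx : x ≠ 0) :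
    ((gammaMeasure m m).prod P) {p : ℝ × Ω | ‖x‖ₑ ≤ nearest X Set.univ p.2 ∧
        ENNReal.ofReal θ * totalPower α X g Set.univ p.2 < pathloss α x * ENNReal.ofReal p.1}
      = ENNReal.ofReal (∑ k ∈ Finset.range m, coverageTerm α θ m (Real.pi * lam * ‖x‖ ^ 2) k) := by
  have := hnet.isProbabilityMeasure_gain
  have hr : 0 < ‖x‖ := norm_pos_iff.2 hx
  set r := ‖x‖ with hrx
  have mI := hnet.measurable_totalPower α Set.univ
  have mρ : MeasurableSet {ω | ENNReal.ofReal r ≤ nearest X Set.univ ω} :=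
    measurableSet_le measurable_const (hnet.ppp.measurable_nearest _)
  have hr1 : 0 < r ^ α := Real.rpow_pos_of_pos hr _
  have h := measure_lt_gamma hα hθ hm (u := Real.pi * lam * r ^ 2)
    (P.restrict {ω | ENNReal.ofReal r ≤ nearest X Set.univ ω})
    (Z := fun ω => ENNReal.ofReal (θ * r ^ α) * totalPower α X g Set.univ ω)
    (mI.const_mul _) fun s hs => by
      simp_rw [← mul_assoc, ← ENNReal.ofReal_mul hs.le]
      rw [hnet.laplace_totalPower_nearest hlam hα hm (by positivity) hr, Real.rpow_neg hr.le]
      have e : s * (θ * r ^ α) * (r ^ α)⁻¹ / m = s * θ / m := by field_simp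
      rw [e, neg_mul]
  have mE : MeasurableSet {p : ℝ × Ω | ENNReal.ofReal (θ * r ^ α) *
      totalPower α X g Set.univ p.2 < ENNReal.ofReal p.1} :=
    measurableSet_lt (by fun_prop) (by fun_prop)
  have hres : (gammaMeasure m m).prod (P.restrict {ω | ENNReal.ofReal r ≤ nearest X Set.univ ω})
      = ((gammaMeasure m m).prod P).restrict
        (Set.univ ×ˢ {ω | ENNReal.ofReal r ≤ nearest X Set.univ ω}) := by
    rw [← Measure.prod_restrict, Measure.restrict_univ]
  rw [← h.1, hres, Measure.restrict_apply mE]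
  congr 1
  ext p
  simp only [Set.mem_ofPred_eq, Set.mem_inter_iff, Set.mem_prod, Set.mem_univ, true_and]
  rw [← lt_div_iff_mul_lt_gain hθ hr, ← ofReal_norm, ENNReal.lt_div_iff_mul_lt
    (Or.inr ENNReal.ofReal_ne_top) (Or.inr (ENNReal.ofReal_pos.2 hθ).ne'), pathloss, mul_comm p.1,
    ENNReal.ofReal_mul (Real.rpow_nonneg hr.le _), and_comm]

lemma measurable_sum_coverageTerm (α θ : ℝ) (m : ℕ) :
    Measurable fun u => ENNReal.ofReal (∑ k ∈ Finset.range m, coverageTerm α θ m u k) := by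
  unfold coverageTerm
  fun_prop

/-- At `u = π λ r²` the coverage terms are nonnegative because they are expectations. -/
lemma IsLOSNetwork.coverageTerm_nonneg (hnet : IsLOSNetwork lam m X g P) (hlam : 0 < lam)
    (hα : 2 < α) (hθ : 0 < θ) (hm : 1 ≤ m) (u : ℝ) (hu : 0 < u) (k : ℕ) :
    0 ≤ coverageTerm α θ m u k := by
  have hc : 0 < Real.pi * lam := by positivity
  have h := (hnet.coverage_beyond hlam hα hθ hm (r := Real.sqrt (u / (Real.pi * lam)))
    (Real.sqrt_pos.2 (by positivity))).2 k
  rwa [Real.sq_sqrt (by positivity), mul_div_cancel₀ _ hc.ne'] at h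

lemma IsLOSNetwork.unifiedCoverage_closest (hnet : IsLOSNetwork lam m X g P) (hlam : 0 < lam)
    (hα : 2 < α) (hθ : 0 < θ) (hm : 1 ≤ m) :
    unifiedCoverage .closest lam α θ m X g P = ENNReal.ofReal (closestClosedForm α θ m) := by
  have hc : 0 < Real.pi * lam := by positivity
  rw [← (setLIntegral_coverageTerm hα hθ hm (hnet.coverageTerm_nonneg hlam hα hθ hm)).1,
    ← setLIntegral_comp_sq hc, unifiedCoverage]
  refine setLIntegral_congr_fun measurableSet_Ioi fun r hr => ?_
  have hr0 : (0 : ℝ) < r := hr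
  dsimp only [exclusionRadius, servingDensity]
  rw [← (hnet.coverage_beyond hlam hα hθ hm hr0).1, ← mul_assoc,
    ← ENNReal.ofReal_mul (by positivity), mul_comm]
  congr 2
  ring

/-- The coverage event is the union over `i` of the events that base station `i` is the closest one
and covers the user; these are almost surely disjoint, and Slivnyak's theorem gives the sum of their
probabilities. -/
lemma IsLOSNetwork.coverageProb_closest (hnet : IsLOSNetwork lam m X g P) (hlam : 0 < lam)
    (hα : 2 < α) (hθ : 0 < θ) (hm : 1 ≤ m) :
    coverageProb .closest α θ X g P = ENNReal.ofReal (closestClosedForm α θ m) := by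
  have hc : 0 < Real.pi * lam := by positivity
  have := hnet.isProbabilityMeasure_gain
  have mJ := hnet.measurable_totalPower α
  have mR := hnet.ppp.measurable_nearest
  have mX := hnet.ppp.measurable
  have mpl := measurable_pathloss α
  set E : Set (ℝ × Plane × ℝ≥0∞ × ℝ≥0∞) := {p | ‖p.2.1‖ₑ ≤ p.2.2.2 ∧
    ENNReal.ofReal θ * p.2.2.1 < pathloss α p.2.1 * ENNReal.ofReal p.1} with hE
  have mE : MeasurableSet E := by
    have m1 : MeasurableSet {p : ℝ × Plane × ℝ≥0∞ × ℝ≥0∞ | ‖p.2.1‖ₑ ≤ p.2.2.2} :=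
      measurableSet_le (by fun_prop) (by fun_prop)
    have m2 : MeasurableSet {p : ℝ × Plane × ℝ≥0∞ × ℝ≥0∞ |
        ENNReal.ofReal θ * p.2.2.1 < pathloss α p.2.1 * ENNReal.ofReal p.1} :=
      measurableSet_lt (by fun_prop) (by fun_prop)
    exact m1.inter m2
  set U : ℕ → Set Ω := fun i =>
    {ω | (g i ω, X i ω, totalPower α X g {j | j ≠ i} ω, nearest X {j | j ≠ i} ω) ∈ E} with hU
  have mU : ∀ i, MeasurableSet (U i) := fun i =>
    ((hnet.gain_measurable i).prodMk ((mX i).prodMk ((mJ _).prodMk (mR _)))) mE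
  -- Two closest base stations would be equally far from the origin.
  have htie : ∀ i, P {ω | ‖X i ω‖ₑ = nearest X {j | j ≠ i} ω} = 0 := by
    have mT : MeasurableSet {p : ℝ × Plane × ℝ≥0∞ × ℝ≥0∞ | ‖p.2.1‖ₑ = p.2.2.2} :=
      measurableSet_eq_fun (by fun_prop) (by fun_prop)
    have h := hnet.tsum_measure α mT
    have mT' : MeasurableSet {q : Plane × ℝ × Ω | ‖q.1‖ₑ = nearest X Set.univ q.2.2} :=
      measurableSet_eq_fun (by fun_prop) ((mR _).comp (measurable_snd.comp measurable_snd))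
    have h2 : ∫⁻ x : Plane,
        ((gammaMeasure m m).prod P) {p | ‖x‖ₑ = nearest X Set.univ p.2} = 0 := by
      have h3 := Measure.prod_apply (μ := (volume : Measure Plane))
        (ν := (gammaMeasure m m).prod P) mT'
      rw [Measure.prod_apply_symm mT'] at h3
      refine h3.symm.trans (lintegral_eq_zero_of_ae_eq_zero (Eventually.of_forall fun p => ?_))
      refine measure_mono_null (fun x hx => ?_)
        (Measure.addHaar_sphere (volume : Measure Plane) 0 (nearest X Set.univ p.2).toReal)
      have hx' : ‖x‖ₑ = nearest X Set.univ p.2 := hx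
      rw [mem_sphere_zero_iff_norm, ← hx', toReal_enorm]
    intro i
    refine ENNReal.tsum_eq_zero.1 (h.trans ?_) i
    exact mul_eq_zero_of_right _ h2
  have hserv : ∀ i ω, IsServing α X g ω .closest i ↔ ‖X i ω‖ₑ ≤ nearest X {j | j ≠ i} ω := by
    intro i ω
    rw [nearest, le_iInf_iff]
    constructor
    · intro h j
      exact enorm_le_iff_norm_le.2 (h j)
    · intro h j
      by_cases hj : j = i
      · rw [hj]
      · exact enorm_le_iff_norm_le.1 (h ⟨j, hj⟩)
  have hsir : ∀ i ω, ENNReal.ofReal θ < sir α X g i ω ↔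
      ENNReal.ofReal θ * totalPower α X g {j | j ≠ i} ω
        < pathloss α (X i ω) * ENNReal.ofReal (g i ω) := by
    intro i ω
    rw [sir, ENNReal.lt_div_iff_mul_lt (Or.inr ENNReal.ofReal_ne_top)
      (Or.inr (ENNReal.ofReal_pos.2 hθ).ne'), rxPower_eq]
    rfl
  have hev : {ω | ∃ i, IsServing α X g ω .closest i ∧ ENNReal.ofReal θ < sir α X g i ω}
      = ⋃ i, U i := by
    ext ω
    rw [Set.mem_iUnion]
    exact exists_congr fun i => and_congr (hserv i ω) (hsir i ω)
  have hdisj : Pairwise (Function.onFun (AEDisjoint P) U) := by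
    intro i j hij
    refine measure_mono_null (fun ω hω => ?_) (htie i)
    have h1 : ‖X i ω‖ₑ ≤ nearest X {j | j ≠ i} ω := hω.1.1
    have h2 : ‖X j ω‖ₑ ≤ nearest X {k | k ≠ j} ω := hω.2.1
    have h3 : nearest X {j | j ≠ i} ω ≤ ‖X j ω‖ₑ := iInf_le (fun k : {j | j ≠ i} => ‖X k ω‖ₑ)
      ⟨j, hij.symm⟩
    have h4 : nearest X {k | k ≠ j} ω ≤ ‖X i ω‖ₑ := iInf_le (fun k : {k | k ≠ j} => ‖X k ω‖ₑ)
      ⟨i, hij⟩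
    exact le_antisymm h1 (h3.trans (h2.trans h4))
  have hx : ∀ᵐ x : Plane, ((gammaMeasure m m).prod P)
          {p | (p.1, x, totalPower α X g Set.univ p.2, nearest X Set.univ p.2) ∈ E}
      = (fun r => ENNReal.ofReal (∑ k ∈ Finset.range m,
          coverageTerm α θ m (Real.pi * lam * r ^ 2) k)) ‖x‖ := by
    have h0 : ∀ᵐ x : Plane, x ∉ ({0} : Set Plane) :=
      measure_eq_zero_iff_ae_notMem.1 (measure_singleton _)
    filter_upwards [h0] with x hx0
    exact hnet.coverage_nearest hlam hα hθ hm hx0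
  have mk : Measurable fun r : ℝ => ENNReal.ofReal (∑ k ∈ Finset.range m,
      coverageTerm α θ m (Real.pi * lam * r ^ 2) k) :=
    (measurable_sum_coverageTerm α θ m).comp (by fun_prop)
  rw [coverageProb, hev, measure_iUnion₀ hdisj fun i => (mU i).nullMeasurableSet,
    hnet.tsum_measure α mE, lintegral_congr_ae hx, lintegral_norm_plane mk,
    ← (setLIntegral_coverageTerm hα hθ hm (hnet.coverageTerm_nonneg hlam hα hθ hm)).1,
    ← setLIntegral_comp_sq hc fun u => ENNReal.ofReal (∑ k ∈ Finset.range m,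
      coverageTerm α θ m u k), ← lintegral_const_mul' _ _ ENNReal.ofReal_ne_top]
  refine setLIntegral_congr_fun measurableSet_Ioi fun r hr => ?_
  have hr0 : (0 : ℝ) < r := hr
  rw [← mul_assoc, ← ENNReal.ofReal_mul hlam.le]
  congr 2
  ring

/-! ### Strongest base station association -/

/-- For `θ ≥ 1` at most one base station has an SIR exceeding `θ`, and it is the strongest. -/
lemma IsLOSNetwork.coverageProb_strongest_eq_unifiedCoverage (hnet : IsLOSNetwork lam m X g P)
    (hlam : 0 < lam) (hα : 2 < α) (hθ : 1 ≤ θ) :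
    coverageProb .strongest α θ X g P = unifiedCoverage .strongest lam α θ m X g P := by
  have := hnet.isProbabilityMeasure_gain
  have mJ := hnet.measurable_totalPower α
  have mR := hnet.ppp.measurable_nearest
  have mX := hnet.ppp.measurable
  have mpl := measurable_pathloss α
  have hθ0 : 0 < θ := one_pos.trans_le hθ
  have hθ1 : (1 : ℝ≥0∞) ≤ ENNReal.ofReal θ := ENNReal.one_le_ofReal.2 hθ
  set E : Set (ℝ × Plane × ℝ≥0∞ × ℝ≥0∞) := {p |
    ENNReal.ofReal θ * p.2.2.1 < pathloss α p.2.1 * ENNReal.ofReal p.1} with hE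
  have mE : MeasurableSet E := measurableSet_lt (by fun_prop) (by fun_prop)
  set U : ℕ → Set Ω := fun i =>
    {ω | (g i ω, X i ω, totalPower α X g {j | j ≠ i} ω, nearest X {j | j ≠ i} ω) ∈ E} with hU
  have mU : ∀ i, MeasurableSet (U i) := fun i =>
    ((hnet.gain_measurable i).prodMk ((mX i).prodMk ((mJ _).prodMk (mR _)))) mE
  have hUiff : ∀ i ω, ω ∈ U i ↔
      ENNReal.ofReal θ * totalPower α X g {j | j ≠ i} ω < rxPower α X g i ω := by
    intro i ω
    rw [rxPower_eq]
    rfl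
  have hsir : ∀ i ω, ENNReal.ofReal θ < sir α X g i ω ↔ ω ∈ U i := by
    intro i ω
    rw [hUiff, sir, ENNReal.lt_div_iff_mul_lt (Or.inr ENNReal.ofReal_ne_top)
      (Or.inr (ENNReal.ofReal_pos.2 hθ0).ne')]
    rfl
  have hlt : ∀ i j ω, j ≠ i → ω ∈ U i → rxPower α X g j ω < rxPower α X g i ω := by
    intro i j ω hji hω
    have h1 : rxPower α X g j ω ≤ totalPower α X g {j | j ≠ i} ω :=
      ENNReal.le_tsum (f := fun k : {j | j ≠ i} => rxPower α X g k ω) ⟨j, hji⟩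
    exact h1.trans_lt ((le_mul_of_one_le_left' hθ1).trans_lt ((hUiff i ω).1 hω))
  have hev : {ω | ∃ i, IsServing α X g ω .strongest i ∧ ENNReal.ofReal θ < sir α X g i ω}
      = ⋃ i, U i := by
    ext ω
    rw [Set.mem_iUnion]
    refine exists_congr fun i => ⟨fun h => (hsir i ω).1 h.2, fun h => ⟨fun j => ?_, (hsir i ω).2 h⟩⟩
    by_cases hj : j = i
    · rw [hj]
    have h1 : rxPower α X g i ω ≤ totalPower α X g {k | k ≠ j} ω :=
      ENNReal.le_tsum (f := fun k : {k | k ≠ j} => rxPower α X g k ω) ⟨i, Ne.symm hj⟩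
    have h2 : sir α X g j ω ≤ 1 :=
      ENNReal.div_le_of_le_mul (by rw [one_mul]; exact (hlt i j ω hj h).le.trans h1)
    exact h2.trans (hθ1.trans ((hsir i ω).2 h).le)
  have hdisj : Pairwise (Function.onFun Disjoint U) := by
    intro i j hij
    refine Set.disjoint_left.2 fun ω h1 h2 => ?_
    exact lt_asymm (hlt i j ω hij.symm h1) (hlt j i ω hij h2)
  set K : ℝ → ℝ≥0∞ := fun r => ((gammaMeasure m m).prod P) {p : ℝ × Ω | ENNReal.ofReal θ *
    totalPower α X g Set.univ p.2 < ENNReal.ofReal (r ^ (-α)) * ENNReal.ofReal p.1} with hK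
  have mK : Measurable K := by
    have mS : MeasurableSet {q : ℝ × ℝ × Ω | ENNReal.ofReal θ * totalPower α X g Set.univ q.2.2
        < ENNReal.ofReal (q.1 ^ (-α)) * ENNReal.ofReal q.2.1} :=
      measurableSet_lt (((mJ _).comp (measurable_snd.comp measurable_snd)).const_mul _)
        (by fun_prop)
    exact measurable_measure_prodMk_left mS
  have hx : ∀ x : Plane, ((gammaMeasure m m).prod P)
      {p | (p.1, x, totalPower α X g Set.univ p.2, nearest X Set.univ p.2) ∈ E} = K ‖x‖ :=
    fun x => rfl
  rw [coverageProb, hev, measure_iUnion hdisj mU, hnet.tsum_measure α mE, lintegral_congr hx,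
    lintegral_norm_plane mK, unifiedCoverage, ← lintegral_const_mul' _ _ ENNReal.ofReal_ne_top]
  refine setLIntegral_congr_fun measurableSet_Ioi fun r hr => ?_
  have hr0 : (0 : ℝ) < r := hr
  have hset : {p : ℝ × Ω | ENNReal.ofReal θ < ENNReal.ofReal (p.1 * r ^ (-α)) /
        interferenceBeyond α X g 0 p.2} = {p : ℝ × Ω | ENNReal.ofReal θ *
      totalPower α X g Set.univ p.2 < ENNReal.ofReal (r ^ (-α)) * ENNReal.ofReal p.1} := by
    ext p
    rw [Set.mem_ofPred_eq, Set.mem_ofPred_eq, interferenceBeyond_zero hα,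
      ENNReal.lt_div_iff_mul_lt (Or.inr ENNReal.ofReal_ne_top)
      (Or.inr (ENNReal.ofReal_pos.2 hθ0).ne'), mul_comm p.1,
      ENNReal.ofReal_mul (Real.rpow_nonneg hr0.le _)]
  dsimp only [exclusionRadius, servingDensity]
  rw [hset, mul_comm _ (ENNReal.ofReal (2 * Real.pi * lam * r)), ← mul_assoc,
    ← ENNReal.ofReal_mul hlam.le]
  congr 2
  ring

end Network

/-! ### The fractional moments behind the Rayleigh value -/

lemma ae_pos_gamma {m : ℕ} (hm : 1 ≤ m) : ∀ᵐ h ∂(gammaMeasure m m), 0 < h := by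
  have hm0 : (0 : ℝ) < m := by exact_mod_cast hm
  have := isProbabilityMeasure_gammaMeasure hm0 hm0
  refine (mem_ae_iff_prob_eq_one measurableSet_Ioi).2 ?_
  rw [gammaMeasure_Ioi hm le_rfl, Finset.sum_eq_single_of_mem 0 (Finset.mem_range.2 hm)]
  · simp
  · intro k _ hk
    simp [hk]

/-- The moment of order `d` of the gains is positive and finite. Only this matters, as it cancels in
the end. -/
lemma exists_moment_gamma {m : ℕ} (hm : 1 ≤ m) {d : ℝ} (hd : 0 < d) :
    ∃ M : ℝ, 0 < M ∧ ∫⁻ h, ENNReal.ofReal (h ^ d) ∂(gammaMeasure m m) = ENNReal.ofReal M := by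
  have hm0 : (0 : ℝ) < m := by exact_mod_cast hm
  have mpdf : Measurable (gammaPDF m m) :=
    ENNReal.measurable_ofReal.comp (measurable_gammaPDFReal _ _)
  have hΓ : 0 < Real.Gamma m := Real.Gamma_pos_of_pos hm0
  have hΓ' : 0 < Real.Gamma (m + d) := Real.Gamma_pos_of_pos (by positivity)
  refine ⟨(m : ℝ) ^ (m : ℝ) / Real.Gamma m * ((1 / (m : ℝ)) ^ (m + d) * Real.Gamma (m + d)),
    by positivity, ?_⟩
  have hpt : ∀ h, gammaPDF m m h * ENNReal.ofReal (h ^ d) = (Set.Ioi 0).indicator (fun h =>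
      ENNReal.ofReal ((m : ℝ) ^ (m : ℝ) / Real.Gamma m) *
        ENNReal.ofReal (h ^ (m + d - 1) * Real.exp (-(m * h)))) h := by
    intro h
    rcases lt_trichotomy h 0 with hh | rfl | hh
    · rw [gammaPDF_of_neg hh, zero_mul, Set.indicator_of_notMem (by simpa using hh.le)]
    · simp [Real.zero_rpow hd.ne']
    · rw [gammaPDF_of_nonneg hh.le, Set.indicator_of_mem (show h ∈ Set.Ioi 0 from hh),
        ← ENNReal.ofReal_mul (by positivity), ← ENNReal.ofReal_mul (by positivity)]
      congr 1
      have e : (m : ℝ) + d - 1 = (m - 1) + d := by ring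
      rw [e, Real.rpow_add hh]
      ring
  rw [gammaMeasure, lintegral_withDensity_eq_lintegral_mul _ mpdf (by fun_prop)]
  simp only [Pi.mul_apply]
  rw [lintegral_congr hpt, lintegral_indicator measurableSet_Ioi,
    lintegral_const_mul' _ _ ENNReal.ofReal_ne_top,
    lintegral_rpow_mul_exp_neg_mul (by positivity) hm0, ← ENNReal.ofReal_mul (by positivity)]

lemma setLIntegral_rpow_mul_exp_neg_mul_rpow {d C : ℝ} (hd : 0 < d) (hC : 0 < C) :
    ∫⁻ s in Set.Ioi (0 : ℝ), ENNReal.ofReal (s ^ (d - 1) * Real.exp (-(C * s ^ d)))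
      = ENNReal.ofReal (1 / (d * C)) := by
  have h := integral_rpow_mul_exp_neg_mul_rpow hd (q := d - 1) (by linarith) hC
  rw [sub_add_cancel, div_self hd.ne', Real.Gamma_one, mul_one, neg_div, div_self hd.ne',
    Real.rpow_neg_one] at h
  have e : C⁻¹ * (1 / d) = 1 / (d * C) := by field_simp
  rw [e] at h
  simp_rw [neg_mul] at h
  have hi : IntegrableOn (fun s : ℝ => s ^ (d - 1) * Real.exp (-(C * s ^ d))) (Set.Ioi 0) :=
    Integrable.of_integral_ne_zero (by rw [h]; positivity)
  rw [← h, ofReal_integral_eq_lintegral_ofReal hi]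
  refine (ae_restrict_iff' measurableSet_Ioi).2 (Eventually.of_forall fun s hs => ?_)
  exact mul_nonneg (Real.rpow_nonneg (le_of_lt hs) _) (Real.exp_nonneg _)

/-- The radial integral of the coverage event, which is a multiple of `I^{-2/α}`, as a mixture of
exponentials in the interference `I`. -/
lemma setLIntegral_coverage_radial {α θ h : ℝ} (hα : 2 < α) (hθ : 0 < θ) (hh : 0 < h) {I : ℝ≥0∞}
    (hI : I ≠ 0) :
    ∫⁻ r in Set.Ioi (0 : ℝ), ENNReal.ofReal (2 * Real.pi * r) *
        {r : ℝ | ENNReal.ofReal θ * I < ENNReal.ofReal (r ^ (-α)) * ENNReal.ofReal h}.indicator 1 r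
      = ENNReal.ofReal (Real.pi * (h / θ) ^ (2 / α) / Real.Gamma (2 / α)) *
        ∫⁻ s in Set.Ioi (0 : ℝ),
          ENNReal.ofReal (s ^ (2 / α - 1)) * expNeg (ENNReal.ofReal s * I) := by
  have hd0 := two_div_pos hα
  have hΓ := Real.Gamma_pos_of_pos hd0
  rcases eq_or_ne I ∞ with rfl | hI'
  · have h1 : ∀ r : ℝ, r ∉ {r : ℝ | ENNReal.ofReal θ * ∞ <
        ENNReal.ofReal (r ^ (-α)) * ENNReal.ofReal h} := by
      intro r hr
      rw [Set.mem_ofPred_eq, ENNReal.mul_top (ENNReal.ofReal_pos.2 hθ).ne'] at hr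
      exact not_top_lt hr
    have h2 : ∀ s ∈ Set.Ioi (0 : ℝ), ENNReal.ofReal (s ^ (2 / α - 1)) *
        expNeg (ENNReal.ofReal s * ∞) = 0 := by
      intro s hs
      rw [ENNReal.mul_top (ENNReal.ofReal_pos.2 hs).ne', expNeg_top, mul_zero]
    rw [setLIntegral_congr_fun measurableSet_Ioi h2]
    simp [Set.indicator_of_notMem (h1 _)]
  obtain ⟨t, ht, rfl⟩ : ∃ t : ℝ, 0 < t ∧ I = ENNReal.ofReal t :=
    ⟨I.toReal, ENNReal.toReal_pos hI hI', (ENNReal.ofReal_toReal hI').symm⟩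
  have h1 : ∀ r ∈ Set.Ioi (0 : ℝ), ENNReal.ofReal (2 * Real.pi * r) *
        {r : ℝ | ENNReal.ofReal θ * ENNReal.ofReal t <
          ENNReal.ofReal (r ^ (-α)) * ENNReal.ofReal h}.indicator 1 r
      = ENNReal.ofReal (2 * Real.pi * r) * (Set.Iio ((h / (θ * t)) ^ (1 / α))).indicator 1 r := by
    intro r hr
    have hr0 : (0 : ℝ) < r := hr
    have hra := Real.rpow_pos_of_pos hr0 α
    have hiff : r < (h / (θ * t)) ^ (1 / α) ↔ ENNReal.ofReal θ * ENNReal.ofReal t <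
          ENNReal.ofReal (r ^ (-α)) * ENNReal.ofReal h := by
      rw [← ENNReal.ofReal_mul hθ.le, ← ENNReal.ofReal_mul (Real.rpow_nonneg hr0.le _),
        ENNReal.ofReal_lt_ofReal_iff (mul_pos (Real.rpow_pos_of_pos hr0 _) hh), one_div,
        Real.lt_rpow_inv_iff_of_pos hr0.le (by positivity) (by linarith),
        lt_div_iff₀ (by positivity), Real.rpow_neg hr0.le, inv_mul_eq_div, lt_div_iff₀ hra,
        mul_comm (r ^ α)]
    simp only [Set.indicator, Set.mem_Iio, Set.mem_ofPred_eq, hiff]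
    congr
  have h2 : ∀ s ∈ Set.Ioi (0 : ℝ), ENNReal.ofReal (s ^ (2 / α - 1)) *
      expNeg (ENNReal.ofReal s * ENNReal.ofReal t)
      = ENNReal.ofReal (s ^ (2 / α - 1) * Real.exp (-(t * s))) := by
    intro s hs
    have hs0 : (0 : ℝ) < s := hs
    rw [← ENNReal.ofReal_mul hs0.le, expNeg_ofReal (by positivity),
      ← ENNReal.ofReal_mul (Real.rpow_nonneg hs0.le _), mul_comm s]
  rw [setLIntegral_congr_fun measurableSet_Ioi h1, setLIntegral_congr_fun measurableSet_Ioi h2,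
    setLIntegral_Ioo_two_pi_mul (by positivity), lintegral_rpow_mul_exp_neg_mul hd0 ht,
    ← ENNReal.ofReal_mul (by positivity)]
  congr 1
  have e1 : 1 / α * ((2 : ℕ) : ℝ) = 2 / α := by push_cast; ring
  have e2 : h / (θ * t) = h / θ * (1 / t) := by field_simp
  rw [← Real.rpow_natCast, ← Real.rpow_mul (by positivity), e1, e2,
    Real.mul_rpow (by positivity) (by positivity)]
  field_simp

/-- By `Γ(1 - d) = -d Γ(-d)` and `Γ(1 + d) = d Γ(d)`. -/
lemma two_mul_zeta_one {α : ℝ} (hα : 2 < α) :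
    2 * zeta α 1 = 2 / α * Real.Gamma (2 / α) * Real.Gamma (1 - 2 / α) := by
  have hd0 := two_div_pos hα
  have hα0 : α ≠ 0 := by linarith
  have h1 := Real.Gamma_add_one hd0.ne'
  have h2 := Real.Gamma_add_one (neg_ne_zero.2 hd0.ne')
  rw [neg_add_eq_sub] at h2
  rw [zeta, Nat.cast_one, Real.Gamma_one, add_comm 1, h1, h2]
  field_simp

lemma strongestClosedForm_pos {α θ : ℝ} (hα : 2 < α) (hθ : 0 < θ) :
    0 < strongestClosedForm α θ := by
  have hd0 := two_div_pos hα
  have h1 := Real.Gamma_pos_of_pos hd0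
  have h2 := Real.Gamma_pos_of_pos (sub_pos.2 (two_div_lt_one hα))
  rw [strongestClosedForm, two_mul_zeta_one hα]
  positivity

section Network

variable {lam α θ : ℝ} {m : ℕ} {X : ℕ → Ω → Plane} {g : ℕ → Ω → ℝ} {P : Measure Ω}
  [IsProbabilityMeasure P]

/-- The total power is stable with exponent `2/α`. -/
lemma IsLOSNetwork.laplace_totalPower (hnet : IsLOSNetwork lam m X g P) (hlam : 0 < lam)
    (hα : 2 < α) (hm : 1 ≤ m) {M : ℝ} (hM : 0 < M)
    (hMγ : ∫⁻ h, ENNReal.ofReal (h ^ (2 / α)) ∂(gammaMeasure m m) = ENNReal.ofReal M) {s : ℝ}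
    (hs : 0 < s) :
    ∫⁻ ω, expNeg (ENNReal.ofReal s * totalPower α X g Set.univ ω) ∂P
      = ENNReal.ofReal (Real.exp
          (-(lam * Real.pi * Real.Gamma (1 - 2 / α) * M * s ^ (2 / α)))) := by
  have := hnet.isProbabilityMeasure_gain
  have hΓ := Real.Gamma_pos_of_pos (sub_pos.2 (two_div_lt_one hα))
  have h := hnet.laplace_gains (w := fun x => ENNReal.ofReal s * pathloss α x)
    ((measurable_pathloss α).const_mul _)
  have e : ∀ ω, ∑' j, ENNReal.ofReal s * pathloss α (X j ω) * ENNReal.ofReal (g j ω)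
      = ENNReal.ofReal s * totalPower α X g Set.univ ω := by
    intro ω
    rw [totalPower, tsum_univ fun j => rxPower α X g j ω, ← ENNReal.tsum_mul_left]
    simp_rw [rxPower_eq, mul_assoc]
  simp_rw [e] at h
  rw [h]
  set k : ℝ → ℝ≥0∞ := fun v => 1 - expNeg (markExponent (gammaMeasure m m)
    (ENNReal.ofReal s * ENNReal.ofReal (v ^ (-α)))) with hk
  have mk : Measurable k := by
    have := measurable_markExponent (gammaMeasure m m)
    fun_prop
  have hkx : ∀ x : Plane, 1 - expNeg (markExponent (gammaMeasure m m)
      (ENNReal.ofReal s * pathloss α x)) = k ‖x‖ := fun x => rfl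
  have h1 : ∀ v ∈ Set.Ioi (0 : ℝ), ENNReal.ofReal (2 * Real.pi * v) * k v
      = ∫⁻ h, ENNReal.ofReal (2 * Real.pi * v) *
        (1 - expNeg (ENNReal.ofReal s * ENNReal.ofReal (v ^ (-α)) * ENNReal.ofReal h))
          ∂(gammaMeasure m m) := by
    intro v hv
    rw [lintegral_const_mul' _ _ ENNReal.ofReal_ne_top, hk]
    dsimp only
    rw [expNeg_markExponent, lintegral_sub (by fun_prop), lintegral_one, measure_univ]
    · exact ne_top_of_le_ne_top ENNReal.one_ne_top
        ((lintegral_mono fun _ => expNeg_le_one _).trans (by simp))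
    · exact Eventually.of_forall fun _ => expNeg_le_one _
  have h2 : ∀ᵐ h ∂(gammaMeasure m m), ∫⁻ v in Set.Ioi (0 : ℝ), ENNReal.ofReal (2 * Real.pi * v) *
        (1 - expNeg (ENNReal.ofReal s * ENNReal.ofReal (v ^ (-α)) * ENNReal.ofReal h))
      = ENNReal.ofReal (Real.pi * Real.Gamma (1 - 2 / α) * s ^ (2 / α)) *
        ENNReal.ofReal (h ^ (2 / α)) := by
    filter_upwards [ae_pos_gamma hm] with h hh
    have e3 := setLIntegral_Ioi_zero_one_sub_expNeg hα (a := s * h) (by positivity)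
    rw [Real.mul_rpow hs.le hh.le, ← mul_assoc, ENNReal.ofReal_mul (by positivity)] at e3
    rw [← e3]
    refine setLIntegral_congr_fun measurableSet_Ioi fun v hv => ?_
    have hv0 : (0 : ℝ) < v := hv
    rw [mul_right_comm (ENNReal.ofReal s), ← ENNReal.ofReal_mul hs.le,
      ← ENNReal.ofReal_mul (by positivity)]
  rw [lintegral_congr hkx, lintegral_norm_plane mk, setLIntegral_congr_fun measurableSet_Ioi h1,
    lintegral_lintegral_swap (by fun_prop), lintegral_congr_ae h2,
    lintegral_const_mul' _ _ ENNReal.ofReal_ne_top, hMγ, ← ENNReal.ofReal_mul (by positivity),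
    ← ENNReal.ofReal_mul hlam.le, expNeg_ofReal (by positivity)]
  congr 3
  ring

/-- There is interference almost surely, since its Laplace transform tends to `0` at infinity. -/
lemma IsLOSNetwork.ae_totalPower_ne_zero (hnet : IsLOSNetwork lam m X g P) (hlam : 0 < lam)
    (hα : 2 < α) (hm : 1 ≤ m) : ∀ᵐ ω ∂P, totalPower α X g Set.univ ω ≠ 0 := by
  have hd0 := two_div_pos hα
  have hΓ := Real.Gamma_pos_of_pos (sub_pos.2 (two_div_lt_one hα))
  obtain ⟨M, hM, hMγ⟩ := exists_moment_gamma hm hd0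
  have m0 : MeasurableSet {ω | totalPower α X g Set.univ ω = 0} :=
    hnet.measurable_totalPower α Set.univ (measurableSet_singleton 0)
  set C := lam * Real.pi * Real.Gamma (1 - 2 / α) * M with hC
  have hC0 : 0 < C := by positivity
  have hle : ∀ s : ℝ, 0 < s → P {ω | totalPower α X g Set.univ ω = 0}
      ≤ ENNReal.ofReal (Real.exp (-(C * s ^ (2 / α)))) := by
    intro s hs
    rw [← hnet.laplace_totalPower hlam hα hm hM hMγ hs, ← lintegral_indicator_one m0]
    refine lintegral_mono fun ω => ?_
    by_cases hω : totalPower α X g Set.univ ω = 0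
    · rw [hω, mul_zero, expNeg_zero]
      exact Set.indicator_le_self' (fun _ _ => zero_le) ω
    · rw [Set.indicator_of_notMem (show ω ∉ {ω | totalPower α X g Set.univ ω = 0} from hω)]
      exact zero_le
  have hlim : Tendsto (fun s : ℝ => ENNReal.ofReal (Real.exp (-(C * s ^ (2 / α))))) atTop
      (𝓝 0) := by
    rw [← ENNReal.ofReal_zero]
    exact ENNReal.tendsto_ofReal (Real.tendsto_exp_neg_atTop_nhds_zero.comp
      ((tendsto_rpow_atTop hd0).const_mul_atTop hC0))
  have h0 : P {ω | totalPower α X g Set.univ ω = 0} ≤ 0 :=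
    ge_of_tendsto hlim (by filter_upwards [eventually_gt_atTop 0] with s hs using hle s hs)
  rw [ae_iff]
  simpa using h0

/-- The fading law enters only through `E[g^{2/α}]`, which cancels between the useful signal and the
interference. -/
lemma IsLOSNetwork.unifiedCoverage_strongest (hnet : IsLOSNetwork lam m X g P) (hlam : 0 < lam)
    (hα : 2 < α) (hθ : 0 < θ) (hm : 1 ≤ m) :
    unifiedCoverage .strongest lam α θ m X g P = ENNReal.ofReal (strongestClosedForm α θ) := by
  have := hnet.isProbabilityMeasure_gain
  have hd0 := two_div_pos hα
  have hΓ := Real.Gamma_pos_of_pos (sub_pos.2 (two_div_lt_one hα))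
  have hΓ2 := Real.Gamma_pos_of_pos hd0
  obtain ⟨M, hM, hMγ⟩ := exists_moment_gamma hm hd0
  have mJ := hnet.measurable_totalPower α Set.univ
  set J := totalPower α X g Set.univ with hJ
  set C := lam * Real.pi * Real.Gamma (1 - 2 / α) * M with hC
  have hC0 : 0 < C := by positivity
  set S : Set (ℝ × ℝ × Ω) := {q | ENNReal.ofReal θ * J q.2.2
      < ENNReal.ofReal (q.1 ^ (-α)) * ENNReal.ofReal q.2.1} with hS
  have mS : MeasurableSet S :=
    measurableSet_lt ((mJ.comp (measurable_snd.comp measurable_snd)).const_mul _) (by fun_prop)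
  have hset : ∀ r ∈ Set.Ioi (0 : ℝ), ((gammaMeasure m m).prod P)
        {p : ℝ × Ω | ENNReal.ofReal θ < ENNReal.ofReal (p.1 * r ^ (-α)) /
          interferenceBeyond α X g (exclusionRadius .strongest r) p.2} *
        ENNReal.ofReal (servingDensity lam .strongest r)
      = ∫⁻ q, ENNReal.ofReal lam * (ENNReal.ofReal (2 * Real.pi * r) * S.indicator 1 (r, q))
          ∂((gammaMeasure m m).prod P) := by
    intro r hr
    have hr0 : (0 : ℝ) < r := hr
    have h1 : {p : ℝ × Ω | ENNReal.ofReal θ < ENNReal.ofReal (p.1 * r ^ (-α)) /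
        interferenceBeyond α X g 0 p.2} = Prod.mk r ⁻¹' S := by
      ext p
      rw [Set.mem_ofPred_eq, Set.mem_preimage, hS, Set.mem_ofPred_eq, interferenceBeyond_zero hα,
        ENNReal.lt_div_iff_mul_lt (Or.inr ENNReal.ofReal_ne_top)
        (Or.inr (ENNReal.ofReal_pos.2 hθ).ne'), mul_comm p.1,
        ENNReal.ofReal_mul (Real.rpow_nonneg hr0.le _)]
    dsimp only [exclusionRadius, servingDensity]
    rw [lintegral_const_mul' _ _ ENNReal.ofReal_ne_top,
      lintegral_const_mul' _ _ ENNReal.ofReal_ne_top, h1,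
      ← lintegral_indicator_one (measurable_prodMk_left mS), mul_comm, ← mul_assoc,
      ← ENNReal.ofReal_mul hlam.le]
    congr 2
    ring
  have hin : ∀ᵐ h ∂(gammaMeasure m m), ∫⁻ ω, (∫⁻ r in Set.Ioi (0 : ℝ), ENNReal.ofReal lam *
      (ENNReal.ofReal (2 * Real.pi * r) * S.indicator 1 (r, h, ω))) ∂P
      = ENNReal.ofReal (lam * (Real.pi * (1 / θ) ^ (2 / α) / Real.Gamma (2 / α)) *
          (1 / (2 / α * C))) * ENNReal.ofReal (h ^ (2 / α)) := by
    filter_upwards [ae_pos_gamma hm] with h hh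
    have h1 : ∀ᵐ ω ∂P, ∫⁻ r in Set.Ioi (0 : ℝ), ENNReal.ofReal lam *
        (ENNReal.ofReal (2 * Real.pi * r) * S.indicator 1 (r, h, ω))
        = ENNReal.ofReal lam * (ENNReal.ofReal (Real.pi * (h / θ) ^ (2 / α) / Real.Gamma (2 / α)) *
          ∫⁻ s in Set.Ioi (0 : ℝ), ENNReal.ofReal (s ^ (2 / α - 1)) *
            expNeg (ENNReal.ofReal s * J ω)) := by
      filter_upwards [hnet.ae_totalPower_ne_zero hlam hα hm] with ω hω
      rw [lintegral_const_mul' _ _ ENNReal.ofReal_ne_top,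
        ← setLIntegral_coverage_radial hα hθ hh hω]
      rfl
    have h2 : ∀ s ∈ Set.Ioi (0 : ℝ), ∫⁻ ω, ENNReal.ofReal (s ^ (2 / α - 1)) *
        expNeg (ENNReal.ofReal s * J ω) ∂P
        = ENNReal.ofReal (s ^ (2 / α - 1) * Real.exp (-(C * s ^ (2 / α)))) := by
      intro s hs
      have hs0 : (0 : ℝ) < s := hs
      rw [lintegral_const_mul' _ _ ENNReal.ofReal_ne_top,
        hnet.laplace_totalPower hlam hα hm hM hMγ hs0,
        ← ENNReal.ofReal_mul (Real.rpow_nonneg hs0.le _)]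
    rw [lintegral_congr_ae h1, lintegral_const_mul' _ _ ENNReal.ofReal_ne_top,
      lintegral_const_mul' _ _ ENNReal.ofReal_ne_top, lintegral_lintegral_swap (by fun_prop),
      setLIntegral_congr_fun measurableSet_Ioi h2, setLIntegral_rpow_mul_exp_neg_mul_rpow hd0 hC0,
      ← ENNReal.ofReal_mul (by positivity), ← ENNReal.ofReal_mul (by positivity),
      ← ENNReal.ofReal_mul (by positivity)]
    congr 1
    rw [div_eq_mul_one_div h, Real.mul_rpow hh.le (by positivity)]
    ring
  have mI : Measurable fun p : ℝ × ℝ × Ω => ENNReal.ofReal lam *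
      (ENNReal.ofReal (2 * Real.pi * p.1) * S.indicator (1 : ℝ × ℝ × Ω → ℝ≥0∞) (p.1, p.2)) := by
    have mi : Measurable (S.indicator (1 : ℝ × ℝ × Ω → ℝ≥0∞)) := measurable_one.indicator mS
    fun_prop
  have mI2 : Measurable fun q : ℝ × Ω => ∫⁻ r in Set.Ioi (0 : ℝ), ENNReal.ofReal lam *
      (ENNReal.ofReal (2 * Real.pi * r) * S.indicator 1 (r, q)) := mI.lintegral_prod_left'
  rw [unifiedCoverage, setLIntegral_congr_fun measurableSet_Ioi hset,
    lintegral_lintegral_swap mI.aemeasurable, lintegral_prod _ mI2.aemeasurable,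
    lintegral_congr_ae hin, lintegral_const_mul' _ _ ENNReal.ofReal_ne_top, hMγ,
    ← ENNReal.ofReal_mul (by positivity)]
  congr 1
  rw [strongestClosedForm, two_mul_zeta_one hα, hC, one_div θ, Real.inv_rpow hθ.le]
  have : 0 < θ ^ (2 / α) := Real.rpow_pos_of_pos hθ _
  field_simp

end Network

end CellularCoverage

theorem mainTheorem2 {Ω : Type*} [MeasurableSpace Ω] (P : MeasureTheory.Measure Ω)
    [MeasureTheory.IsProbabilityMeasure P]
    (lam α θ : ℝ) (m : ℕ) (hlam : 0 < lam) (hα : 2 < α) (hθ : 0 < θ) (hm : 1 ≤ m)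
    (X : ℕ → Ω → CellularCoverage.Plane) (g : ℕ → Ω → ℝ)
    (hnet : CellularCoverage.IsLOSNetwork lam m X g P) :
    (CellularCoverage.coverageProb .closest α θ X g P =
        ENNReal.ofReal (CellularCoverage.closestClosedForm α θ m) ∧
      CellularCoverage.unifiedCoverage .closest lam α θ m X g P =
        ENNReal.ofReal (CellularCoverage.closestClosedForm α θ m) ∧
      0 < CellularCoverage.closestClosedForm α θ m) ∧
    (CellularCoverage.unifiedCoverage .strongest lam α θ m X g P =
        ENNReal.ofReal (CellularCoverage.strongestClosedForm α θ) ∧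
      (1 ≤ θ → CellularCoverage.coverageProb .strongest α θ X g P =
        ENNReal.ofReal (CellularCoverage.strongestClosedForm α θ)) ∧
      0 < CellularCoverage.strongestClosedForm α θ) := by
  have hs := hnet.unifiedCoverage_strongest hlam hα hθ hm
  exact ⟨⟨hnet.coverageProb_closest hlam hα hθ hm, hnet.unifiedCoverage_closest hlam hα hθ hm,
    (CellularCoverage.setLIntegral_coverageTerm hα hθ hm
      (hnet.coverageTerm_nonneg hlam hα hθ hm)).2⟩,
    hs, fun hθ1 => (hnet.coverageProb_strongest_eq_unifiedCoverage hlam hα hθ1).trans hs,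
    CellularCoverage.strongestClosedForm_pos hα hθ⟩
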